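/- For each $n\ge 1$ let $Q$ be a random symmetric $n\times n$ matrix from the Gaussian Orthogonal Ensemble normalized so that the entries $Q_{ij}$, $i\le j$, are independent, $Q_{ii}\sim N(0,1)$ and $Q_{ij}\sim N(0,\tfrac12)$ for $i<j$. Consider the standard quadratic program $$\min\{x^\top Qx : x\in\Delta^{n-1}\},\qquad \Delta^{n-1}=\Big\{x\in\mathbb R^n: x_i\ge 0,\ \sum_i x_i=1\Big\}.$$ Almost surely this problem has a unique global minimizer $x^\star$; let $\kappa_n=|\{i: x^\star_i>0\}|$, which is a random variable defined almost surely. Let $Z_{(1)}\le\dots\le Z_{(n)}$ be the ordered diagonal entries of $Q$, let $\Phi$ be the standard normal distribution function, and put $$q_n=\Phi(\sqrt2\,Z_{(1)}),\qquad p_{ij}=\Phi(\sqrt2\,\tau_{ij}),\qquad \tau_{ij}=Z_{(1)}-\sqrt{(Z_{(i)}-Z_{(1)})(Z_{(j)}-Z_{(1)})}\quad(1\le i<j\le n),$$ $$S_n=\mathbb E\big[1-(1-q_n)^{n-1}\big],\qquad A_n=\mathbb E\Big[(1-q_n)^{n-1}\Big(1-\prod_{j=3}^n(1-p_{2j})\Big)\Big],$$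 $$B_n=\mathbb E\Big[(1-q_n)^{n-1}\prod_{j=3}^n(1-p_{2j})\Big(1-\prod_{3\le i<j\le n}(1-p_{ij})\Big)\Big].$$ Then, as $n\to\infty$, $$\mathbb P(\kappa_n=2)=S_n+A_n+B_n+o(B_n),\qquad \mathbb P(\kappa_n>1)=S_n+A_n+B_n+o(B_n),$$ $$\mathbb P(\kappa_n=1)=1-S_n-A_n-B_n+o(B_n),$$ where $$S_n\sim 2\sqrt{2\pi}\,\frac{\sqrt{\log n}}{n},\qquad A_n\sim 3\sqrt{\frac{\pi}{2}}\,\frac{1}{n\sqrt{\log n}},\qquad B_n\sim 9\sqrt{\frac{\pi}{2}}\,\frac{1}{n(\log n)^{3/2}}.$$ Consequently $\mathbb P(\kappa_n>1)\sim\mathbb P(\kappa_n=2)\sim 2\sqrt{2\pi}\,\sqrt{\log n}/n$, that is, $$\lim_{n\to\infty}\frac{n}{\sqrt{\log n}}\,\mathbb P(\kappa_n>1)=\lim_{n\to\infty}\frac{n}{\sqrt{\log n}}\,\mathbb P(\kappa_n=2)=2\sqrt{2\pi},$$ and $\mathbb P(\kappa_n=1)=1-\Theta(\sqrt{\log n}/n)$.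 Likewise the probability that the vertex $e_i$ of $\Delta^{n-1}$ at the index $i$ of the smallest diagonal entry $Q_{ii}$ is a global minimizer is $1-\Theta(\sqrt{\log n}/n)$. -/

import Mathlib

open MeasureTheory ProbabilityTheory Filter Asymptotics Topology
open scoped NNReal Matrix

namespace StQP

/-- The random matrix `Q` has the GOE law in the normalization with diagonal entries `N(0, 1)`
and off-diagonal entries `N(0, 1/2)`: it is symmetric and its entries on and above the diagonal
are jointly independent. -/
structure IsGOE {n : ℕ} {Ω : Type*} [MeasurableSpace Ω] (P : Measure Ω)
    (Q : Ω → Matrix (Fin n) (Fin n) ℝ) : Prop where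
  symm : ∀ ω, (Q ω).IsSymm
  diag : ∀ i, HasLaw (fun ω => Q ω i i) (gaussianReal 0 1) P
  offDiag : ∀ i j, i < j → HasLaw (fun ω => Q ω i j) (gaussianReal 0 (1 / 2)) P
  indep : iIndepFun
    (fun (p : {p : Fin n × Fin n // p.1 ≤ p.2}) (ω : Ω) => Q ω p.1.1 p.1.2) P

/-- `x` is a global minimizer of `x ↦ xᵀ A x` over the probability simplex. -/
def IsMinimizer {n : ℕ} (A : Matrix (Fin n) (Fin n) ℝ) (x : Fin n → ℝ) : Prop :=
  x ∈ stdSimplex ℝ (Fin n) ∧ ∀ y ∈ stdSimplex ℝ (Fin n), x ⬝ᵥ A *ᵥ x ≤ y ⬝ᵥ A *ᵥ y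

open Classical in
/-- The support size of the unique global minimizer over the simplex
(with value `0` if the minimizer is not unique). -/
noncomputable def kappa {n : ℕ} (A : Matrix (Fin n) (Fin n) ℝ) : ℕ :=
  if h : ∃! x, IsMinimizer A x then {i | 0 < h.exists.choose i}.ncard else 0

/-- Some vertex of the simplex at which the diagonal of `A` is minimal is a global minimizer. -/
def MinDiagVertexOptimal {n : ℕ} (A : Matrix (Fin n) (Fin n) ℝ) : Prop :=
  ∃ i, (∀ j, A i i ≤ A j j) ∧ IsMinimizer A (Pi.single i 1)

/-- The `r`-th smallest diagonal entry `Z_(r)` of `A`, for `1 ≤ r ≤ n`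
(with value `0` for `r` outside this range). -/
noncomputable def diagOrderStat {n : ℕ} (A : Matrix (Fin n) (Fin n) ℝ) (r : ℕ) : ℝ :=
  if h : 1 ≤ r ∧ r ≤ n then A.diag (Tuple.sort A.diag ⟨r - 1, by omega⟩) else 0

/-- The standard normal distribution function `Φ`. -/
noncomputable def stdNormalCDF (x : ℝ) : ℝ := cdf (gaussianReal 0 1) x

/-- The threshold `τ_{ij} = Z_(1) - √((Z_(i) - Z_(1)) (Z_(j) - Z_(1)))`. -/
noncomputable def tau {n : ℕ} (A : Matrix (Fin n) (Fin n) ℝ) (i j : ℕ) : ℝ :=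
  diagOrderStat A 1 - √((diagOrderStat A i - diagOrderStat A 1) *
    (diagOrderStat A j - diagOrderStat A 1))

/-- `p_{ij} = Φ(√2 τ_{ij})`, the probability that an `N(0, 1/2)` variable independent of the
diagonal lies below `τ_{ij}`, given the diagonal. -/
noncomputable def pairProb {n : ℕ} (A : Matrix (Fin n) (Fin n) ℝ) (i j : ℕ) : ℝ :=
  stdNormalCDF (√2 * tau A i j)

/-- `q_n = Φ(√2 Z_(1))`. -/
noncomputable def minPairProb {n : ℕ} (A : Matrix (Fin n) (Fin n) ℝ) : ℝ :=
  stdNormalCDF (√2 * diagOrderStat A 1)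

section Terms

variable {n : ℕ} {Ω : Type*} [MeasurableSpace Ω]

/-- `S_n = 𝔼[1 - (1 - q_n)^(n-1)]`. -/
noncomputable def termS (P : Measure Ω) (Q : Ω → Matrix (Fin n) (Fin n) ℝ) : ℝ :=
  ∫ ω, (1 - (1 - minPairProb (Q ω)) ^ (n - 1)) ∂P

/-- `A_n = 𝔼[(1 - q_n)^(n-1) (1 - ∏_{3 ≤ j ≤ n} (1 - p_{2j}))]`. -/
noncomputable def termA (P : Measure Ω) (Q : Ω → Matrix (Fin n) (Fin n) ℝ) : ℝ :=
  ∫ ω, (1 - minPairProb (Q ω)) ^ (n - 1) *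
    (1 - ∏ j ∈ Finset.Icc 3 n, (1 - pairProb (Q ω) 2 j)) ∂P

/-- `B_n = 𝔼[(1 - q_n)^(n-1) ∏_{3 ≤ j ≤ n} (1 - p_{2j}) (1 - ∏_{3 ≤ i < j ≤ n} (1 - p_{ij}))]`. -/
noncomputable def termB (P : Measure Ω) (Q : Ω → Matrix (Fin n) (Fin n) ℝ) : ℝ :=
  ∫ ω, (1 - minPairProb (Q ω)) ^ (n - 1) *
    (∏ j ∈ Finset.Icc 3 n, (1 - pairProb (Q ω) 2 j)) *
    (1 - ∏ i ∈ Finset.Icc 3 n, ∏ j ∈ Finset.Ioc i n, (1 - pairProb (Q ω) i j)) ∂P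

end Terms

end StQP

/-! Let `m` be the least diagonal entry. On the edge of the simplex joining `e_i` and `e_j` the form
takes a value below `m` exactly when `Q_ij < m - √((Q_ii - m)(Q_jj - m))`: with `Q_ii = m + u²`,
`Q_jj = m + v²`, the value minus `m` at weights `a + b = 1` is `(a u - b v)² + 2ab(Q_ij - m + uv)`.
Let `E` be the event `SomeEdgeBelow` that this happens on some edge. When the minimizer is unique,
`κ = 2` forces `E`, and `E` forces `κ > 1`. Given the diagonal, the off-diagonal entries are
independent, so the complement of `E` has conditional probability `∏ (1 - p_ij)` over ranks `i < j`.
Splitting this product into the rows `i = 1`, `i = 2` and `i ≥ 3` gives exactly `P(E) = S_n + A_n +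
B_n` (`IsGOE.measureReal_someEdgeBelow`). All three expansions therefore have error at most `P(κ >
2)`.

To bound `P(κ > 2)`, use first-order optimality: on the support of a minimizer every row average
`(Qx)_i` equals the minimal value, which is at most `-r` with `r` near `√(2 log n)` outside a
negligible event. A support of size at least three then forces one of a few patterns of very
negative entries (`IsMinimizer.badConfiguration`). A union bound over indices makes their total
probability `o(1 / (n (log n)^(3/2)))`, which is `o(B_n)` (`tendsto_mul_measureReal_two_lt_kappa`).

For the sizes of `S_n`, `A_n`, `B_n`, products are first replaced by sums, with quadratic errors
controlled by `secondMoment`. Writing `L = √(2 log n)`, the term `S_n` reduces to a Beta integral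
because the `N(0, 1/2)` tail at `-t` is asymptotic to `√π t Φ(-t)²`. In `A_n` and `B_n` the edge
probability is not negligible only when the gap `y - x` above the minimum `x = -t` is of order
`t⁻³`. With `k = t³ (y - x)` the integrand tends to `k ^ m * exp (-2√k)`, where `m = 0` for `A_n`,
and `m = 1` for `B_n` because the second smallest entry must fit into the gap
(`tendsto_gapIntegral`). The Abelian theorem `tendsto_integral_mul_one_sub_pow` then integrates over
the law of the minimum.

Almost sure uniqueness comes from the minimum value as a function of the entries: it is monotone in
each diagonal entry, hence differentiable almost everywhere, and its derivative is `x_i²` for every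
minimizer `x`. -/

namespace StQP

/-! ### Gaussian tails through the Mills ratio. -/

section GaussianTail

open Real Set

/-- The Mills ratio of the standard normal law: `Φ(-a) = φ(a) * mills a`. -/
noncomputable def mills (a : ℝ) : ℝ := ∫ v in Ioi (0 : ℝ), exp (-(a * v) - v ^ 2 / 2)

/-- The standard normal density. -/
noncomputable def stdNormalPDF (x : ℝ) : ℝ := gaussianPDFReal 0 1 x

lemma stdNormalPDF_eq (x : ℝ) : stdNormalPDF x = (√(2 * π))⁻¹ * exp (-x ^ 2 / 2) := by
  simp [stdNormalPDF, gaussianPDFReal]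

lemma stdNormalPDF_pos (x : ℝ) : 0 < stdNormalPDF x := gaussianPDFReal_pos _ _ _ one_ne_zero

lemma stdNormalPDF_add (x h : ℝ) :
    stdNormalPDF (x + h) = stdNormalPDF x * exp (-(x * h) - h ^ 2 / 2) := by
  rw [stdNormalPDF_eq, stdNormalPDF_eq, mul_assoc, ← exp_add]; ring_nf

lemma stdNormalPDF_neg (x : ℝ) : stdNormalPDF (-x) = stdNormalPDF x := by
  simp [stdNormalPDF_eq]

lemma continuous_stdNormalPDF : Continuous stdNormalPDF := by
  have : stdNormalPDF = fun x => (√(2 * π))⁻¹ * exp (-x ^ 2 / 2) := funext stdNormalPDF_eq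
  rw [this]; fun_prop

lemma stdNormalPDF_le (x : ℝ) : stdNormalPDF x ≤ exp (-x ^ 2 / 2) := by
  rw [stdNormalPDF_eq]
  refine mul_le_of_le_one_left (exp_pos _).le (inv_le_one_of_one_le₀ ?_)
  rw [one_le_sqrt]
  linarith [pi_gt_three]

lemma integrable_mills (a : ℝ) : Integrable (fun v => exp (-(a * v) - v ^ 2 / 2)) := by
  have h := (integrable_exp_neg_mul_sq (b := 1 / 2) (by norm_num)).comp_add_right a
  have h2 := h.const_mul (exp (a ^ 2 / 2))
  refine h2.congr (ae_of_all _ fun v => ?_)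
  simp only [← exp_add]
  ring_nf

lemma stdNormalCDF_eq_real (x : ℝ) : stdNormalCDF x = (gaussianReal 0 1).real (Iic x) :=
  cdf_eq_real _ _

lemma stdNormalCDF_eq_integral (x : ℝ) : stdNormalCDF x = ∫ y in Iic x, stdNormalPDF y := by
  rw [stdNormalCDF_eq_real, measureReal_def, gaussianReal_apply_eq_integral _ one_ne_zero,
    ENNReal.toReal_ofReal (integral_nonneg fun y => gaussianPDFReal_nonneg _ _ _)]
  rfl

lemma stdNormalCDF_neg (a : ℝ) : stdNormalCDF (-a) = stdNormalPDF a * mills a := by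
  rw [stdNormalCDF_eq_integral, mills, ← integral_Ici_eq_integral_Ioi,
    ← integral_indicator measurableSet_Iic, ← integral_sub_left_eq_self _ volume (-a),
    ← integral_indicator measurableSet_Ici, ← integral_const_mul]
  congr 1
  ext v
  by_cases hv : 0 ≤ v
  · have h1 : -a - v ∈ Iic (-a) := by simp [hv]
    rw [indicator_of_mem h1, indicator_of_mem (mem_Ici.2 hv), ← stdNormalPDF_neg,
      ← stdNormalPDF_add]
    ring_nf
  · have h1 : -a - v ∉ Iic (-a) := by simpa using hv
    rw [indicator_of_notMem h1, indicator_of_notMem (by simpa using hv), mul_zero]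

lemma mills_pos (a : ℝ) : 0 < mills a := by
  rw [mills, setIntegral_pos_iff_support_of_nonneg_ae (ae_of_all _ fun v => (exp_pos _).le)
    (integrable_mills a).integrableOn]
  have : Function.support (fun v => exp (-(a * v) - v ^ 2 / 2)) = univ := by
    ext v; simp [(exp_pos _).ne']
  simp [this]

lemma mills_antitone : Antitone mills := by
  intro a b hab
  refine setIntegral_mono_on (integrable_mills b).integrableOn (integrable_mills a).integrableOn
    measurableSet_Ioi fun v hv => ?_
  have : a * v ≤ b * v := mul_le_mul_of_nonneg_right hab (le_of_lt hv)
  gcongr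

lemma mul_mills_eq {a : ℝ} (ha : 0 < a) :
    a * mills a = ∫ v in Ioi (0 : ℝ), exp (-v - (v / a) ^ 2 / 2) := by
  have h := integral_comp_mul_left_Ioi (fun v => exp (-v - (v / a) ^ 2 / 2)) 0 ha
  rw [mul_zero, smul_eq_mul] at h
  rw [mills]
  have h2 : (∫ v in Ioi (0 : ℝ), exp (-(a * v) - v ^ 2 / 2)) =
      ∫ v in Ioi (0 : ℝ), exp (-(a * v) - (a * v / a) ^ 2 / 2) := by
    congr 1; ext v; rw [mul_div_cancel_left₀ _ ha.ne']
  rw [h2, h]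
  field_simp

lemma mul_mills_le_one {a : ℝ} (ha : 0 < a) : a * mills a ≤ 1 := by
  rw [mul_mills_eq ha, ← integral_exp_neg_Ioi_zero]
  refine integral_mono_of_nonneg (ae_of_all _ fun v => (exp_pos _).le) ?_
    (ae_of_all _ fun v => exp_le_exp.2 (by nlinarith [sq_nonneg (v / a)]))
  simpa [IntegrableOn] using exp_neg_integrableOn_Ioi 0 one_pos

lemma tendsto_mul_mills : Tendsto (fun a => a * mills a) atTop (𝓝 1) := by
  have h : Tendsto (fun a : ℝ => ∫ v in Ioi (0 : ℝ), exp (-v - (v / a) ^ 2 / 2)) atTop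
      (𝓝 (∫ v in Ioi (0 : ℝ), exp (-v))) := by
    refine tendsto_integral_filter_of_dominated_convergence (fun v => exp (-v)) ?_ ?_ ?_ ?_
    · exact Eventually.of_forall fun a => (by fun_prop : Continuous _).aestronglyMeasurable
    · refine Eventually.of_forall fun a => ae_of_all _ fun v => ?_
      rw [norm_of_nonneg (exp_pos _).le]
      exact exp_le_exp.2 (by nlinarith [sq_nonneg (v / a)])
    · simpa [IntegrableOn] using exp_neg_integrableOn_Ioi 0 one_pos
    · refine ae_of_all _ fun v => ?_
      have h1 : Tendsto (fun a : ℝ => v / a) atTop (𝓝 0) := tendsto_const_nhds.div_atTop tendsto_id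
      have h2 := ((tendsto_const_nhds (x := -v)).sub ((h1.pow 2).div_const 2))
      simpa [Function.comp_def] using (continuous_exp.tendsto _).comp h2
  rw [integral_exp_neg_Ioi_zero] at h
  refine h.congr' ?_
  filter_upwards [eventually_gt_atTop 0] with a ha
  rw [mul_mills_eq ha]

lemma stdNormalCDF_pos (x : ℝ) : 0 < stdNormalCDF x := by
  rw [← neg_neg x, stdNormalCDF_neg]; exact mul_pos (stdNormalPDF_pos _) (mills_pos _)

lemma stdNormalCDF_le_one (x : ℝ) : stdNormalCDF x ≤ 1 := cdf_le_one _ _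

lemma stdNormalCDF_mono : Monotone stdNormalCDF := monotone_cdf _

lemma hasDerivAt_stdNormalCDF (x : ℝ) : HasDerivAt stdNormalCDF (stdNormalPDF x) x := by
  have hint : Integrable stdNormalPDF := integrable_gaussianPDFReal 0 1
  have h : stdNormalCDF = fun x => stdNormalCDF 0 + ∫ y in (0 : ℝ)..x, stdNormalPDF y := by
    ext x
    rw [stdNormalCDF_eq_integral, stdNormalCDF_eq_integral,
      ← intervalIntegral.integral_Iic_sub_Iic hint.integrableOn hint.integrableOn]
    ring
  rw [h]
  exact (intervalIntegral.integral_hasDerivAt_right hint.intervalIntegrable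
    continuous_stdNormalPDF.aestronglyMeasurable.stronglyMeasurableAtFilter
    continuous_stdNormalPDF.continuousAt).const_add _

lemma continuous_stdNormalCDF : Continuous stdNormalCDF :=
  continuous_iff_continuousAt.2 fun x => (hasDerivAt_stdNormalCDF x).continuousAt

lemma tendsto_stdNormalCDF_atBot : Tendsto stdNormalCDF atBot (𝓝 0) := tendsto_cdf_atBot _

lemma tendsto_stdNormalCDF_atTop : Tendsto stdNormalCDF atTop (𝓝 1) := tendsto_cdf_atTop _

/-- The exponential is the exact ratio of the densities at `a + b` and `a`, and the Mills ratio only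
decreases. Hence the constant is one and no size condition on `a` is needed. -/
lemma stdNormalCDF_neg_add_le (a : ℝ) {b : ℝ} (hb : 0 ≤ b) :
    stdNormalCDF (-(a + b)) ≤ exp (-(a * b) - b ^ 2 / 2) * stdNormalCDF (-a) := by
  rw [stdNormalCDF_neg, stdNormalCDF_neg, stdNormalPDF_add]
  have h := mills_antitone (show a ≤ a + b by linarith)
  have h1 := stdNormalPDF_pos a
  calc _ ≤ stdNormalPDF a * exp (-(a * b) - b ^ 2 / 2) * mills a := by gcongr
    _ = _ := by ring

lemma stdNormalCDF_neg_le_exp {a : ℝ} (ha : 0 ≤ a) : stdNormalCDF (-a) ≤ exp (-a ^ 2 / 2) := by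
  have h := stdNormalCDF_neg_add_le 0 ha
  simp only [zero_add, zero_mul, neg_zero, zero_sub] at h
  refine h.trans ?_
  rw [neg_div]
  exact mul_le_of_le_one_right (exp_pos _).le (stdNormalCDF_le_one _)

lemma mul_stdNormalCDF_neg_le {a : ℝ} (ha : 0 < a) : a * stdNormalCDF (-a) ≤ stdNormalPDF a := by
  rw [stdNormalCDF_neg, ← mul_assoc, mul_comm a, mul_assoc]
  exact mul_le_of_le_one_right (stdNormalPDF_pos a).le (mul_mills_le_one ha)

lemma tendsto_mul_stdNormalCDF_neg_div :
    Tendsto (fun a => a * stdNormalCDF (-a) / stdNormalPDF a) atTop (𝓝 1) := by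
  refine tendsto_mul_mills.congr fun a => ?_
  rw [stdNormalCDF_neg]
  field_simp [(stdNormalPDF_pos a).ne']

/-- The distribution function of `N(0, 1/2)`. -/
noncomputable def halfCDF (x : ℝ) : ℝ := stdNormalCDF (√2 * x)

lemma halfCDF_pos (x : ℝ) : 0 < halfCDF x := stdNormalCDF_pos _

lemma halfCDF_le_one (x : ℝ) : halfCDF x ≤ 1 := stdNormalCDF_le_one _

lemma halfCDF_mono : Monotone halfCDF := fun _ _ h =>
  stdNormalCDF_mono (mul_le_mul_of_nonneg_left h (sqrt_nonneg _))

lemma continuous_halfCDF : Continuous halfCDF :=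
  continuous_stdNormalCDF.comp (continuous_const.mul continuous_id)

lemma halfCDF_eq_real (x : ℝ) : halfCDF x = (gaussianReal 0 (1 / 2)).real (Iic x) := by
  have h := gaussianReal_map_const_mul (μ := 0) (v := 1 / 2) (√2)
  have h2 : (NNReal.mk (√2 ^ 2) (sq_nonneg _)) * (1 / 2) = 1 := by
    ext; rw [NNReal.coe_mul, NNReal.coe_mk]; norm_num
  rw [h2, mul_zero] at h
  rw [halfCDF, stdNormalCDF_eq_real, ← h, map_measureReal_apply (by fun_prop) measurableSet_Iic]
  congr 1
  ext y
  simp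

lemma halfCDF_neg (t : ℝ) : halfCDF (-t) = stdNormalPDF (√2 * t) * mills (√2 * t) := by
  rw [halfCDF, mul_neg, stdNormalCDF_neg]

lemma halfCDF_neg_add_le (t : ℝ) {s : ℝ} (hs : 0 ≤ s) :
    halfCDF (-(t + s)) ≤ exp (-(2 * t * s) - s ^ 2) * halfCDF (-t) := by
  have h := stdNormalCDF_neg_add_le (√2 * t) (mul_nonneg (sqrt_nonneg 2) hs)
  have h2 : √2 * √2 = 2 := mul_self_sqrt (by norm_num)
  have e : -(√2 * t * (√2 * s)) - (√2 * s) ^ 2 / 2 = -(2 * t * s) - s ^ 2 := by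
    linear_combination (-(t * s) - s ^ 2 / 2) * h2
  rw [e, ← mul_add] at h
  simpa only [halfCDF, mul_neg] using h

lemma halfCDF_neg_le_exp {t : ℝ} (ht : 0 ≤ t) : halfCDF (-t) ≤ exp (-t ^ 2) := by
  have h := stdNormalCDF_neg_le_exp (mul_nonneg (sqrt_nonneg 2) ht)
  have e : -(√2 * t) ^ 2 / 2 = -t ^ 2 := by
    rw [mul_pow, sq_sqrt (by norm_num)]; ring
  rw [e] at h
  simpa only [halfCDF, mul_neg] using h

lemma stdNormalPDF_sqrt_two_mul (t : ℝ) :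
    stdNormalPDF (√2 * t) = √(2 * π) * stdNormalPDF t ^ 2 := by
  have : √(2 * π) ≠ 0 := (sqrt_pos.2 (by positivity)).ne'
  rw [stdNormalPDF_eq, stdNormalPDF_eq, mul_pow, mul_pow, ← exp_nat_mul, sq_sqrt (by norm_num)]
  field_simp
  congr 1
  push_cast
  ring

/-- Halving the variance squares the density up to a constant, so the tail is squared up to a factor
linear in `t`. This expresses edge probabilities through the uniform variable `Φ(x)`. -/
lemma tendsto_halfCDF_div :
    Tendsto (fun t => halfCDF (-t) / (t * stdNormalCDF (-t) ^ 2)) atTop (𝓝 √π) := by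
  have h2 : Tendsto (fun t : ℝ => √2 * t) atTop atTop :=
    tendsto_id.const_mul_atTop (sqrt_pos.2 two_pos)
  have h3 := ((tendsto_mul_mills.comp h2).div (tendsto_mul_mills.pow 2) (by norm_num)).const_mul √π
  rw [one_pow, div_one, mul_one] at h3
  refine h3.congr' ?_
  filter_upwards [eventually_gt_atTop 0] with t ht
  simp only [Function.comp, Pi.div_apply]
  rw [halfCDF_neg, stdNormalCDF_neg, stdNormalPDF_sqrt_two_mul, sqrt_mul two_pos.le]
  have := (stdNormalPDF_pos t).ne'
  have := (mills_pos t).ne'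
  field_simp

/-- The `N(0, 1/2)` tail varies on the scale `1 / t`: in `exp (-2 t s - s²)` only the term `t s → σ`
survives. -/
lemma tendsto_halfCDF_neg_add_div {s : ℝ → ℝ} {σ : ℝ}
    (hs : Tendsto (fun t => t * s t) atTop (𝓝 σ)) :
    Tendsto (fun t => halfCDF (-(t + s t)) / halfCDF (-t)) atTop (𝓝 (exp (-(2 * σ)))) := by
  have h2 : Tendsto (fun t : ℝ => √2 * t) atTop atTop :=
    tendsto_id.const_mul_atTop (sqrt_pos.2 two_pos)
  have hs0 : Tendsto s atTop (𝓝 0) := by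
    refine (hs.div_atTop tendsto_id).congr' ?_
    filter_upwards [eventually_gt_atTop 0] with t ht
    simp only [id]; field_simp
  have hst : Tendsto (fun t => t + s t) atTop atTop := tendsto_id.atTop_add hs0
  have h3 : Tendsto (fun t => √2 * (t + s t)) atTop atTop :=
    hst.const_mul_atTop (sqrt_pos.2 two_pos)
  have hr : Tendsto (fun t => t / (t + s t)) atTop (𝓝 1) := by
    have h1 : Tendsto (fun t : ℝ => 1 + s t / t) atTop (𝓝 1) := by
      simpa using (tendsto_const_nhds (x := (1 : ℝ))).add (hs0.div_atTop tendsto_id)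
    have := h1.inv₀ one_ne_zero
    rw [inv_one] at this
    refine this.congr' ?_
    filter_upwards [eventually_gt_atTop 0] with t ht
    field_simp
  have hm := ((tendsto_mul_mills.comp h3).div (tendsto_mul_mills.comp h2) one_ne_zero).mul hr
  have he : Tendsto (fun t => exp (-(2 * (t * s t)) - s t ^ 2)) atTop (𝓝 (exp (-(2 * σ)))) := by
    have := ((hs.const_mul 2).neg).sub (hs0.pow 2)
    simp only [ne_eq, OfNat.ofNat_ne_zero, not_false_eq_true, zero_pow, sub_zero] at this
    exact (continuous_exp.tendsto _).comp this
  have := he.mul hm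
  rw [div_one, mul_one, mul_one] at this
  refine this.congr' ?_
  filter_upwards [eventually_gt_atTop 0, hst.eventually_gt_atTop 0] with t ht hst
  simp only [Function.comp, Pi.div_apply]
  have h22 : √2 * √2 = 2 := mul_self_sqrt (by norm_num)
  have e : -(√2 * t * (√2 * s t)) - (√2 * s t) ^ 2 / 2 = -(2 * (t * s t)) - s t ^ 2 := by
    linear_combination (-(t * s t) - s t ^ 2 / 2) * h22
  have hh : halfCDF (-(t + s t)) = stdNormalPDF (√2 * t) * exp (-(2 * (t * s t)) - s t ^ 2) *
      mills (√2 * (t + s t)) := by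
    rw [halfCDF_neg, ← e, ← stdNormalPDF_add, mul_add]
  rw [hh, halfCDF_neg]
  have := (stdNormalPDF_pos (√2 * t)).ne'
  have := (mills_pos (√2 * t)).ne'
  have : √2 ≠ 0 := by positivity
  rw [mul_comm √2 t] at *
  field_simp

end GaussianTail

end StQP

namespace StQP

/-! ### Laplace-type asymptotics of the edge probability averaged over the gap. -/

section GapIntegral

open Real Set

/-- The average over independent standard normal `y`, `z` of
`c x y z * (Φ(y) - Φ(x)) ^ m * P(N(0, 1/2) ≤ x - √((y - x) (z - x)))`. -/
noncomputable def gapIntegral (m : ℕ) (c : ℝ → ℝ → ℝ → ℝ) (x : ℝ) : ℝ :=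
  ∫ z, ∫ y, c x y z * (stdNormalCDF y - stdNormalCDF x) ^ m * halfCDF (x - √((y - x) * (z - x)))
    ∂(gaussianReal 0 1) ∂(gaussianReal 0 1)

/-- Weights `c x y z` admissible in `gapIntegral`: they live on `x ≤ y ≤ z` (with `y` close to `x`
when `m = 2`) and tend to `1` on the scale `y - x ≍ |x|⁻³`. -/
structure IsGapWeight (m : ℕ) (c : ℝ → ℝ → ℝ → ℝ) : Prop where
  nonneg : ∀ x y z, 0 ≤ c x y z
  le_one : ∀ x y z, c x y z ≤ 1
  measurable : Measurable (fun p : ℝ × ℝ × ℝ => c p.1 p.2.1 p.2.2)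
  supp : ∀ x y z, c x y z ≠ 0 → x ≤ y ∧ y ≤ z ∧ (m ≤ 1 ∨ (m ≤ 2 ∧ y ≤ x + 1 / x ^ 2))
  tendsto : ∀ k, 0 < k → ∀ z, Tendsto (fun t : ℝ => c (-t) (-t + k / t ^ 3) z) atTop (𝓝 1)

lemma exists_stdNormalCDF_sub (t : ℝ) {h : ℝ} (hh : 0 ≤ h) :
    ∃ ξ ∈ Icc 0 h, stdNormalCDF (-t + h) - stdNormalCDF (-t) =
      h * (stdNormalPDF t * exp (t * ξ - ξ ^ 2 / 2)) := by
  rcases hh.eq_or_lt with rfl | hh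
  · exact ⟨0, by simp, by simp⟩
  obtain ⟨y, ⟨hy1, hy2⟩, hy⟩ := exists_hasDerivAt_eq_slope stdNormalCDF stdNormalPDF
    (show -t < -t + h by linarith) continuous_stdNormalCDF.continuousOn
    fun x _ => hasDerivAt_stdNormalCDF x
  refine ⟨y + t, ⟨by linarith, by linarith⟩, ?_⟩
  have e : stdNormalPDF y = stdNormalPDF t * exp (t * (y + t) - (y + t) ^ 2 / 2) := by
    have := stdNormalPDF_add (-t) (y + t)
    rw [stdNormalPDF_neg] at this
    rw [show -t + (y + t) = y by ring] at this
    rw [this]; ring_nf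
  rw [← e, hy]
  have : (-t + h - -t) = h := by ring
  rw [this]
  field_simp

lemma stdNormalCDF_sub_le {t h : ℝ} (ht : 0 ≤ t) (hh : 0 ≤ h) :
    stdNormalCDF (-t + h) - stdNormalCDF (-t) ≤ h * (stdNormalPDF t * exp (t * h)) := by
  obtain ⟨ξ, ⟨h0, h1⟩, e⟩ := exists_stdNormalCDF_sub t hh
  rw [e]
  have := (stdNormalPDF_pos t).le
  gcongr
  nlinarith [mul_le_mul_of_nonneg_left h1 ht, sq_nonneg ξ]

lemma le_stdNormalCDF_sub {t h : ℝ} (ht : 0 ≤ t) (hh : 0 ≤ h) :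
    h * (stdNormalPDF t * exp (-h ^ 2 / 2)) ≤ stdNormalCDF (-t + h) - stdNormalCDF (-t) := by
  obtain ⟨ξ, ⟨h0, h1⟩, e⟩ := exists_stdNormalCDF_sub t hh
  rw [e]
  have := (stdNormalPDF_pos t).le
  gcongr
  nlinarith [mul_nonneg ht h0]

/-- This bounds the logarithm of the rescaled integrand, with `h = y - x`, `g = z - x`, `j = m + 1`.
The growth `j t h` comes from the density of `y` and the `m` increments of `Φ`, the decay from the
edge probability. As `h ≤ √(hg)`, the decay dominates when `j ≤ 2`. For `j = 3` it need not, and the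
cut `t h ≤ 1` takes over. -/
lemma gap_exponent_le {t h g j : ℝ} (ht : 1 ≤ t) (hh : 0 ≤ h) (hg : h ≤ g)
    (hj : j ≤ 2 ∨ (j ≤ 3 ∧ t * h ≤ 1)) :
    j * (t * h) - h * g - 2 * t * √(h * g) ≤ 3 ∧
    (t / 2 ≤ g → j * (t * h) - h * g - 2 * t * √(h * g) ≤ 3 - √(h * t ^ 3) / 12) := by
  have hg0 : 0 ≤ g := hh.trans hg
  have hw0 := sqrt_nonneg (h * g)
  have hw2 : √(h * g) ^ 2 = h * g := sq_sqrt (mul_nonneg hh hg0)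
  set w := √(h * g) with hw
  have hhw : h ≤ w := by
    rw [hw]; apply le_sqrt_of_sq_le; nlinarith
  have hth : 0 ≤ t * h := by positivity
  have htw : 0 ≤ t * w := by positivity
  have hsmall : t / 2 ≤ g → √(h * t ^ 3) ≤ 2 * (t * w) := by
    intro hgt
    rw [sqrt_le_left (by positivity)]
    have : h * t ^ 3 ≤ 2 * t ^ 2 * (h * g) := by nlinarith [mul_nonneg hh (sq_nonneg t)]
    have h3 : (2 * (t * w)) ^ 2 = 4 * t ^ 2 * (h * g) := by rw [← hw2]; ring
    rw [h3]
    have : 0 ≤ t ^ 2 * (h * g) := by positivity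
    linarith
  rcases hj with hj | ⟨hj, hcut⟩
  · have h2 : j * (t * h) ≤ 2 * (t * h) := mul_le_mul_of_nonneg_right hj hth
    have h3 : t * h ≤ t * w := mul_le_mul_of_nonneg_left hhw (by linarith)
    have h4 : 0 ≤ h * g := by positivity
    refine ⟨by nlinarith, fun hgt => ?_⟩
    have h5 := hsmall hgt
    by_cases hr : 2 * h ≤ w
    · have : 2 * (t * h) ≤ t * w := by nlinarith
      nlinarith
    -- Here `h` and `g` are comparable and the decay comes from `h * g = w² ≥ g² / 4`. Together with
    -- `√(h t³) ≤ 3 g²` this is where the `12` comes from.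
    · push Not at hr
      have hgw : g ≤ 2 * w := by
        have : w * g ≤ 2 * w * w := by nlinarith
        by_contra hc
        push Not at hc
        have hwpos : 0 < w := by
          rcases hw0.eq_or_lt with h0 | h0
          · nlinarith
          · exact h0
        nlinarith
      have hk : √(h * t ^ 3) ≤ 3 * g ^ 2 := by
        rw [sqrt_le_left (by positivity)]
        have h8 : t ^ 3 ≤ (2 * g) ^ 3 := by gcongr; linarith
        have : h * t ^ 3 ≤ g * (2 * g) ^ 3 := by gcongr
        nlinarith [pow_nonneg hg0 4]
      nlinarith
  · have h2 : j * (t * h) ≤ 3 * 1 := mul_le_mul hj hcut hth (by norm_num)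
    have h4 : 0 ≤ h * g := by positivity
    refine ⟨by nlinarith, fun hgt => ?_⟩
    have h5 := hsmall hgt
    nlinarith

lemma one_add_pow_four_mul_exp_le {k : ℝ} (hk : 0 ≤ k) :
    (1 + k) ^ 4 * exp (-(√k / 12)) ≤ 96 ^ 8 := by
  have hq := sqrt_nonneg k
  have hq2 := sq_sqrt hk
  set q := √k
  -- `96 = 8 * 12`, and the eighth power is what dominates `(1 + k) ^ 4 = (1 + q²) ^ 4`.
  have h1 : (1 + q / 96) ^ 8 ≤ exp (q / 12) := by
    have := add_one_le_exp (q / 96)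
    calc (1 + q / 96) ^ 8 ≤ exp (q / 96) ^ 8 := by gcongr; linarith
      _ = exp (q / 12) := by rw [← exp_nat_mul]; congr 1; push_cast; ring
  have h2 : (1 + k) ^ 4 ≤ 96 ^ 8 * (1 + q / 96) ^ 8 := by
    have : 1 + k ≤ (96 * (1 + q / 96)) ^ 2 := by nlinarith
    calc (1 + k) ^ 4 ≤ ((96 * (1 + q / 96)) ^ 2) ^ 4 := by gcongr
      _ = _ := by ring
  rw [exp_neg, ← div_eq_mul_inv, div_le_iff₀ (exp_pos _)]
  exact h2.trans (by gcongr)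

/-- The integrand of `gapIntegral` in the rescaled variable `k = t³ (y + t)`. -/
noncomputable def gapIntegrand (m : ℕ) (c : ℝ → ℝ → ℝ → ℝ) (t z k : ℝ) : ℝ :=
  c (-t) (-t + k / t ^ 3) z * (stdNormalPDF (-t + k / t ^ 3) / stdNormalPDF t) *
    (t ^ 3 * (stdNormalCDF (-t + k / t ^ 3) - stdNormalCDF (-t)) / stdNormalPDF t) ^ m *
    (halfCDF (-(t + √(k / t ^ 3 * (t + z)))) / halfCDF (-t))

variable {m : ℕ} {c : ℝ → ℝ → ℝ → ℝ}

lemma gapIntegrand_nonneg (hc : IsGapWeight m c) {t z k : ℝ} (ht : 0 < t) (hk : 0 < k) :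
    0 ≤ gapIntegrand m c t z k := by
  have h1 := hc.nonneg (-t) (-t + k / t ^ 3) z
  have h2 : 0 ≤ stdNormalCDF (-t + k / t ^ 3) - stdNormalCDF (-t) :=
    sub_nonneg.2 (stdNormalCDF_mono (by simp; positivity))
  have h3 := stdNormalPDF_pos t
  have h4 := stdNormalPDF_pos (-t + k / t ^ 3)
  have h5 := halfCDF_pos (-(t + √(k / t ^ 3 * (t + z))))
  have h6 := halfCDF_pos (-t)
  unfold gapIntegrand
  positivity

/-- A dominating function independent of `t`. If `z ≥ -t/2`, the exponent decays like `√k`.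
Otherwise `z` is itself very negative and `k` is at most a polynomial in `z`, which the Gaussian law
of `z` integrates. -/
lemma gapIntegrand_le (hc : IsGapWeight m c) {t z k : ℝ} (ht : 1 ≤ t) (hk : 0 < k) :
    gapIntegrand m c t z k ≤ (1 + 8 * z ^ 4) ^ 4 * (exp 3 * 96 ^ 8 * ((1 + k) ^ 2)⁻¹) := by
  have hbound : 0 ≤ (1 + 8 * z ^ 4) ^ 4 * (exp 3 * 96 ^ 8 * ((1 + k) ^ 2)⁻¹) := by positivity
  have ht0 : 0 < t := by linarith
  by_cases hcz : c (-t) (-t + k / t ^ 3) z = 0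
  · simpa [gapIntegrand, hcz] using hbound
  obtain ⟨-, hyz, hm⟩ := hc.supp _ _ _ hcz
  have hk' : k = k / t ^ 3 * t ^ 3 := by field_simp
  have hh : 0 < k / t ^ 3 := by positivity
  set h := k / t ^ 3 with hdef
  have hg : h ≤ t + z := by linarith
  have hj : ((m : ℝ) + 1 ≤ 2 ∨ ((m : ℝ) + 1 ≤ 3 ∧ t * h ≤ 1)) := by
    rcases hm with hm | ⟨hm, hy⟩
    · left; have : (m : ℝ) ≤ 1 := by exact_mod_cast hm
      linarith
    · right
      have h1 : (m : ℝ) ≤ 2 := by exact_mod_cast hm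
      refine ⟨by linarith, ?_⟩
      have h2 : h ≤ 1 / t ^ 2 := by rw [neg_sq] at hy; linarith
      calc t * h ≤ t * (1 / t ^ 2) := by gcongr
        _ = 1 / t := by field_simp
        _ ≤ 1 := by rw [div_le_one ht0]; exact ht
  have hm2 : m ≤ 2 := by omega
  obtain ⟨hE1, hE2⟩ := gap_exponent_le ht hh.le hg hj
  set E := ((m : ℝ) + 1) * (t * h) - h * (t + z) - 2 * t * √(h * (t + z)) with hE
  have hp := stdNormalPDF_pos t
  have hmain : gapIntegrand m c t z k ≤ k ^ m * exp E := by
    have h1 : stdNormalPDF (-t + h) / stdNormalPDF t ≤ exp (t * h) := by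
      rw [div_le_iff₀ hp, stdNormalPDF_add, stdNormalPDF_neg, mul_comm]
      gcongr
      nlinarith [sq_nonneg h]
    have h2 : t ^ 3 * (stdNormalCDF (-t + h) - stdNormalCDF (-t)) / stdNormalPDF t ≤
        k * exp (t * h) := by
      rw [div_le_iff₀ hp]
      calc _ ≤ t ^ 3 * (h * (stdNormalPDF t * exp (t * h))) := by
            gcongr; exact stdNormalCDF_sub_le ht0.le hh.le
        _ = _ := by rw [hk']; ring
    have h20 : 0 ≤ t ^ 3 * (stdNormalCDF (-t + h) - stdNormalCDF (-t)) / stdNormalPDF t := by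
      have : 0 ≤ stdNormalCDF (-t + h) - stdNormalCDF (-t) :=
        sub_nonneg.2 (stdNormalCDF_mono (by linarith))
      positivity
    have h3 : halfCDF (-(t + √(h * (t + z)))) / halfCDF (-t) ≤
        exp (-(2 * t * √(h * (t + z))) - h * (t + z)) := by
      rw [div_le_iff₀ (halfCDF_pos _)]
      have := halfCDF_neg_add_le t (sqrt_nonneg (h * (t + z)))
      rwa [sq_sqrt (mul_nonneg hh.le (hh.le.trans hg))] at this
    have h30 : 0 ≤ halfCDF (-(t + √(h * (t + z)))) / halfCDF (-t) :=
      div_nonneg (halfCDF_pos _).le (halfCDF_pos _).le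
    have h10 : 0 ≤ stdNormalPDF (-t + h) / stdNormalPDF t :=
      div_nonneg (stdNormalPDF_pos _).le hp.le
    have hcn := hc.nonneg (-t) (-t + h) z
    have hcl := hc.le_one (-t) (-t + h) z
    unfold gapIntegrand
    rw [← hdef]
    calc _ ≤ 1 * exp (t * h) * (k * exp (t * h)) ^ m *
          exp (-(2 * t * √(h * (t + z))) - h * (t + z)) := by gcongr
      _ = k ^ m * exp E := by
          rw [hE, mul_pow, ← exp_nat_mul, one_mul, mul_left_comm, mul_assoc, ← exp_add, mul_assoc,
            ← exp_add]
          congr 2; ring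
  refine hmain.trans ?_
  have hkm : k ^ m * (1 + k) ^ 2 ≤ (1 + k) ^ 4 := by
    have h1 : k ^ m ≤ (1 + k) ^ m := by gcongr; linarith
    have h2 : (1 + k) ^ m ≤ (1 + k) ^ 2 := pow_le_pow_right₀ (by linarith) hm2
    calc k ^ m * (1 + k) ^ 2 ≤ (1 + k) ^ 2 * (1 + k) ^ 2 := by gcongr; exact h1.trans h2
      _ = _ := by ring
  have hz1 : 1 ≤ 1 + 8 * z ^ 4 := by nlinarith [sq_nonneg (z ^ 2)]
  have key : (1 + k) ^ 4 * exp E ≤ (1 + 8 * z ^ 4) ^ 4 * (exp 3 * 96 ^ 8) := by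
    by_cases hgt : t / 2 ≤ t + z
    · have hEE := hE2 hgt
      rw [← hk'] at hEE
      calc (1 + k) ^ 4 * exp E ≤ (1 + k) ^ 4 * exp (3 + -(√k / 12)) := by
            gcongr; linarith
        _ = exp 3 * ((1 + k) ^ 4 * exp (-(√k / 12))) := by rw [exp_add]; ring
        _ ≤ exp 3 * 96 ^ 8 := by gcongr; exact one_add_pow_four_mul_exp_le hk.le
        _ ≤ _ := le_mul_of_one_le_left (by positivity) (one_le_pow₀ hz1)
    -- In this case `t < 2(-z)` and `h ≤ t + z < -z`, so `k = h t³` is at most `8 z⁴`.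
    · push Not at hgt
      have hkz : k ≤ 8 * z ^ 4 := by
        have ha : t ≤ 2 * (-z) := by linarith
        have hb : h ≤ -z := by linarith
        have h0 : 0 ≤ -z := by linarith
        calc k = h * t ^ 3 := hk'
          _ ≤ (-z) * (2 * (-z)) ^ 3 := by gcongr
          _ = _ := by ring
      calc (1 + k) ^ 4 * exp E ≤ (1 + 8 * z ^ 4) ^ 4 * exp 3 := by gcongr
        _ ≤ _ := by
          gcongr
          exact le_mul_of_one_le_right (exp_pos _).le (by norm_num)
  calc k ^ m * exp E = (k ^ m * (1 + k) ^ 2) * exp E * ((1 + k) ^ 2)⁻¹ := by field_simp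
    _ ≤ (1 + k) ^ 4 * exp E * ((1 + k) ^ 2)⁻¹ := by gcongr
    _ ≤ (1 + 8 * z ^ 4) ^ 4 * (exp 3 * 96 ^ 8) * ((1 + k) ^ 2)⁻¹ := by gcongr
    _ = _ := by ring

/-- On the scale `y - x = k / t³` the density of `y` is constant and `Φ` is linear. Since `z - x ∼
t`, the threshold moves by about `√k / t`, which costs the factor `exp (-2√k)`. The limit does not
depend on `z`. -/
lemma tendsto_gapIntegrand (hc : IsGapWeight m c) (z : ℝ) {k : ℝ} (hk : 0 < k) :
    Tendsto (fun t => gapIntegrand m c t z k) atTop (𝓝 (k ^ m * exp (-(2 * √k)))) := by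
  have hinv : ∀ n : ℕ, n ≠ 0 → Tendsto (fun t : ℝ => k / t ^ n) atTop (𝓝 0) := fun n hn =>
    tendsto_const_nhds.div_atTop (tendsto_pow_atTop hn)
  have h3 := hinv 3 (by norm_num)
  have h2 := hinv 2 (by norm_num)
  have hup : Tendsto (fun t : ℝ => exp (t * (k / t ^ 3))) atTop (𝓝 1) := by
    have := (continuous_exp.tendsto 0).comp h2
    rw [exp_zero] at this
    refine this.congr' ?_
    filter_upwards [eventually_gt_atTop 0] with t ht
    simp only [Function.comp]
    congr 1; field_simp
  have hlo : Tendsto (fun t : ℝ => exp (-(k / t ^ 3) ^ 2 / 2)) atTop (𝓝 1) := by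
    have := (continuous_exp.tendsto _).comp ((h3.pow 2).neg.div_const 2)
    simpa [Function.comp_def] using this
  have hA : Tendsto (fun t => stdNormalPDF (-t + k / t ^ 3) / stdNormalPDF t) atTop (𝓝 1) := by
    have := hup.mul hlo
    rw [mul_one] at this
    refine this.congr fun t => ?_
    rw [stdNormalPDF_add, stdNormalPDF_neg, mul_div_cancel_left₀ _ (stdNormalPDF_pos t).ne',
      ← exp_add]
    ring_nf
  have hB : Tendsto (fun t => t ^ 3 * (stdNormalCDF (-t + k / t ^ 3) - stdNormalCDF (-t)) /
      stdNormalPDF t) atTop (𝓝 k) := by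
    have hl := hlo.const_mul k
    have hu := hup.const_mul k
    rw [mul_one] at hl hu
    refine tendsto_of_tendsto_of_tendsto_of_le_of_le' hl hu ?_ ?_
    · filter_upwards [eventually_gt_atTop 0] with t ht
      rw [le_div_iff₀ (stdNormalPDF_pos t)]
      have := le_stdNormalCDF_sub ht.le (show 0 ≤ k / t ^ 3 by positivity)
      calc _ = t ^ 3 * (k / t ^ 3 * (stdNormalPDF t * exp (-(k / t ^ 3) ^ 2 / 2))) := by field_simp
        _ ≤ _ := by gcongr
    · filter_upwards [eventually_gt_atTop 0] with t ht
      rw [div_le_iff₀ (stdNormalPDF_pos t)]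
      have := stdNormalCDF_sub_le ht.le (show 0 ≤ k / t ^ 3 by positivity)
      calc _ ≤ t ^ 3 * (k / t ^ 3 * (stdNormalPDF t * exp (t * (k / t ^ 3)))) := by gcongr
        _ = _ := by field_simp
  have hC : Tendsto (fun t => halfCDF (-(t + √(k / t ^ 3 * (t + z)))) / halfCDF (-t)) atTop
      (𝓝 (exp (-(2 * √k)))) := by
    refine tendsto_halfCDF_neg_add_div ?_
    have h1 : Tendsto (fun t : ℝ => k * (1 + z / t)) atTop (𝓝 k) := by
      have := ((tendsto_const_nhds (x := z)).div_atTop tendsto_id).const_add (1 : ℝ)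
      simpa using this.const_mul k
    refine ((continuous_sqrt.tendsto k).comp h1).congr' ?_
    filter_upwards [eventually_gt_atTop 0] with t ht
    simp only [Function.comp]
    rw [← sqrt_sq ht.le, ← sqrt_mul (sq_nonneg t), sqrt_sq ht.le]
    congr 1; field_simp
  have := (((hc.tendsto k hk z).mul hA).mul (hB.pow m)).mul hC
  simp only [one_mul] at this
  exact this

lemma measurable_gapIntegrand (hc : IsGapWeight m c) (t : ℝ) :
    Measurable (fun p : ℝ × ℝ => gapIntegrand m c t p.1 p.2) := by
  have h1 : Measurable (fun p : ℝ × ℝ => c (-t) (-t + p.2 / t ^ 3) p.1) :=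
    hc.measurable.comp (by fun_prop : Measurable fun p : ℝ × ℝ => (-t, -t + p.2 / t ^ 3, p.1))
  have h0 : Measurable (fun p : ℝ × ℝ => -t + p.2 / t ^ 3) := by fun_prop
  have h2 := continuous_stdNormalPDF.measurable.comp h0
  have h3 := continuous_stdNormalCDF.measurable.comp h0
  have h4 := continuous_halfCDF.measurable.comp
    (by fun_prop : Measurable fun p : ℝ × ℝ => -(t + √(p.2 / t ^ 3 * (t + p.1))))
  exact ((h1.mul (h2.div_const _)).mul
    ((((h3.sub_const _).const_mul _).div_const _).pow_const _)).mul (h4.div_const _)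

lemma integrable_gap_bound :
    Integrable (fun p : ℝ × ℝ => (1 + 8 * p.1 ^ 4) ^ 4 * (exp 3 * 96 ^ 8 * ((1 + p.2) ^ 2)⁻¹))
      ((gaussianReal 0 1).prod (volume.restrict (Ioi 0))) := by
  refine Integrable.mul_prod (f := fun z : ℝ => (1 + 8 * z ^ 4) ^ 4)
    (g := fun k : ℝ => exp 3 * 96 ^ 8 * ((1 + k) ^ 2)⁻¹) ?_ ?_
  · have h : ∀ n : ℕ, Integrable (fun z : ℝ => z ^ n) (gaussianReal 0 1) := fun n =>
      integrable_pow_of_mem_interior_integrableExpSet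
        (by simp [integrableExpSet_fun_id_gaussianReal]) n
    have e : (fun z : ℝ => (1 + 8 * z ^ 4) ^ 4) = fun z => 1 + 32 * z ^ 4 + 384 * z ^ 8 +
        2048 * z ^ 12 + 4096 * z ^ 16 := by ext z; ring
    rw [e]
    exact ((((integrable_const _).add ((h 4).const_mul _)).add ((h 8).const_mul _)).add
      ((h 12).const_mul _)).add ((h 16).const_mul _)
  · refine Integrable.const_mul ?_ _
    have := integrableOn_Ioi_rpow_of_lt (a := -2) (by norm_num) (c := 1) one_pos
    have h2 : IntegrableOn (fun k : ℝ => (k + 1) ^ (-2 : ℝ)) (Ioi 0) := by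
      have h3 := (this.integrable_indicator measurableSet_Ioi).comp_add_right 1
      rw [← integrable_indicator_iff measurableSet_Ioi]
      refine h3.congr (ae_of_all _ fun k => ?_)
      simp [indicator]
    refine h2.congr_fun (fun k hk => ?_) measurableSet_Ioi
    have hk0 : (0 : ℝ) < k := hk
    simp only
    rw [rpow_neg (by linarith), add_comm k 1]
    norm_cast

/-- The change of variables `y = -t + k / t³`. The weight vanishes for `y < -t`, so only `k > 0`
contributes. -/
lemma gapIntegral_eq (hc : IsGapWeight m c) {t : ℝ} (ht : 1 ≤ t) :
    gapIntegral m c (-t) * (t ^ (3 * (m + 1)) / (stdNormalPDF t ^ (m + 1) * halfCDF (-t))) =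
      ∫ p : ℝ × ℝ, gapIntegrand m c t p.1 p.2
        ∂((gaussianReal 0 1).prod (volume.restrict (Ioi 0))) := by
  have ht0 : 0 < t := by linarith
  have hint : Integrable (fun p : ℝ × ℝ => gapIntegrand m c t p.1 p.2)
      ((gaussianReal 0 1).prod (volume.restrict (Ioi 0))) := by
    refine integrable_gap_bound.mono' (measurable_gapIntegrand hc t).aestronglyMeasurable ?_
    have : ∀ᵐ p : ℝ × ℝ ∂((gaussianReal 0 1).prod (volume.restrict (Ioi 0))), p.2 ∈ Ioi (0 : ℝ) :=
      Measure.quasiMeasurePreserving_snd.ae (ae_restrict_mem measurableSet_Ioi)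
    filter_upwards [this] with p hp
    rw [norm_of_nonneg (gapIntegrand_nonneg hc ht0 hp)]
    exact gapIntegrand_le hc ht hp
  rw [integral_prod _ hint, gapIntegral, ← integral_mul_const]
  congr 1
  ext z
  rw [← integral_mul_const, integral_gaussianReal_eq_integral_smul one_ne_zero]
  set F : ℝ → ℝ := fun y => stdNormalPDF y * (c (-t) y z *
    (stdNormalCDF y - stdNormalCDF (-t)) ^ m * halfCDF (-t - √((y - -t) * (z - -t))) *
    (t ^ (3 * (m + 1)) / (stdNormalPDF t ^ (m + 1) * halfCDF (-t)))) with hF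
  have hp := (stdNormalPDF_pos t).ne'
  have hq := (halfCDF_pos (-t)).ne'
  have hGF : ∀ k, gapIntegrand m c t z k = (t ^ 3)⁻¹ * F (-t + k / t ^ 3) := by
    intro k
    simp only [hF, gapIntegrand]
    rw [show -(t + √(k / t ^ 3 * (t + z))) = -t - √((-t + k / t ^ 3 - -t) * (z - -t)) by
      rw [show -t + k / t ^ 3 - -t = k / t ^ 3 by ring, show z - -t = t + z by ring]; ring]
    rw [div_pow, mul_pow]
    field_simp
    ring
  have hsupp : ∀ k < 0, F (-t + k / t ^ 3) = 0 := by
    intro k hk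
    have : c (-t) (-t + k / t ^ 3) z = 0 := by
      by_contra hne
      have := (hc.supp _ _ _ hne).1
      have : k / t ^ 3 < 0 := div_neg_of_neg_of_pos hk (by positivity)
      linarith
    simp [hF, this]
  have h1 : ∫ k in Ioi 0, gapIntegrand m c t z k = ∫ k, gapIntegrand m c t z k := by
    rw [← integral_Ici_eq_integral_Ioi]
    refine setIntegral_eq_integral_of_forall_compl_eq_zero fun k hk => ?_
    rw [hGF, hsupp k (by simpa using hk), mul_zero]
  have h2 : ∫ y, F y = ∫ k, (t ^ 3)⁻¹ * F (-t + k / t ^ 3) := by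
    rw [integral_const_mul, ← integral_add_left_eq_self F (-t)]
    have := Measure.integral_comp_div (fun h => F (-t + h)) (t ^ 3)
    rw [this, abs_of_pos (by positivity), smul_eq_mul]
    field_simp
  rw [h1]
  simp_rw [hGF]
  rw [← h2]
  rfl

theorem tendsto_gapIntegral (hc : IsGapWeight m c) :
    Tendsto (fun t => gapIntegral m c (-t) *
      (t ^ (3 * (m + 1)) / (stdNormalPDF t ^ (m + 1) * halfCDF (-t)))) atTop
      (𝓝 (∫ k in Ioi (0 : ℝ), k ^ m * exp (-(2 * √k)))) := by
  have h : Tendsto (fun t => ∫ p : ℝ × ℝ, gapIntegrand m c t p.1 p.2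
        ∂((gaussianReal 0 1).prod (volume.restrict (Ioi 0)))) atTop
      (𝓝 (∫ p : ℝ × ℝ, 1 * (p.2 ^ m * exp (-(2 * √p.2)))
        ∂((gaussianReal 0 1).prod (volume.restrict (Ioi 0))))) := by
    have hae : ∀ᵐ p : ℝ × ℝ ∂((gaussianReal 0 1).prod (volume.restrict (Ioi 0))),
        p.2 ∈ Ioi (0 : ℝ) :=
      Measure.quasiMeasurePreserving_snd.ae (ae_restrict_mem measurableSet_Ioi)
    refine tendsto_integral_filter_of_dominated_convergence _ ?_ ?_ integrable_gap_bound ?_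
    · exact Eventually.of_forall fun t => (measurable_gapIntegrand hc t).aestronglyMeasurable
    · filter_upwards [eventually_ge_atTop 1] with t ht
      filter_upwards [hae] with p hp
      rw [norm_of_nonneg (gapIntegrand_nonneg hc (by linarith) hp)]
      exact gapIntegrand_le hc ht hp
    · filter_upwards [hae] with p hp
      rw [one_mul]
      exact tendsto_gapIntegrand hc p.1 hp
  rw [integral_prod_mul (fun _ : ℝ => (1 : ℝ)) (fun k : ℝ => k ^ m * exp (-(2 * √k)))] at h
  simp only [integral_const, probReal_univ, smul_eq_mul, one_mul] at h
  refine h.congr' ?_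
  filter_upwards [eventually_ge_atTop 1] with t ht
  rw [gapIntegral_eq hc ht]

lemma integral_pow_mul_exp_neg_sqrt (m : ℕ) :
    ∫ k in Ioi (0 : ℝ), k ^ m * exp (-(2 * √k)) =
      2 * (2 * m + 1).factorial / 2 ^ (2 * m + 2) := by
  have h := integral_rpow_mul_exp_neg_mul_rpow (p := 1 / 2) (q := m) (b := 2) (by norm_num)
    (by have : (0 : ℝ) ≤ m := m.cast_nonneg
        linarith) two_pos
  have e : ∀ k : ℝ, k ^ m * exp (-(2 * √k)) = k ^ (m : ℝ) * exp (-2 * k ^ (1 / 2 : ℝ)) := by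
    intro k
    rw [rpow_natCast, sqrt_eq_rpow]; ring_nf
  simp_rw [e]
  rw [h, show ((m : ℝ) + 1) / (1 / 2) = ((2 * m + 1 : ℕ) : ℝ) + 1 by push_cast; ring,
    Gamma_nat_eq_factorial,
    show -((m : ℝ) + 1) / (1 / 2) = -((2 * m + 2 : ℕ) : ℝ) by push_cast; ring,
    rpow_neg two_pos.le, rpow_natCast]
  field_simp

end GapIntegral

end StQP

namespace StQP

/-! ### Integrals against the law of the sample minimum. -/

section Abelian

open Real Set

lemma integrable_of_continuous_of_bound {f : ℝ → ℝ} (hf : Measurable f) (C : ℝ)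
    (hC : ∀ x, |f x| ≤ C) (μ : Measure ℝ) [IsFiniteMeasure μ] : Integrable f μ :=
  Integrable.of_bound hf.aestronglyMeasurable C (ae_of_all _ hC)

lemma measurable_pow_mul_pow (k N : ℕ) :
    Measurable fun x => stdNormalCDF x ^ k * (1 - stdNormalCDF x) ^ N := by
  have := continuous_stdNormalCDF
  exact (by fun_prop : Continuous _).measurable

lemma pow_mul_pow_mem (k N : ℕ) (x : ℝ) :
    0 ≤ stdNormalCDF x ^ k * (1 - stdNormalCDF x) ^ N ∧
      stdNormalCDF x ^ k * (1 - stdNormalCDF x) ^ N ≤ 1 := by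
  have h0 := (stdNormalCDF_pos x).le
  have h1 := stdNormalCDF_le_one x
  have h2 : 0 ≤ 1 - stdNormalCDF x := by linarith
  exact ⟨by positivity, mul_le_one₀ (pow_le_one₀ h0 h1) (by positivity)
    (pow_le_one₀ h2 (by linarith))⟩

lemma integrable_pow_mul_pow (k N : ℕ) : Integrable
    (fun x => stdNormalCDF x ^ k * (1 - stdNormalCDF x) ^ N) (gaussianReal 0 1) := by
  refine integrable_of_continuous_of_bound (measurable_pow_mul_pow k N) 1 (fun x => ?_) _
  rw [abs_of_nonneg (pow_mul_pow_mem k N x).1]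
  exact (pow_mul_pow_mem k N x).2

/-- `Φ` of a standard normal is uniform on `[0, 1]`. In this form it is the fundamental theorem of
calculus for `P ∘ Φ` on the whole line. -/
lemma integral_deriv_comp_stdNormalCDF {P P' : ℝ → ℝ} (hP : ∀ u, HasDerivAt P (P' u) u)
    (hint : Integrable (fun x => P' (stdNormalCDF x)) (gaussianReal 0 1)) :
    ∫ x, P' (stdNormalCDF x) ∂(gaussianReal 0 1) = P 1 - P 0 := by
  rw [integral_gaussianReal_eq_integral_smul one_ne_zero]
  have hint' : Integrable (fun x => P' (stdNormalCDF x) * stdNormalPDF x) := by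
    rw [gaussianReal_of_var_ne_zero _ one_ne_zero, integrable_withDensity_iff
      (measurable_gaussianPDF 0 1) (ae_of_all _ fun _ => gaussianPDF_lt_top)] at hint
    simp only [toReal_gaussianPDF] at hint
    exact hint
  have := integral_of_hasDerivAt_of_tendsto (f := fun x => P (stdNormalCDF x))
    (fun x => (hP _).comp x (hasDerivAt_stdNormalCDF x)) hint'
    (((hP 0).continuousAt.tendsto).comp tendsto_stdNormalCDF_atBot)
    (((hP 1).continuousAt.tendsto).comp tendsto_stdNormalCDF_atTop)
  rw [← this]
  congr 1; ext x; rw [smul_eq_mul, mul_comm]; rfl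

/-- The Beta integral, by integration by parts from `(k + 1, N)` to `(k, N + 1)`. -/
lemma integral_pow_mul_pow (k N : ℕ) :
    (∫ x, stdNormalCDF x ^ k * (1 - stdNormalCDF x) ^ N ∂(gaussianReal 0 1)) *
      (N + 1).ascFactorial (k + 1) = k.factorial := by
  induction k generalizing N with
  | zero =>
    have hd : ∀ u : ℝ, HasDerivAt (fun u : ℝ => -(1 - u) ^ (N + 1) / ((N : ℝ) + 1))
        (u ^ 0 * (1 - u) ^ N) u := by
      intro u
      have := ((((hasDerivAt_id u).const_sub 1).pow (N + 1)).neg).div_const ((N : ℝ) + 1)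
      convert! this using 1
      have : (N : ℝ) + 1 ≠ 0 := by positivity
      simp; field_simp
    rw [integral_deriv_comp_stdNormalCDF hd (integrable_pow_mul_pow 0 N)]
    have : (N : ℝ) + 1 ≠ 0 := by positivity
    simp [Nat.ascFactorial]
    field_simp
  | succ k ih =>
    have hd : ∀ u : ℝ, HasDerivAt (fun u => u ^ (k + 1) * (1 - u) ^ (N + 1))
        ((k + 1) * (u ^ k * (1 - u) ^ (N + 1)) - (N + 1) * (u ^ (k + 1) * (1 - u) ^ N)) u := by
      intro u
      have := ((hasDerivAt_id u).pow (k + 1)).mul (((hasDerivAt_id u).const_sub 1).pow (N + 1))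
      convert! this using 1
      simp; ring
    have h := integral_deriv_comp_stdNormalCDF hd
      (((integrable_pow_mul_pow k (N + 1)).const_mul _).sub
        ((integrable_pow_mul_pow (k + 1) N).const_mul _))
    rw [integral_sub ((integrable_pow_mul_pow k (N + 1)).const_mul _)
      ((integrable_pow_mul_pow (k + 1) N).const_mul _), integral_const_mul,
      integral_const_mul] at h
    have h2 := ih (N + 1)
    have e : (N + 1).ascFactorial (k + 1 + 1) = (N + 1) * (N + 1 + 1).ascFactorial (k + 1) := by
      rw [Nat.ascFactorial_succ, ← Nat.succ_ascFactorial]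
    rw [e, Nat.factorial_succ]
    push_cast at h2 ⊢
    simp at h
    linear_combination ((k : ℝ) + 1) * h2 - (↑((N + 1 + 1).ascFactorial (k + 1)) : ℝ) * h

lemma tendsto_natCast_div_sub_add (j i : ℕ) :
    Tendsto (fun n : ℕ => (n : ℝ) / ((n - j : ℕ) + 1 + i : ℝ)) atTop (𝓝 1) := by
  have h := tendsto_natCast_div_add_atTop (𝕜 := ℝ) (1 + i - j : ℝ)
  refine h.congr' ?_
  filter_upwards [eventually_ge_atTop j] with n hn
  rw [Nat.cast_sub hn]
  ring_nf

lemma tendsto_pow_mul_integral_pow (k j : ℕ) :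
    Tendsto (fun n : ℕ => (n : ℝ) ^ (k + 1) *
      ∫ x, stdNormalCDF x ^ k * (1 - stdNormalCDF x) ^ (n - j) ∂(gaussianReal 0 1)) atTop
      (𝓝 k.factorial) := by
  have hr : ∀ i : ℕ, Tendsto (fun n : ℕ => (n : ℝ) ^ i / ((n - j + 1).ascFactorial i : ℕ)) atTop
      (𝓝 1) := by
    intro i
    induction i with
    | zero => simp
    | succ i ih =>
      have := ih.mul (tendsto_natCast_div_sub_add j i)
      rw [mul_one] at this
      refine this.congr fun n => ?_
      rw [Nat.ascFactorial_succ]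
      push_cast
      rw [div_mul_div_comm, ← pow_succ, mul_comm (((n - j + 1).ascFactorial i : ℕ) : ℝ)]
  have := (hr (k + 1)).mul_const (k.factorial : ℝ)
  rw [one_mul] at this
  refine this.congr fun n => ?_
  rw [← integral_pow_mul_pow k (n - j)]
  have : (((n - j + 1).ascFactorial (k + 1) : ℕ) : ℝ) ≠ 0 := by
    exact_mod_cast (Nat.ascFactorial_pos _ _).ne'
  field_simp

/-- The typical size of `-Z_(1)`. -/
noncomputable def minScale (n : ℕ) : ℝ := √(2 * log n)

/-- A level above which `-Z_(1)` lies with overwhelming probability. -/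
noncomputable def minScaleLow (n : ℕ) : ℝ := √(minScale n ^ 2 - minScale n)

/-- A level which `-Z_(1)` exceeds with small probability. -/
noncomputable def minScaleHigh (n : ℕ) : ℝ := √(minScale n ^ 2 + minScale n)

lemma tendsto_minScale : Tendsto minScale atTop atTop :=
  tendsto_sqrt_atTop.comp
    ((tendsto_log_atTop.comp tendsto_natCast_atTop_atTop).const_mul_atTop two_pos)

lemma exp_minScale {n : ℕ} (hn : 1 ≤ n) : exp (minScale n ^ 2 / 2) = n := by
  have h1 : (1 : ℝ) ≤ n := by exact_mod_cast hn
  rw [minScale, sq_sqrt (by have := log_nonneg h1; positivity), mul_div_cancel_left₀ _ two_ne_zero,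
    exp_log (by linarith)]

lemma natCast_pow_eq {n : ℕ} (hn : 1 ≤ n) (a : ℕ) :
    (n : ℝ) ^ a = exp (a * (minScale n ^ 2 / 2)) := by
  rw [exp_nat_mul, exp_minScale hn]

lemma eventually_one_le_minScale : ∀ᶠ n in atTop, 1 ≤ minScale n :=
  tendsto_minScale.eventually_ge_atTop 1

lemma sq_minScaleLow {n : ℕ} (h : 1 ≤ minScale n) :
    minScaleLow n ^ 2 = minScale n ^ 2 - minScale n := by
  rw [minScaleLow, sq_sqrt (by nlinarith)]

lemma sq_minScaleHigh {n : ℕ} (h : 1 ≤ minScale n) :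
    minScaleHigh n ^ 2 = minScale n ^ 2 + minScale n := by
  rw [minScaleHigh, sq_sqrt (by nlinarith)]

lemma tendsto_minScaleLow_div : Tendsto (fun n => minScaleLow n / minScale n) atTop (𝓝 1) := by
  have h : Tendsto (fun n => √(1 - 1 / minScale n)) atTop (𝓝 √(1 - 0)) :=
    (continuous_sqrt.tendsto _).comp
      (tendsto_const_nhds.sub (tendsto_const_nhds.div_atTop tendsto_minScale))
  simp only [sub_zero, sqrt_one] at h
  refine h.congr' ?_
  filter_upwards [eventually_one_le_minScale] with n hn
  rw [minScaleLow, eq_div_iff (by linarith)]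
  nth_rewrite 2 [← sqrt_sq (by linarith : 0 ≤ minScale n)]
  rw [← sqrt_mul' _ (sq_nonneg _)]
  congr 1; field_simp

lemma tendsto_minScaleHigh_div : Tendsto (fun n => minScaleHigh n / minScale n) atTop (𝓝 1) := by
  have h : Tendsto (fun n => √(1 + 1 / minScale n)) atTop (𝓝 √(1 + 0)) :=
    (continuous_sqrt.tendsto _).comp
      (tendsto_const_nhds.add (tendsto_const_nhds.div_atTop tendsto_minScale))
  simp only [add_zero, sqrt_one] at h
  refine h.congr' ?_
  filter_upwards [eventually_one_le_minScale] with n hn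
  rw [minScaleHigh, eq_div_iff (by linarith)]
  nth_rewrite 2 [← sqrt_sq (by linarith : 0 ≤ minScale n)]
  rw [← sqrt_mul' _ (sq_nonneg _)]
  congr 1; field_simp

lemma tendsto_minScaleLow : Tendsto minScaleLow atTop atTop := by
  have := tendsto_minScaleLow_div.pos_mul_atTop one_pos tendsto_minScale
  refine this.congr' ?_
  filter_upwards [eventually_one_le_minScale] with n hn
  field_simp

lemma tendsto_rpow_mul_exp {E : ℝ → ℝ} {b : ℝ} (hb : 0 < b) (s : ℝ)
    (hE : ∀ᶠ x in atTop, E x ≤ -b * x) :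
    Tendsto (fun x => x ^ s * exp (E x)) atTop (𝓝 0) := by
  refine tendsto_of_tendsto_of_tendsto_of_le_of_le' tendsto_const_nhds
    (tendsto_rpow_mul_exp_neg_mul_atTop_nhds_zero s b hb) ?_ ?_
  · filter_upwards [eventually_ge_atTop 0] with x hx
    positivity
  · filter_upwards [eventually_ge_atTop 0, hE] with x hx h
    gcongr

/-- With `L = minScale n` one has `exp (L² / 2) = n`. Lowering the squared level by `L` gains a
factor `exp (L / 2)`, which beats every power of `L`. The target `L³` is chosen because `exp (-L³)`
beats every power of `n`. -/
lemma eventually_le_mul_stdNormalCDF_minScaleLow :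
    ∀ᶠ n : ℕ in atTop, minScale n ^ 3 ≤ n * stdNormalCDF (-minScaleLow n) := by
  have h1 : ∀ᶠ x : ℝ in atTop, 2 * √(2 * π) * x ^ 4 ≤ exp (x / 2) := by
    have := tendsto_rpow_mul_exp (b := 1 / 2) (E := fun x => -(x / 2)) (by norm_num) 4
      (Eventually.of_forall fun x => by linarith)
    have hc : (0 : ℝ) < (2 * √(2 * π))⁻¹ := by positivity
    filter_upwards [this.eventually_lt_const hc] with x hx
    rw [exp_neg, ← div_eq_mul_inv, div_lt_iff₀ (exp_pos _), inv_mul_eq_div, lt_div_iff₀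
      (by positivity)] at hx
    have e : x ^ (4 : ℝ) = x ^ 4 := by norm_cast
    rw [e] at hx
    linarith
  filter_upwards [tendsto_minScale.eventually h1, eventually_one_le_minScale,
    tendsto_minScaleLow.eventually_gt_atTop 0, eventually_ge_atTop 1,
    tendsto_minScaleLow.eventually
      (tendsto_mul_stdNormalCDF_neg_div.eventually_const_lt (show (1 / 2 : ℝ) < 1 by norm_num))]
    with n hx hL hr hn hm
  rw [lt_div_iff₀ (stdNormalPDF_pos _), stdNormalPDF_eq, sq_minScaleLow hL] at hm
  have hrL : minScaleLow n ≤ minScale n := by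
    rw [minScaleLow, sqrt_le_left (by linarith)]; linarith
  have hexp : (n : ℝ) * exp (-(minScale n ^ 2 - minScale n) / 2) = exp (minScale n / 2) := by
    rw [← exp_minScale hn, ← exp_add]; congr 1; ring
  have hsq : (0 : ℝ) < √(2 * π) := by positivity
  have hn0 : (0 : ℝ) < n := by exact_mod_cast hn
  have hq := stdNormalCDF_pos (-minScaleLow n)
  have h3 : exp (minScale n / 2) ≤
      2 * √(2 * π) * (minScale n * (n * stdNormalCDF (-minScaleLow n))) := by
    rw [← hexp]
    have : exp (-(minScale n ^ 2 - minScale n) / 2) ≤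
        2 * √(2 * π) * (minScaleLow n * stdNormalCDF (-minScaleLow n)) := by
      have e : 2 * √(2 * π) * (1 / 2 * ((√(2 * π))⁻¹ * exp (-(minScale n ^ 2 - minScale n) / 2))) =
        exp (-(minScale n ^ 2 - minScale n) / 2) := by field_simp
      rw [← e]
      gcongr
    calc _ ≤ n * (2 * √(2 * π) * (minScaleLow n * stdNormalCDF (-minScaleLow n))) := by gcongr
      _ = 2 * √(2 * π) * (minScaleLow n * (n * stdNormalCDF (-minScaleLow n))) := by ring
      _ ≤ _ := by gcongr
  have h4 : 2 * √(2 * π) * minScale n ^ 4 ≤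
      2 * √(2 * π) * (minScale n * (n * stdNormalCDF (-minScaleLow n))) := hx.trans h3
  have h5 := le_of_mul_le_mul_left h4 (by positivity)
  have h6 : minScale n * minScale n ^ 3 ≤ minScale n * (n * stdNormalCDF (-minScaleLow n)) := by
    calc _ = minScale n ^ 4 := by ring
      _ ≤ _ := h5
  exact le_of_mul_le_mul_left h6 (by linarith)

/-- With overwhelming probability the minimum of `n - j` standard normals is below
`-minScaleLow n`. -/
lemma eventually_one_sub_pow_le (j : ℕ) : ∀ᶠ n : ℕ in atTop,
    (1 - stdNormalCDF (-minScaleLow n)) ^ (n - j) ≤ exp j * exp (-minScale n ^ 3) := by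
  filter_upwards [eventually_le_mul_stdNormalCDF_minScaleLow, eventually_ge_atTop j] with n h hn
  have h0 := stdNormalCDF_pos (-minScaleLow n)
  have h1 := stdNormalCDF_le_one (-minScaleLow n)
  have h2 := one_sub_le_exp_neg (stdNormalCDF (-minScaleLow n))
  calc (1 - stdNormalCDF (-minScaleLow n)) ^ (n - j)
      ≤ exp (-stdNormalCDF (-minScaleLow n)) ^ (n - j) := by gcongr
    _ = exp (((n : ℝ) - j) * -stdNormalCDF (-minScaleLow n)) := by
      rw [← exp_nat_mul, Nat.cast_sub hn]
    _ ≤ exp (j + -minScale n ^ 3) := by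
      gcongr
      have : (j : ℝ) * stdNormalCDF (-minScaleLow n) ≤ j * 1 := by gcongr
      nlinarith
    _ = _ := exp_add _ _

lemma tendsto_natCast_pow_mul_exp_cube (a : ℕ) (s : ℝ) :
    Tendsto (fun n : ℕ => (n : ℝ) ^ a * minScale n ^ s * exp (-minScale n ^ 3)) atTop (𝓝 0) := by
  have h := (tendsto_rpow_mul_exp (b := 1) one_pos s (E := fun x => a * (x ^ 2 / 2) - x ^ 3)
    (by
      filter_upwards [eventually_ge_atTop ((a : ℝ) + 1)] with x hx
      have ha : (0 : ℝ) ≤ a := a.cast_nonneg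
      have hx1 : 1 ≤ x := by linarith
      have : (a + 1) * x ^ 2 ≤ x * x ^ 2 := by gcongr
      nlinarith)).comp tendsto_minScale
  refine h.congr' ?_
  filter_upwards [eventually_ge_atTop 1] with n hn
  rw [natCast_pow_eq hn, Function.comp, sub_eq_add_neg, exp_add]
  ring

/-- A power of `n` against a Gaussian tail beyond a multiple of the typical minimum. -/
lemma tendsto_natCast_pow_mul_exp_low {a : ℕ} {β : ℝ} (hβ : a < 2 * β) (s : ℝ) :
    Tendsto (fun n : ℕ => (n : ℝ) ^ a * minScale n ^ s * exp (-(β * minScaleLow n ^ 2))) atTop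
      (𝓝 0) := by
  have h := (tendsto_rpow_mul_exp (b := 1) one_pos s
    (E := fun x => a * (x ^ 2 / 2) - β * (x ^ 2 - x))
    (by
      have hd : 0 < β - a / 2 := by linarith
      filter_upwards [eventually_ge_atTop ((β + 1) / (β - a / 2)), eventually_ge_atTop 0]
        with x hx hx0
      rw [div_le_iff₀ hd] at hx
      nlinarith)).comp tendsto_minScale
  refine h.congr' ?_
  filter_upwards [eventually_ge_atTop 1, eventually_one_le_minScale] with n hn hL
  rw [natCast_pow_eq hn, Function.comp, sub_eq_add_neg, exp_add, sq_minScaleLow hL]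
  ring

lemma tendsto_natCast_pow_mul_exp_high {a : ℕ} (ha : 0 < a) (s : ℝ) :
    Tendsto (fun n : ℕ => (n : ℝ) ^ a * minScale n ^ s * exp (-(a * minScaleHigh n ^ 2 / 2)))
      atTop (𝓝 0) := by
  have ha' : (0 : ℝ) < a := by exact_mod_cast ha
  have h := (tendsto_rpow_mul_exp (b := a / 2) (by positivity) s
    (E := fun x => a * (x ^ 2 / 2) - a * (x ^ 2 + x) / 2)
    (Eventually.of_forall fun x => by ring_nf; rfl)).comp tendsto_minScale
  refine h.congr' ?_
  filter_upwards [eventually_ge_atTop 1, eventually_one_le_minScale] with n hn hL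
  rw [natCast_pow_eq hn, Function.comp, sub_eq_add_neg, exp_add, sq_minScaleHigh hL]
  ring

/-- If `f(x) ~ C Φ(x) ^ k |x| ^ p` at `-∞` then
`∫ f (1 - Φ) ^ (n - j) dγ ~ C k! L ^ p / n ^ (k + 1)` with `L = √(2 log n)`. -/
theorem tendsto_integral_mul_one_sub_pow {f : ℝ → ℝ} (hf : Measurable f) (hf0 : ∀ x, 0 ≤ f x)
    (hf1 : ∀ x, f x ≤ 1) {k : ℕ} {p : ℤ} (hp : p ≤ 1) {C : ℝ}
    (hlim : Tendsto (fun t => f (-t) / (stdNormalCDF (-t) ^ (k + 1) * t ^ p)) atTop (𝓝 C)) (j : ℕ) :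
    Tendsto (fun n : ℕ => (n : ℝ) ^ (k + 2) * minScale n ^ (-p) *
      ∫ x, f x * (1 - stdNormalCDF x) ^ (n - j) ∂(gaussianReal 0 1)) atTop
      (𝓝 (C * (k + 1).factorial)) := by
  have hC : 0 ≤ C := ge_of_tendsto hlim (by
    filter_upwards [eventually_gt_atTop 0] with t ht
    have := hf0 (-t)
    have := stdNormalCDF_pos (-t)
    positivity)
  have hbeta := tendsto_pow_mul_integral_pow (k + 1) j
  have hfint : ∀ N, Integrable (fun x => f x * (1 - stdNormalCDF x) ^ N) (gaussianReal 0 1) := by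
    intro N
    have hm := measurable_pow_mul_pow 0 N
    simp only [pow_zero, one_mul] at hm
    refine integrable_of_continuous_of_bound (hf.mul hm) 1 (fun x => ?_) _
    have h := pow_mul_pow_mem 0 N x
    simp only [pow_zero, one_mul] at h
    rw [Pi.mul_apply, abs_of_nonneg (mul_nonneg (hf0 x) h.1)]
    exact mul_le_one₀ (hf1 x) h.1 h.2
  -- The comparison is with `C` times a Beta integral, whose limit is known. It remains to make the
  -- difference of the integrands small on and off the window of typical minima.
  suffices hd : Tendsto (fun n : ℕ => (n : ℝ) ^ (k + 2) * minScale n ^ (-p) *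
      (∫ x, f x * (1 - stdNormalCDF x) ^ (n - j) ∂(gaussianReal 0 1)) -
      C * ((n : ℝ) ^ (k + 1 + 1) * ∫ x, stdNormalCDF x ^ (k + 1) * (1 - stdNormalCDF x) ^ (n - j)
        ∂(gaussianReal 0 1))) atTop (𝓝 0) by
    have := hd.add (hbeta.const_mul C)
    simpa using this
  -- uniform approximation on the window `[-minScaleHigh n, -minScaleLow n]`
  have hmid : ∀ ε > 0, ∀ᶠ n : ℕ in atTop, ∀ t, minScaleLow n ≤ t → t ≤ minScaleHigh n →
      |f (-t) / (stdNormalCDF (-t) ^ (k + 1) * t ^ p) * (t / minScale n) ^ p - C| ≤ ε := by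
    intro ε hε
    have h1 : Tendsto (fun q : ℝ × ℝ => q.1 * q.2 ^ p) (𝓝 C ×ˢ 𝓝 1) (𝓝 C) := by
      rw [← nhds_prod_eq]
      have : ContinuousAt (fun q : ℝ × ℝ => q.1 * q.2 ^ p) (C, 1) :=
        continuousAt_fst.mul (continuousAt_snd.zpow₀ p (Or.inl one_ne_zero))
      simpa [ContinuousAt] using this
    have h2 := h1.eventually (Metric.closedBall_mem_nhds C hε)
    rw [eventually_prod_iff] at h2
    obtain ⟨pa, ha, pb, hb, hab⟩ := h2
    have ha' := hlim.eventually ha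
    obtain ⟨T, hT⟩ := eventually_atTop.1 ha'
    obtain ⟨δ, hδ, hball⟩ := Metric.eventually_nhds_iff_ball.1 hb
    filter_upwards [tendsto_minScaleLow.eventually_ge_atTop T, eventually_one_le_minScale,
      tendsto_minScaleLow_div.eventually (Ioo_mem_nhds (show 1 - δ < 1 by linarith) (lt_add_one 1)),
      tendsto_minScaleHigh_div.eventually
        (Ioo_mem_nhds (show (0 : ℝ) < 1 by norm_num) (show 1 < 1 + δ by linarith))]
      with n h3 hL h4 h5 t h6 h7
    have hb' : pb (t / minScale n) := by
      apply hball
      have hL0 : 0 < minScale n := by linarith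
      rw [Metric.mem_ball, dist_eq, abs_lt]
      constructor
      · have : minScaleLow n / minScale n ≤ t / minScale n := by gcongr
        linarith [h4.1]
      · have : t / minScale n ≤ minScaleHigh n / minScale n := by gcongr
        linarith [h5.2]
    have := hab (hT t (h3.trans h6)) hb'
    rwa [dist_eq] at this
  -- a crude bound far to the left
  have hfar : ∀ᶠ t in atTop, f (-t) ≤ (C + 1) * (stdNormalCDF (-t) ^ k * exp (-t ^ 2 / 2)) := by
    filter_upwards [hlim.eventually_le_const (show C < C + 1 by linarith), eventually_ge_atTop 1]
      with t h ht
    have hΦ := stdNormalCDF_pos (-t)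
    rw [div_le_iff₀ (by positivity)] at h
    -- This is where `p ≤ 1` enters: a single power of `t` is absorbed by `t * Φ(-t) ≤ φ(t)`.
    have h2 : t ^ p ≤ t := by
      calc t ^ p ≤ t ^ (1 : ℤ) := zpow_le_zpow_right₀ ht hp
        _ = t := zpow_one t
    calc f (-t) ≤ (C + 1) * (stdNormalCDF (-t) ^ (k + 1) * t ^ p) := h
      _ ≤ (C + 1) * (stdNormalCDF (-t) ^ (k + 1) * t) := by gcongr
      _ = (C + 1) * (stdNormalCDF (-t) ^ k * (t * stdNormalCDF (-t))) := by ring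
      _ ≤ _ := by
        gcongr
        exact (mul_stdNormalCDF_neg_le (by linarith)).trans (stdNormalPDF_le t)
  obtain ⟨T, hT⟩ := eventually_atTop.1 hfar
  -- `A n` bounds the error to the right of the window, where the power of `1 - Φ` is tiny. `B n`
  -- bounds it to the left, where the Gaussian mass is small.
  set A : ℕ → ℝ := fun n => (minScale n ^ (-p) + C) * (exp j * exp (-minScale n ^ 3)) with hA
  set B : ℕ → ℝ := fun n => (minScale n ^ (-p) * (C + 1) + C) *
    exp (-((k + 1 : ℕ) * minScaleHigh n ^ 2 / 2)) with hB
  have hAlim : Tendsto (fun n : ℕ => (n : ℝ) ^ (k + 2) * A n) atTop (𝓝 0) := by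
    have h1 := tendsto_natCast_pow_mul_exp_cube (k + 2) (-p : ℤ)
    have h2 := tendsto_natCast_pow_mul_exp_cube (k + 2) 0
    have := (h1.add (h2.const_mul C)).const_mul (exp j)
    simp only [rpow_intCast, rpow_zero, mul_zero, add_zero] at this
    refine this.congr fun n => ?_
    rw [hA]; ring
  have hBlim : Tendsto (fun n : ℕ => (n : ℝ) ^ (k + 2) *
      (B n * stdNormalCDF (-minScaleHigh n))) atTop (𝓝 0) := by
    -- `B n` carries `k + 1` Gaussian factors at the level `minScaleHigh n`, and the mass of the
    -- left tail supplies one more. The total `k + 2` matches the power of `n`.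
    have h1 := tendsto_natCast_pow_mul_exp_high (Nat.succ_pos (k + 1)) (-p : ℤ)
    have h2 := tendsto_natCast_pow_mul_exp_high (Nat.succ_pos (k + 1)) 0
    have := ((h1.mul_const (C + 1)).add (h2.const_mul C))
    simp only [rpow_intCast, rpow_zero, zero_mul, mul_zero, add_zero] at this
    refine squeeze_zero' ?_ ?_ this
    · filter_upwards [eventually_one_le_minScale] with n hn
      have := stdNormalCDF_pos (-minScaleHigh n)
      rw [hB]; positivity
    · filter_upwards [eventually_one_le_minScale] with n hn
      have h3 := stdNormalCDF_neg_le_exp (sqrt_nonneg (minScale n ^ 2 + minScale n))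
      have e : exp (-((k + 1).succ * minScaleHigh n ^ 2 / 2)) =
          exp (-((k + 1 : ℕ) * minScaleHigh n ^ 2 / 2)) * exp (-minScaleHigh n ^ 2 / 2) := by
        rw [← exp_add]; congr 1; push_cast; ring
      calc _ ≤ (n : ℝ) ^ (k + 2) * (B n * exp (-minScaleHigh n ^ 2 / 2)) := by
            have : 0 ≤ B n := by rw [hB]; positivity
            gcongr; exact h3
        _ = _ := by rw [hB, e]; simp only [Nat.succ_eq_add_one]; ring
  rw [Metric.tendsto_atTop']
  intro ε hε
  obtain ⟨N0, hN0⟩ := eventually_atTop.1 (show ∀ᶠ n : ℕ in atTop, dist ((n : ℝ) ^ (k + 2) * minScale n ^ (-p) *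
      (∫ x, f x * (1 - stdNormalCDF x) ^ (n - j) ∂(gaussianReal 0 1)) -
      C * ((n : ℝ) ^ (k + 1 + 1) * ∫ x, stdNormalCDF x ^ (k + 1) * (1 - stdNormalCDF x) ^ (n - j)
        ∂(gaussianReal 0 1))) 0 < ε by
    set M : ℝ := (k + 1).factorial + 1 with hM
    have hMpos : 0 < M := by positivity
    filter_upwards [hmid (ε / (4 * M)) (by positivity), eventually_one_le_minScale,
      tendsto_minScaleLow.eventually_ge_atTop (max T 1), eventually_one_sub_pow_le j,
      hbeta.eventually_le_const (show ((k + 1).factorial : ℝ) < M by linarith),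
      hAlim.eventually_lt_const (show 0 < ε / 4 by linarith),
      hBlim.eventually_lt_const (show 0 < ε / 4 by linarith)] with n hmid hL hlow hcube hbn hAn hBn
    have hL0 : 0 < minScale n := by linarith
    have hlz : 0 < minScale n ^ (-p) := zpow_pos hL0 _
    have hpt : ∀ x, |minScale n ^ (-p) * (f x * (1 - stdNormalCDF x) ^ (n - j)) -
        C * (stdNormalCDF x ^ (k + 1) * (1 - stdNormalCDF x) ^ (n - j))| ≤
        ε / (4 * M) * (stdNormalCDF x ^ (k + 1) * (1 - stdNormalCDF x) ^ (n - j)) +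
        (A n + (Iic (-minScaleHigh n)).indicator (fun _ => B n) x) := by
      intro x
      have hΦ0 := stdNormalCDF_pos x
      have hΦ1 := stdNormalCDF_le_one x
      have hA0 : 0 ≤ A n := by rw [hA]; positivity
      have hB0 : 0 ≤ B n := by rw [hB]; positivity
      have hI0 : 0 ≤ (Iic (-minScaleHigh n)).indicator (fun _ => B n) x :=
        indicator_nonneg (fun _ _ => hB0) x
      have hw0 : 0 ≤ (1 - stdNormalCDF x) ^ (n - j) := pow_nonneg (by linarith) _
      have hw1 : (1 - stdNormalCDF x) ^ (n - j) ≤ 1 := pow_le_one₀ (by linarith) (by linarith)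
      have hm0 : 0 ≤ ε / (4 * M) * (stdNormalCDF x ^ (k + 1) * (1 - stdNormalCDF x) ^ (n - j)) := by
        positivity
      have e : minScale n ^ (-p) * (f x * (1 - stdNormalCDF x) ^ (n - j)) -
        C * (stdNormalCDF x ^ (k + 1) * (1 - stdNormalCDF x) ^ (n - j)) =
        (minScale n ^ (-p) * f x - C * stdNormalCDF x ^ (k + 1)) *
          (1 - stdNormalCDF x) ^ (n - j) := by ring
      rw [e, abs_mul, abs_of_nonneg hw0]
      have hcr : |minScale n ^ (-p) * f x - C * stdNormalCDF x ^ (k + 1)| ≤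
          minScale n ^ (-p) * f x + C * stdNormalCDF x ^ (k + 1) := by
        have h1 : 0 ≤ minScale n ^ (-p) * f x := mul_nonneg hlz.le (hf0 x)
        have h2 : 0 ≤ C * stdNormalCDF x ^ (k + 1) := by positivity
        rw [abs_le]; constructor <;> linarith
      rcases lt_or_ge (-minScaleLow n) x with hx | hx
      · have h1 : (1 - stdNormalCDF x) ^ (n - j) ≤ exp j * exp (-minScale n ^ 3) := by
          refine le_trans ?_ hcube
          have := stdNormalCDF_mono hx.le
          gcongr
        have h2 : minScale n ^ (-p) * f x + C * stdNormalCDF x ^ (k + 1) ≤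
            minScale n ^ (-p) + C := by
          have h3 : stdNormalCDF x ^ (k + 1) ≤ 1 := pow_le_one₀ hΦ0.le hΦ1
          have h4 : minScale n ^ (-p) * f x ≤ minScale n ^ (-p) * 1 := by gcongr; exact hf1 x
          have h5 : C * stdNormalCDF x ^ (k + 1) ≤ C * 1 := by gcongr
          linarith
        have : |minScale n ^ (-p) * f x - C * stdNormalCDF x ^ (k + 1)| *
            (1 - stdNormalCDF x) ^ (n - j) ≤ A n := by
          rw [hA]
          exact mul_le_mul (hcr.trans h2) h1 hw0 (by positivity)
        linarith
      · obtain ⟨t, rfl⟩ : ∃ t, x = -t := ⟨-x, by simp⟩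
        have ht : minScaleLow n ≤ t := by linarith
        have hTt : T ≤ t := (le_max_left _ _).trans (hlow.trans ht)
        have ht1 : 1 ≤ t := (le_max_right _ _).trans (hlow.trans ht)
        have ht0 : 0 < t := by linarith
        rcases le_or_gt t (minScaleHigh n) with htR | htR
        · have h1 := hmid t ht htR
          have h2 : minScale n ^ (-p) * f (-t) - C * stdNormalCDF (-t) ^ (k + 1) =
              (f (-t) / (stdNormalCDF (-t) ^ (k + 1) * t ^ p) * (t / minScale n) ^ p - C) *
                stdNormalCDF (-t) ^ (k + 1) := by
            have : t ^ p ≠ 0 := (zpow_pos ht0 p).ne'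
            rw [div_zpow, zpow_neg]
            field_simp
          rw [h2, abs_mul, abs_of_nonneg (pow_nonneg hΦ0.le _), mul_assoc]
          have := mul_le_mul_of_nonneg_right h1
            (mul_nonneg (pow_nonneg hΦ0.le (k + 1)) hw0)
          linarith
        · have hmem : -t ∈ Iic (-minScaleHigh n) := by simp; exact htR.le
          rw [indicator_of_mem hmem]
          have hR0 : 0 ≤ minScaleHigh n := sqrt_nonneg _
          have h1 : stdNormalCDF (-t) ≤ exp (-minScaleHigh n ^ 2 / 2) :=
            (stdNormalCDF_neg_le_exp ht0.le).trans (exp_le_exp.2 (by nlinarith))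
          have h1' : exp (-t ^ 2 / 2) ≤ exp (-minScaleHigh n ^ 2 / 2) :=
            exp_le_exp.2 (by nlinarith)
          have hpow : ∀ i : ℕ, exp (-(i * minScaleHigh n ^ 2 / 2)) =
              exp (-minScaleHigh n ^ 2 / 2) ^ i := by
            intro i; rw [← exp_nat_mul]; congr 1; ring
          have h2 : f (-t) ≤ (C + 1) * exp (-((k + 1 : ℕ) * minScaleHigh n ^ 2 / 2)) := by
            refine (hT t hTt).trans ?_
            rw [hpow]
            have : stdNormalCDF (-t) ^ k * exp (-t ^ 2 / 2) ≤
                exp (-minScaleHigh n ^ 2 / 2) ^ k * exp (-minScaleHigh n ^ 2 / 2) :=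
              mul_le_mul (pow_le_pow_left₀ hΦ0.le h1 k) h1' (exp_pos _).le (by positivity)
            rw [pow_succ _ k]
            gcongr
          have h3 : stdNormalCDF (-t) ^ (k + 1) ≤ exp (-((k + 1 : ℕ) * minScaleHigh n ^ 2 / 2)) := by
            rw [hpow]; gcongr
          have h4 : |minScale n ^ (-p) * f (-t) - C * stdNormalCDF (-t) ^ (k + 1)| *
            (1 - stdNormalCDF (-t)) ^ (n - j) ≤ B n := by
            calc _ ≤ (minScale n ^ (-p) * f (-t) + C * stdNormalCDF (-t) ^ (k + 1)) * 1 := by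
                  gcongr
                  exact add_nonneg (mul_nonneg hlz.le (hf0 _)) (by positivity)
              _ ≤ (minScale n ^ (-p) * ((C + 1) * exp (-((k + 1 : ℕ) * minScaleHigh n ^ 2 / 2))) +
                  C * exp (-((k + 1 : ℕ) * minScaleHigh n ^ 2 / 2))) * 1 := by gcongr
              _ = B n := by rw [hB]; ring
          linarith
    have hi1 := (hfint (n - j)).const_mul (minScale n ^ (-p))
    have hi2 := (integrable_pow_mul_pow (k + 1) (n - j)).const_mul C
    have hi3 := (integrable_pow_mul_pow (k + 1) (n - j)).const_mul (ε / (4 * M))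
    have hi4 : Integrable (fun x => A n + (Iic (-minScaleHigh n)).indicator (fun _ => B n) x)
        (gaussianReal 0 1) :=
      (integrable_const _).add ((integrable_const _).indicator measurableSet_Iic)
    have key : |minScale n ^ (-p) * (∫ x, f x * (1 - stdNormalCDF x) ^ (n - j) ∂(gaussianReal 0 1))
        - C * ∫ x, stdNormalCDF x ^ (k + 1) * (1 - stdNormalCDF x) ^ (n - j) ∂(gaussianReal 0 1)| ≤
        ε / (4 * M) * (∫ x, stdNormalCDF x ^ (k + 1) * (1 - stdNormalCDF x) ^ (n - j)
          ∂(gaussianReal 0 1)) + (A n + B n * stdNormalCDF (-minScaleHigh n)) := by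
      rw [← integral_const_mul, ← integral_const_mul, ← integral_sub hi1 hi2]
      refine (abs_integral_le_integral_abs).trans ((integral_mono (hi1.sub hi2).abs
        (hi3.add hi4) hpt).trans ?_)
      rw [integral_add' hi3 hi4, integral_const_mul, integral_add (integrable_const _)
        ((integrable_const _).indicator measurableSet_Iic), integral_indicator measurableSet_Iic]
      simp [stdNormalCDF_eq_real, mul_comm]
    have hnk : (0 : ℝ) ≤ (n : ℝ) ^ (k + 2) := by positivity
    rw [dist_eq, sub_zero]
    set I1 := ∫ x, f x * (1 - stdNormalCDF x) ^ (n - j) ∂(gaussianReal 0 1)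
    set I2 := ∫ x, stdNormalCDF x ^ (k + 1) * (1 - stdNormalCDF x) ^ (n - j) ∂(gaussianReal 0 1)
    have e2 : (n : ℝ) ^ (k + 2) * minScale n ^ (-p) * I1 - C * ((n : ℝ) ^ (k + 1 + 1) * I2) =
        (n : ℝ) ^ (k + 2) * (minScale n ^ (-p) * I1 - C * I2) := by ring
    rw [e2, abs_mul, abs_of_nonneg hnk]
    calc _ ≤ (n : ℝ) ^ (k + 2) * (ε / (4 * M) * I2 + (A n + B n * stdNormalCDF (-minScaleHigh n))) := by
          gcongr
      _ = ε / (4 * M) * ((n : ℝ) ^ (k + 1 + 1) * I2) + (n : ℝ) ^ (k + 2) * A n +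
          (n : ℝ) ^ (k + 2) * (B n * stdNormalCDF (-minScaleHigh n)) := by ring
      _ ≤ ε / (4 * M) * M + (n : ℝ) ^ (k + 2) * A n +
          (n : ℝ) ^ (k + 2) * (B n * stdNormalCDF (-minScaleHigh n)) := by gcongr
      _ = ε / 4 + (n : ℝ) ^ (k + 2) * A n +
          (n : ℝ) ^ (k + 2) * (B n * stdNormalCDF (-minScaleHigh n)) := by field_simp
      _ < ε := by linarith)
  exact ⟨N0, fun n hn => hN0 n hn.le⟩

end Abelian

end StQP

namespace StQP

/-! ### From the gap integral to powers of `n` and `√(2 log n)`. -/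

section GapAsymptotics

open Real Set

variable {m : ℕ} {c : ℝ → ℝ → ℝ → ℝ}

/-- The integrand of `gapIntegral`. -/
noncomputable def gapKernel (m : ℕ) (c : ℝ → ℝ → ℝ → ℝ) (x y z : ℝ) : ℝ :=
  c x y z * (stdNormalCDF y - stdNormalCDF x) ^ m * halfCDF (x - √((y - x) * (z - x)))

lemma measurable_gapKernel (hc : IsGapWeight m c) :
    Measurable (fun p : ℝ × ℝ × ℝ => gapKernel m c p.1 p.2.1 p.2.2) := by
  have h3 := continuous_stdNormalCDF
  have h4 := continuous_halfCDF
  unfold gapKernel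
  refine (hc.measurable.mul ?_).mul ?_
  · exact (by fun_prop : Continuous fun p : ℝ × ℝ × ℝ =>
      (stdNormalCDF p.2.1 - stdNormalCDF p.1) ^ m).measurable
  · exact (by fun_prop : Continuous fun p : ℝ × ℝ × ℝ =>
      halfCDF (p.1 - √((p.2.1 - p.1) * (p.2.2 - p.1)))).measurable

lemma gapKernel_mem (hc : IsGapWeight m c) (x y z : ℝ) :
    0 ≤ gapKernel m c x y z ∧ gapKernel m c x y z ≤ 1 := by
  by_cases h : c x y z = 0
  · simp [gapKernel, h]
  have hxy := stdNormalCDF_mono (hc.supp x y z h).1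
  have h0 := hc.nonneg x y z
  have h1 := hc.le_one x y z
  have h2 := (stdNormalCDF_pos x)
  have h3 := stdNormalCDF_le_one y
  have h4 : 0 ≤ stdNormalCDF y - stdNormalCDF x := by linarith
  have h5 := (halfCDF_pos (x - √((y - x) * (z - x)))).le
  unfold gapKernel
  exact ⟨by positivity, mul_le_one₀ (mul_le_one₀ h1 (by positivity)
    (pow_le_one₀ h4 (by linarith))) h5 (halfCDF_le_one _)⟩

lemma measurable_gapIntegral (hc : IsGapWeight m c) : Measurable (gapIntegral m c) := by
  have h1 : Measurable (fun p : (ℝ × ℝ) × ℝ => gapKernel m c p.1.1 p.2 p.1.2) :=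
    (measurable_gapKernel hc).comp (by fun_prop : Measurable fun p : (ℝ × ℝ) × ℝ =>
      (p.1.1, p.2, p.1.2))
  have h2 := h1.stronglyMeasurable.integral_prod_right' (ν := gaussianReal 0 1)
  exact (h2.integral_prod_right' (ν := gaussianReal 0 1)).measurable

lemma integral_mem_Icc {α : Type*} [MeasurableSpace α] {μ : Measure α} [IsProbabilityMeasure μ]
    {f : α → ℝ} (h : ∀ x, 0 ≤ f x ∧ f x ≤ 1) : 0 ≤ ∫ x, f x ∂μ ∧ ∫ x, f x ∂μ ≤ 1 := by
  refine ⟨integral_nonneg fun x => (h x).1, ?_⟩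
  have := integral_mono_of_nonneg (ae_of_all μ fun x => (h x).1) (integrable_const (1 : ℝ))
    (ae_of_all μ fun x => (h x).2)
  simpa using this

lemma gapIntegral_mem (hc : IsGapWeight m c) (x : ℝ) :
    0 ≤ gapIntegral m c x ∧ gapIntegral m c x ≤ 1 :=
  integral_mem_Icc fun z => integral_mem_Icc fun y => gapKernel_mem hc x y z

/-- Substituting `φ(t) ∼ t Φ(-t)` and the `N(0, 1/2)` tail `√π t Φ(-t)²` into `tendsto_gapIntegral`
leaves `Φ(-t) ^ (m + 3)` and `t ^ (m + 2 - 3 (m + 1))`. -/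
lemma tendsto_gapIntegral_div (hc : IsGapWeight m c) :
    Tendsto (fun t => gapIntegral m c (-t) /
      (stdNormalCDF (-t) ^ (m + 2 + 1) * t ^ (-(2 * m + 1 : ℤ)))) atTop
      (𝓝 (2 * (2 * m + 1).factorial / 2 ^ (2 * m + 2) * √π)) := by
  have h1 := tendsto_gapIntegral hc
  rw [integral_pow_mul_exp_neg_sqrt] at h1
  have h2 := (tendsto_mul_stdNormalCDF_neg_div.inv₀ one_ne_zero).pow (m + 1)
  have h := (h1.mul h2).mul tendsto_halfCDF_div
  rw [inv_one, one_pow, mul_one] at h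
  refine h.congr' ?_
  filter_upwards [eventually_gt_atTop 0] with t ht
  have hp := (stdNormalPDF_pos t).ne'
  have hq := (halfCDF_pos (-t)).ne'
  have hΦ := (stdNormalCDF_pos (-t)).ne'
  have e : t ^ (-(2 * m + 1 : ℤ)) = (t ^ (2 * m + 1))⁻¹ := by
    rw [zpow_neg]; norm_cast
  rw [e, inv_div, div_pow, mul_pow]
  field_simp
  ring

/-- `n ^ (m + 4) L ^ (2 m + 1) ∫ gapIntegral m c (1 - Φ) ^ (n - j) dγ` converges. -/
lemma tendsto_integral_gapIntegral (hc : IsGapWeight m c) (j : ℕ) :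
    Tendsto (fun n : ℕ => (n : ℝ) ^ (m + 4) * minScale n ^ (2 * m + 1) *
      ∫ x, gapIntegral m c x * (1 - stdNormalCDF x) ^ (n - j) ∂(gaussianReal 0 1)) atTop
      (𝓝 (2 * (2 * m + 1).factorial / 2 ^ (2 * m + 2) * √π * (m + 3).factorial)) := by
  have h := tendsto_integral_mul_one_sub_pow (measurable_gapIntegral hc)
    (fun x => (gapIntegral_mem hc x).1) (fun x => (gapIntegral_mem hc x).2)
    (by omega) (tendsto_gapIntegral_div hc) j
  refine h.congr fun n => ?_
  congr 2

/-- The weight `1{x ≤ y ≤ z}`. -/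
noncomputable def fullWeight (x y z : ℝ) : ℝ := if x ≤ y ∧ y ≤ z then 1 else 0

/-- The weight `1{x < y < z, y ≤ x + x⁻²}`. -/
noncomputable def cutWeight (x y z : ℝ) : ℝ :=
  if x < y ∧ y < z ∧ y ≤ x + 1 / x ^ 2 then 1 else 0

lemma eventually_add_div_cube_lt (k z : ℝ) : ∀ᶠ t : ℝ in atTop, -t + k / t ^ 3 < z := by
  have h : Tendsto (fun t : ℝ => -t + k / t ^ 3) atTop atBot :=
    tendsto_neg_atTop_atBot.atBot_add (tendsto_const_nhds.div_atTop (tendsto_pow_atTop three_ne_zero))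
  exact h.eventually_lt_atBot z

lemma isGapWeight_fullWeight (hm : m ≤ 1) : IsGapWeight m fullWeight where
  nonneg x y z := by unfold fullWeight; split_ifs <;> norm_num
  le_one x y z := by unfold fullWeight; split_ifs <;> norm_num
  measurable := by
    unfold fullWeight
    refine Measurable.ite ?_ measurable_const measurable_const
    exact (measurableSet_le measurable_fst measurable_snd.fst).inter
      (measurableSet_le measurable_snd.fst measurable_snd.snd)
  supp x y z h := by
    simp only [fullWeight, ne_eq, ite_eq_right_iff, one_ne_zero, imp_false, not_not] at h
    exact ⟨h.1, h.2, Or.inl hm⟩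
  tendsto k hk z := by
    refine tendsto_const_nhds.congr' ?_
    filter_upwards [eventually_add_div_cube_lt k z, eventually_gt_atTop 0] with t h1 h2
    have : 0 < k / t ^ 3 := by positivity
    rw [fullWeight, if_pos ⟨by linarith, h1.le⟩]

/-- Relevant gaps are of order `t⁻³`, so truncating them at `t⁻²` does not change the limit. It does
make the order `m = 2` available, which the lower bound for `B_n` needs for its error term. -/
lemma isGapWeight_cutWeight (hm : m ≤ 2) : IsGapWeight m cutWeight where
  nonneg x y z := by unfold cutWeight; split_ifs <;> norm_num
  le_one x y z := by unfold cutWeight; split_ifs <;> norm_num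
  measurable := by
    unfold cutWeight
    refine Measurable.ite ?_ measurable_const measurable_const
    exact (measurableSet_lt measurable_fst measurable_snd.fst).inter
      ((measurableSet_lt measurable_snd.fst measurable_snd.snd).inter
        (measurableSet_le measurable_snd.fst
          (by fun_prop : Measurable fun p : ℝ × ℝ × ℝ => p.1 + 1 / p.1 ^ 2)))
  supp x y z h := by
    simp only [cutWeight, ne_eq, ite_eq_right_iff, one_ne_zero, imp_false, not_not] at h
    exact ⟨h.1.le, h.2.1.le, Or.inr ⟨hm, h.2.2⟩⟩
  tendsto k hk z := by
    refine tendsto_const_nhds.congr' ?_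
    filter_upwards [eventually_add_div_cube_lt k z, eventually_gt_atTop 0, eventually_ge_atTop k]
      with t h1 h2 h3
    have h4 : 0 < k / t ^ 3 := by positivity
    have h5 : k / t ^ 3 ≤ 1 / t ^ 2 := by
      rw [div_le_div_iff₀ (by positivity) (by positivity)]
      nlinarith [sq_nonneg t]
    rw [cutWeight, if_pos ⟨by linarith, h1, by rw [neg_sq]; linarith⟩]

lemma measurable_halfCDF_integrand : Measurable halfCDF := continuous_halfCDF.measurable

lemma tendsto_integral_halfCDF (j : ℕ) :
    Tendsto (fun n : ℕ => (n : ℝ) ^ 3 * (minScale n)⁻¹ *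
      ∫ x, halfCDF x * (1 - stdNormalCDF x) ^ (n - j) ∂(gaussianReal 0 1)) atTop
      (𝓝 (√π * 2)) := by
  have hlim : Tendsto (fun t => halfCDF (-t) / (stdNormalCDF (-t) ^ (1 + 1) * t ^ (1 : ℤ))) atTop
      (𝓝 √π) := by
    refine tendsto_halfCDF_div.congr fun t => ?_
    rw [zpow_one, mul_comm t]
  have h := tendsto_integral_mul_one_sub_pow measurable_halfCDF_integrand
    (fun x => (halfCDF_pos x).le) halfCDF_le_one le_rfl hlim j
  simpa [zpow_neg] using h

end GapAsymptotics

end StQP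

namespace StQP

/-! ### Integrating functions of a few coordinates over a product measure. -/

section PiIntegrals

open Real Set Function

lemma abs_mul_prod_le_one {κ : Type*} {f : ℝ} (hf : 0 ≤ f ∧ f ≤ 1) {T : Finset κ} {w : κ → ℝ}
    (hw : ∀ e, 0 ≤ w e ∧ w e ≤ 1) : |f * ∏ e ∈ T, w e| ≤ 1 := by
  have h1 : 0 ≤ ∏ e ∈ T, w e := Finset.prod_nonneg fun e _ => (hw e).1
  have h2 : ∏ e ∈ T, w e ≤ 1 := Finset.prod_le_one (fun e _ => (hw e).1) fun e _ => (hw e).2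
  rw [abs_of_nonneg (mul_nonneg hf.1 h1)]
  exact mul_le_one₀ hf.2 h1 h2

variable {ι : Type*} [Fintype ι] [DecidableEq ι]

/-- Resampling one coordinate independently preserves the product law. This gives Fubini in any
chosen coordinate without splitting the index type. -/
lemma measurePreserving_update (μ : ι → Measure ℝ) [∀ i, IsProbabilityMeasure (μ i)] (a : ι) :
    MeasurePreserving (fun p : ℝ × (ι → ℝ) => update p.2 a p.1) ((μ a).prod (Measure.pi μ))
      (Measure.pi μ) := by
  have hm : Measurable (fun p : ℝ × (ι → ℝ) => update p.2 a p.1) :=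
    measurable_update'.comp measurable_swap
  refine ⟨hm, (Measure.pi_eq fun s hs => ?_).symm⟩
  rw [Measure.map_apply hm (MeasurableSet.univ_pi hs)]
  have e : (fun p : ℝ × (ι → ℝ) => update p.2 a p.1) ⁻¹' (univ.pi s) =
      s a ×ˢ (univ.pi (update s a univ)) := by
    ext ⟨x, z⟩
    simp only [mem_preimage, mem_univ_pi, mem_prod]
    constructor
    · intro h
      refine ⟨by simpa using h a, fun i => ?_⟩
      rcases eq_or_ne i a with rfl | hi
      · simp
      · simpa [hi] using h i
    · rintro ⟨h1, h2⟩ i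
      rcases eq_or_ne i a with rfl | hi
      · simpa using h1
      · simpa [hi] using h2 i
  rw [e, Measure.prod_prod, Measure.pi_pi, ← Finset.mul_prod_erase _ _ (Finset.mem_univ a),
    ← Finset.mul_prod_erase _ (fun i => μ i (s i)) (Finset.mem_univ a)]
  simp only [update_self, measure_univ, one_mul]
  congr 1
  refine Finset.prod_congr rfl fun i hi => ?_
  rw [update_of_ne (Finset.ne_of_mem_erase hi)]

lemma integral_pi_update (μ : ι → Measure ℝ) [∀ i, IsProbabilityMeasure (μ i)] (a : ι)
    {H : (ι → ℝ) → ℝ} (hm : Measurable H) (hb : ∀ z, |H z| ≤ 1) :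
    ∫ z, H z ∂(Measure.pi μ) = ∫ x, ∫ z, H (update z a x) ∂(Measure.pi μ) ∂(μ a) := by
  have hp := measurePreserving_update μ a
  rw [← hp.map_eq, integral_map hp.measurable.aemeasurable hm.aestronglyMeasurable, hp.map_eq,
    integral_prod]
  exact Integrable.of_bound (hm.comp hp.measurable).aestronglyMeasurable 1
    (ae_of_all _ fun p => hb _)

lemma integral_prod_pi (μ : Measure ℝ) [IsProbabilityMeasure μ] (T : Finset ι) (v : ℝ → ℝ) :
    ∫ z, ∏ e ∈ T, v (z e) ∂(Measure.pi fun _ : ι => μ) = (∫ x, v x ∂μ) ^ T.card := by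
  have h := integral_fintype_prod_eq_prod (μ := fun _ : ι => μ) (𝕜 := ℝ)
    (fun i x => if i ∈ T then v x else 1)
  have e1 : ∀ z : ι → ℝ, (∏ i, if i ∈ T then v (z i) else 1) = ∏ e ∈ T, v (z e) := by
    intro z; rw [Finset.prod_ite_mem]; simp
  have e2 : (∏ i : ι, ∫ x, (if i ∈ T then v x else 1) ∂μ) = ∏ i ∈ T, ∫ x, v x ∂μ := by
    rw [← Finset.prod_filter_mul_prod_filter_not Finset.univ (· ∈ T)]
    rw [Finset.prod_congr rfl (g := fun _ => ∫ x, v x ∂μ)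
      (fun i hi => by simp [(Finset.mem_filter.1 hi).2]),
      Finset.prod_congr (s₁ := Finset.univ.filter (· ∉ T)) rfl (g := fun _ => (1 : ℝ))
      (fun i hi => by simp [(Finset.mem_filter.1 hi).2])]
    simp
  simp_rw [e1] at h
  rw [h, e2, Finset.prod_const]

variable (μ : Measure ℝ) [IsProbabilityMeasure μ]

lemma integral_pi_one {F : ℝ → ℝ} {v : ℝ → ℝ → ℝ} (hF : Measurable F)
    (hF1 : ∀ x, 0 ≤ F x ∧ F x ≤ 1) (hv : Measurable fun p : ℝ × ℝ => v p.1 p.2)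
    (hv1 : ∀ x e, 0 ≤ v x e ∧ v x e ≤ 1) (a : ι) :
    ∫ z, F (z a) * ∏ e ∈ {a}ᶜ, v (z a) (z e) ∂(Measure.pi fun _ : ι => μ) =
      ∫ x, F x * (∫ e, v x e ∂μ) ^ (Fintype.card ι - 1) ∂μ := by
  have hp := fun e : ι => measurable_pi_apply (X := fun _ : ι => ℝ) e
  have hH : Measurable fun z : ι → ℝ => F (z a) * ∏ e ∈ {a}ᶜ, v (z a) (z e) :=
    (hF.comp (hp a)).mul (Finset.measurable_fun_prod _ fun e _ =>
      hv.comp ((hp a).prodMk (hp e)))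
  rw [integral_pi_update (fun _ => μ) a hH fun z => abs_mul_prod_le_one (hF1 _) fun e => hv1 _ _]
  congr 1; ext x
  have e : ∀ z : ι → ℝ, F (update z a x a) * ∏ e ∈ {a}ᶜ, v (update z a x a) (update z a x e) =
      F x * ∏ e ∈ {a}ᶜ, v x (z e) := by
    intro z
    rw [update_self]
    congr 1
    refine Finset.prod_congr rfl fun e he => ?_
    rw [update_of_ne (by simpa using he)]
  simp_rw [e]
  rw [integral_const_mul, integral_prod_pi, Finset.card_compl, Finset.card_singleton]

/-- Once three coordinates are fixed, the other `card ι - 3` contribute independent equal factors.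
The order of integration, with `y` innermost, is that of `gapIntegral`. -/
lemma integral_pi_three {F v : ℝ → ℝ → ℝ → ℝ} (hF : Measurable fun p : ℝ × ℝ × ℝ => F p.1 p.2.1 p.2.2)
    (hF1 : ∀ x y w, 0 ≤ F x y w ∧ F x y w ≤ 1)
    (hv : Measurable fun p : ℝ × ℝ × ℝ => v p.1 p.2.1 p.2.2)
    (hv1 : ∀ x y e, 0 ≤ v x y e ∧ v x y e ≤ 1) {a b c : ι} (hab : a ≠ b) (hac : a ≠ c)
    (hbc : b ≠ c) :
    ∫ z, F (z a) (z b) (z c) * ∏ e ∈ {a, b, c}ᶜ, v (z a) (z b) (z e)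
        ∂(Measure.pi fun _ : ι => μ) =
      ∫ x, ∫ w, ∫ y, F x y w * (∫ e, v x y e ∂μ) ^ (Fintype.card ι - 3) ∂μ ∂μ ∂μ := by
  set H : (ι → ℝ) → ℝ := fun z => F (z a) (z b) (z c) * ∏ e ∈ {a, b, c}ᶜ, v (z a) (z b) (z e)
    with hHdef
  have hp := fun e : ι => measurable_pi_apply (X := fun _ : ι => ℝ) e
  have hH : Measurable H :=
    (hF.comp ((hp a).prodMk ((hp b).prodMk (hp c)))).mul (Finset.measurable_fun_prod _ fun e _ =>
      hv.comp ((hp a).prodMk ((hp b).prodMk (hp e))))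
  have hH1 : ∀ z, |H z| ≤ 1 := fun z => abs_mul_prod_le_one (hF1 _ _ _) fun e => hv1 _ _ _
  rw [integral_pi_update (fun _ => μ) a hH hH1]
  congr 1; ext x
  have hu := fun (i : ι) (x : ℝ) => measurable_update_left (a := i) (x := x) (X := fun _ : ι => ℝ)
  have hH2 : Measurable fun z => H (update z a x) := hH.comp (hu a x)
  rw [integral_pi_update (fun _ => μ) c hH2 fun z => hH1 _]
  congr 1; ext w
  have hH3 : Measurable fun z => H (update (update z c w) a x) := hH2.comp (hu c w)
  rw [integral_pi_update (fun _ => μ) b hH3 fun z => hH1 _]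
  congr 1; ext y
  have e : ∀ z : ι → ℝ, H (update (update (update z b y) c w) a x) =
      F x y w * ∏ e ∈ {a, b, c}ᶜ, v x y (z e) := by
    intro z
    simp only [hHdef, update_self, update_of_ne hab.symm, update_of_ne hac.symm,
      update_of_ne hbc]
    congr 1
    refine Finset.prod_congr rfl fun e he => ?_
    simp only [Finset.mem_compl, Finset.mem_insert, Finset.mem_singleton, not_or] at he
    rw [update_of_ne he.1, update_of_ne he.2.2, update_of_ne he.2.1]
  simp_rw [e]
  rw [integral_const_mul, integral_prod_pi, Finset.card_compl]
  congr 2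
  rw [Finset.card_eq_three.2 ⟨a, b, c, hab, hac, hbc, rfl⟩]

lemma integral_pi_four {F v : ℝ → ℝ → ℝ → ℝ} {u : ℝ → ℝ → ℝ → ℝ}
    (hF : Measurable fun p : ℝ × ℝ × ℝ => F p.1 p.2.1 p.2.2)
    (hF1 : ∀ x y w, 0 ≤ F x y w ∧ F x y w ≤ 1)
    (hv : Measurable fun p : ℝ × ℝ × ℝ => v p.1 p.2.1 p.2.2)
    (hv1 : ∀ x y e, 0 ≤ v x y e ∧ v x y e ≤ 1)
    (hu : Measurable fun p : ℝ × ℝ × ℝ => u p.1 p.2.1 p.2.2)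
    (hu1 : ∀ x y e, 0 ≤ u x y e ∧ u x y e ≤ 1) {a b c d : ι} (hab : a ≠ b) (hac : a ≠ c)
    (hbc : b ≠ c) (had : a ≠ d) (hbd : b ≠ d) (hcd : c ≠ d) :
    ∫ z, F (z a) (z b) (z c) * u (z a) (z b) (z d) * ∏ e ∈ {a, b, c, d}ᶜ, v (z a) (z b) (z e)
        ∂(Measure.pi fun _ : ι => μ) =
      ∫ x, ∫ w, ∫ y, F x y w * (∫ d, u x y d ∂μ) * (∫ e, v x y e ∂μ) ^ (Fintype.card ι - 4)
        ∂μ ∂μ ∂μ := by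
  set H : (ι → ℝ) → ℝ := fun z => F (z a) (z b) (z c) * u (z a) (z b) (z d) *
    ∏ e ∈ {a, b, c, d}ᶜ, v (z a) (z b) (z e) with hHdef
  have hp := fun e : ι => measurable_pi_apply (X := fun _ : ι => ℝ) e
  have hH : Measurable H :=
    ((hF.comp ((hp a).prodMk ((hp b).prodMk (hp c)))).mul
      (hu.comp ((hp a).prodMk ((hp b).prodMk (hp d))))).mul
      (Finset.measurable_fun_prod _ fun e _ => hv.comp ((hp a).prodMk ((hp b).prodMk (hp e))))
  have hH1 : ∀ z, |H z| ≤ 1 := fun z => abs_mul_prod_le_one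
    ⟨mul_nonneg (hF1 _ _ _).1 (hu1 _ _ _).1,
      mul_le_one₀ (hF1 _ _ _).2 (hu1 _ _ _).1 (hu1 _ _ _).2⟩ fun e => hv1 _ _ _
  rw [integral_pi_update (fun _ => μ) a hH hH1]
  congr 1; ext x
  have hup := fun (i : ι) (x : ℝ) => measurable_update_left (a := i) (x := x) (X := fun _ : ι => ℝ)
  have hH2 : Measurable fun z => H (update z a x) := hH.comp (hup a x)
  rw [integral_pi_update (fun _ => μ) c hH2 fun z => hH1 _]
  congr 1; ext w
  have hH3 : Measurable fun z => H (update (update z c w) a x) := hH2.comp (hup c w)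
  rw [integral_pi_update (fun _ => μ) b hH3 fun z => hH1 _]
  congr 1; ext y
  have hH4 : Measurable fun z => H (update (update (update z b y) c w) a x) :=
    hH3.comp (hup b y)
  have h := integral_pi_update (fun _ => μ) d hH4 fun z => hH1 _
  have e : ∀ (t : ℝ) (z : ι → ℝ), H (update (update (update (update z d t) b y) c w) a x) =
      F x y w * u x y t * ∏ e ∈ {a, b, c, d}ᶜ, v x y (z e) := by
    intro t z
    simp only [hHdef, update_self, update_of_ne hab.symm, update_of_ne hac.symm,
      update_of_ne hbc, update_of_ne had.symm, update_of_ne hbd.symm, update_of_ne hcd.symm]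
    congr 1
    refine Finset.prod_congr rfl fun e he => ?_
    simp only [Finset.mem_compl, Finset.mem_insert, Finset.mem_singleton, not_or] at he
    rw [update_of_ne he.1, update_of_ne he.2.2.1, update_of_ne he.2.1, update_of_ne he.2.2.2]
  simp_rw [e, integral_const_mul, integral_prod_pi] at h
  refine h.trans ?_
  rw [integral_mul_const, integral_const_mul, Finset.card_compl]
  congr 2
  rw [Finset.card_eq_of_equiv_fin]
  exact (Finset.equivFinOfCardEq (by
    rw [Finset.card_insert_of_notMem (by simp [hab, hac, had]),
      Finset.card_eq_three.2 ⟨b, c, d, hbc, hbd, hcd, rfl⟩]))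

end PiIntegrals

end StQP

namespace StQP

/-! ### Order statistics and sums over tuples of indices. -/

section OrderStatistics

open Real Set Function

variable {n : ℕ}

/-- The `r`-th smallest coordinate of `z`, for `1 ≤ r ≤ n`. -/
noncomputable def ordStat (z : Fin n → ℝ) (r : ℕ) : ℝ :=
  if h : 1 ≤ r ∧ r ≤ n then z (Tuple.sort z ⟨r - 1, by omega⟩) else 0

/-- `P(N(0, 1/2) ≤ x - √((y - x) (w - x)))`. -/
noncomputable def edgeProb (x y w : ℝ) : ℝ := halfCDF (x - √((y - x) * (w - x)))

lemma edgeProb_pos (x y w : ℝ) : 0 < edgeProb x y w := halfCDF_pos _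

lemma edgeProb_le (x y w : ℝ) : edgeProb x y w ≤ halfCDF x :=
  halfCDF_mono (by linarith [sqrt_nonneg ((y - x) * (w - x))])

lemma edgeProb_le_one (x y w : ℝ) : edgeProb x y w ≤ 1 := halfCDF_le_one _

lemma edgeProb_comm (x y w : ℝ) : edgeProb x y w = edgeProb x w y := by
  simp only [edgeProb, mul_comm]

lemma edgeProb_self (x w : ℝ) : edgeProb x x w = halfCDF x := by simp [edgeProb]

/-- On each of the finitely many sets where `Tuple.sort z` is a given permutation, the order
statistic is a coordinate. Ties are broken by the index, which explains the second family of
conditions below. -/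
lemma measurable_ordStat (r : ℕ) : Measurable fun z : Fin n → ℝ => ordStat z r := by
  unfold ordStat
  by_cases h : 1 ≤ r ∧ r ≤ n
  · simp only [h, and_self, ↓reduceDIte]
    have hs : ∀ σ : Equiv.Perm (Fin n), MeasurableSet {z : Fin n → ℝ | Tuple.sort z = σ} := by
      intro σ
      have hp := fun e : Fin n => measurable_pi_apply (X := fun _ : Fin n => ℝ) e
      have e : {z : Fin n → ℝ | Tuple.sort z = σ} =
          (⋂ i, ⋂ j, {z : Fin n → ℝ | i ≤ j → z (σ i) ≤ z (σ j)}) ∩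
          ⋂ i, ⋂ j, {z : Fin n → ℝ | i < j → z (σ i) = z (σ j) → σ i < σ j} := by
        ext z
        simp only [mem_ofPred_eq, mem_inter_iff, mem_iInter]
        rw [eq_comm, Tuple.eq_sort_iff]
        exact Iff.rfl
      rw [e]
      refine (MeasurableSet.iInter fun i => MeasurableSet.iInter fun j => ?_).inter
        (MeasurableSet.iInter fun i => MeasurableSet.iInter fun j => ?_)
      · by_cases hij : i ≤ j
        · simpa [hij] using measurableSet_le (hp (σ i)) (hp (σ j))
        · simp [hij]
      · by_cases hij : i < j
        · by_cases hs : σ i < σ j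
          · simp [hs]
          · simp only [hij, hs, forall_const, imp_false]
            exact (measurableSet_eq_fun (hp (σ i)) (hp (σ j))).compl
        · simp [hij]
    have e : (fun z : Fin n → ℝ => z (Tuple.sort z ⟨r - 1, by omega⟩)) = fun z =>
        ∑ σ : Equiv.Perm (Fin n), ({z : Fin n → ℝ | Tuple.sort z = σ}).indicator
          (fun z => z (σ ⟨r - 1, by omega⟩)) z := by
      ext z
      rw [Finset.sum_eq_single (Tuple.sort z)]
      · simp
      · intro σ _ hσ
        exact indicator_of_notMem (by simpa using hσ.symm) _
      · simp
    rw [e]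
    exact Finset.measurable_fun_sum _ fun σ _ => (measurable_pi_apply _).indicator (hs σ)
  · simp only [h, ↓reduceDIte]
    exact measurable_const

/-- An index at which the `r`-th smallest coordinate is attained. -/
noncomputable def rankIndex (hn : 0 < n) (z : Fin n → ℝ) (r : ℕ) : Fin n :=
  Tuple.sort z ⟨(r - 1) % n, Nat.mod_lt _ hn⟩

variable (hn : 0 < n) (z : Fin n → ℝ)

lemma ordStat_eq {r : ℕ} (h1 : 1 ≤ r) (h2 : r ≤ n) : ordStat z r = z (rankIndex hn z r) := by
  rw [ordStat, dif_pos ⟨h1, h2⟩, rankIndex]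
  congr 3
  rw [Nat.mod_eq_of_lt (by omega)]

lemma rankIndex_inj {r r' : ℕ} (h1 : 1 ≤ r) (h2 : r ≤ n) (h1' : 1 ≤ r') (h2' : r' ≤ n)
    (h : rankIndex hn z r = rankIndex hn z r') : r = r' := by
  have := (Tuple.sort z).injective h
  rw [Fin.mk.injEq, Nat.mod_eq_of_lt (by omega), Nat.mod_eq_of_lt (by omega)] at this
  omega

lemma exists_rankIndex (e : Fin n) : ∃ r, 1 ≤ r ∧ r ≤ n ∧ rankIndex hn z r = e := by
  have hlt := ((Tuple.sort z).symm e).isLt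
  refine ⟨(Tuple.sort z).symm e + 1, by omega, by omega, ?_⟩
  rw [rankIndex]
  have : (⟨(((Tuple.sort z).symm e : ℕ) + 1 - 1) % n, Nat.mod_lt _ hn⟩ : Fin n) =
      (Tuple.sort z).symm e := by
    ext; simp [Nat.mod_eq_of_lt hlt]
  rw [this, Equiv.apply_symm_apply]

lemma rankIndex_mono {r r' : ℕ} (h : r ≤ r') (h2 : r' ≤ n) :
    z (rankIndex hn z r) ≤ z (rankIndex hn z r') := by
  refine Tuple.monotone_sort z ?_
  rw [Fin.mk_le_mk, Nat.mod_eq_of_lt (by omega), Nat.mod_eq_of_lt (by omega)]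
  omega

lemma ordStat_mono {r r' : ℕ} (h1 : 1 ≤ r) (h : r ≤ r') (h2 : r' ≤ n) :
    ordStat z r ≤ ordStat z r' := by
  have hn : 0 < n := by omega
  rw [ordStat_eq hn z h1 (by omega), ordStat_eq hn z (by omega) h2]
  exact rankIndex_mono hn z h h2

lemma ordStat_one_le (e : Fin n) : ordStat z 1 ≤ z e := by
  have hn : 0 < n := e.pos
  obtain ⟨r, h1, h2, rfl⟩ := exists_rankIndex hn z e
  rw [← ordStat_eq hn z h1 h2]
  exact ordStat_mono z le_rfl h1 h2

/-- Used with `s` a set of ranks and `T` the injective index tuples: order statistics are traded for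
exchangeable sums, whose terms all have the same expectation. The next lemma gives the reverse
comparison. -/
lemma sum_le_sum_of_maps {α β : Type*} {s : Finset β} {T : Finset α} {f : β → ℝ} {ψ : α → ℝ}
    (i : β → α) (hi : InjOn i s) (hm : ∀ j ∈ s, i j ∈ T) (hf : ∀ j ∈ s, f j ≤ ψ (i j))
    (h0 : ∀ t ∈ T, 0 ≤ ψ t) : ∑ j ∈ s, f j ≤ ∑ t ∈ T, ψ t := by
  classical
  calc ∑ j ∈ s, f j ≤ ∑ j ∈ s, ψ (i j) := Finset.sum_le_sum hf
    _ = ∑ t ∈ s.image i, ψ t := (Finset.sum_image hi).symm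
    _ ≤ ∑ t ∈ T, ψ t := Finset.sum_le_sum_of_subset_of_nonneg
        (Finset.image_subset_iff.2 hm) fun t ht _ => h0 t ht

lemma sum_le_sum_of_covers {α β : Type*} {s : Finset β} {T : Finset α} {f : β → ℝ} {ψ : α → ℝ}
    (i : β → α) (hi : InjOn i s) (hc : ∀ t ∈ T, ψ t ≠ 0 → ∃ j ∈ s, i j = t)
    (hf : ∀ j ∈ s, ψ (i j) ≤ f j) (h0 : ∀ t, 0 ≤ ψ t) : ∑ t ∈ T, ψ t ≤ ∑ j ∈ s, f j := by
  classical
  calc ∑ t ∈ T, ψ t = ∑ t ∈ T with ψ t ≠ 0, ψ t := (Finset.sum_filter_ne_zero T).symm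
    _ ≤ ∑ t ∈ s.image i, ψ t := Finset.sum_le_sum_of_subset_of_nonneg (fun t ht => by
        rw [Finset.mem_filter] at ht
        obtain ⟨j, hj, rfl⟩ := hc t ht.1 ht.2
        exact Finset.mem_image_of_mem i hj) fun t _ _ => h0 t
    _ = ∑ j ∈ s, ψ (i j) := Finset.sum_image hi
    _ ≤ ∑ j ∈ s, f j := Finset.sum_le_sum hf

/-- The injective `k`-tuples of indices. -/
def injTuples (k n : ℕ) : Finset (Fin k → Fin n) := Finset.univ.filter Injective

lemma card_injTuples (k n : ℕ) : (injTuples k n).card = n.descFactorial k := by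
  rw [injTuples, ← Fintype.card_subtype,
    Fintype.card_congr (Equiv.subtypeInjectiveEquivEmbedding (Fin k) (Fin n)),
    Fintype.card_embedding_eq, Fintype.card_fin, Fintype.card_fin]

/-- Indicator of `x ≤ e`. -/
noncomputable def leInd (x e : ℝ) : ℝ := if x ≤ e then 1 else 0

/-- Indicator of `x < e`. -/
noncomputable def ltInd (x e : ℝ) : ℝ := if x < e then 1 else 0

lemma leInd_mem (x e : ℝ) : 0 ≤ leInd x e ∧ leInd x e ≤ 1 := by
  unfold leInd; split_ifs <;> norm_num

lemma ltInd_mem (x e : ℝ) : 0 ≤ ltInd x e ∧ ltInd x e ≤ 1 := by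
  unfold ltInd; split_ifs <;> norm_num

lemma prod_leInd_eq_one {T : Finset (Fin n)} {x : ℝ} (h : ∀ e ∈ T, x ≤ z e) :
    ∏ e ∈ T, leInd x (z e) = 1 :=
  Finset.prod_eq_one fun e he => if_pos (h e he)

lemma lt_of_prod_ltInd_ne_zero {z : Fin n → ℝ} {T : Finset (Fin n)} {x : ℝ}
    (h : ∏ e ∈ T, ltInd x (z e) ≠ 0) : ∀ e ∈ T, x < z e := by
  intro e he
  have := Finset.prod_ne_zero_iff.1 h e he
  simpa [ltInd] using this

lemma prod_mem {κ : Type*} {T : Finset κ} {w : κ → ℝ} (hw : ∀ e, 0 ≤ w e ∧ w e ≤ 1) :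
    0 ≤ ∏ e ∈ T, w e ∧ ∏ e ∈ T, w e ≤ 1 :=
  ⟨Finset.prod_nonneg fun e _ => (hw e).1, Finset.prod_le_one (fun e _ => (hw e).1) fun e _ => (hw e).2⟩

lemma eq_rankIndex_one {a : Fin n} (h : ∀ e, e ≠ a → z a < z e) : a = rankIndex hn z 1 := by
  by_contra hne
  have h1 := h _ (Ne.symm hne)
  rw [← ordStat_eq hn z le_rfl hn] at h1
  exact absurd (ordStat_one_le z a) (not_le.2 h1)

lemma eq_rankIndex_two {a b : Fin n} (hab : a ≠ b) (hz : z a < z b)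
    (h : ∀ e, e ≠ a → e ≠ b → z b < z e) : a = rankIndex hn z 1 ∧ b = rankIndex hn z 2 := by
  have ha : a = rankIndex hn z 1 := eq_rankIndex_one hn z fun e he => by
    rcases eq_or_ne e b with rfl | hb
    · exact hz
    · exact hz.trans (h e he hb)
  refine ⟨ha, ?_⟩
  obtain ⟨r, h1, h2, rfl⟩ := exists_rankIndex hn z b
  have hr : r ≠ 1 := by rintro rfl; exact hab ha
  by_contra hne
  have := h (rankIndex hn z 2) (by
    intro h'; rw [ha] at h'
    have := rankIndex_inj hn z (by omega) (by omega) (by omega) (by omega) h'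
    omega) (Ne.symm hne)
  exact absurd (rankIndex_mono hn z (show 2 ≤ r by omega) h2) (not_le.2 this)

lemma eq_rankIndex_three {a b d : Fin n} (hab : a ≠ b) (had : a ≠ d) (hbd : b ≠ d)
    (hz : z a < z d) (hz' : z d < z b)
    (h : ∀ e, e ≠ a → e ≠ b → e ≠ d → z b < z e) :
    a = rankIndex hn z 1 ∧ d = rankIndex hn z 2 ∧ b = rankIndex hn z 3 := by
  obtain ⟨ha, hd⟩ := eq_rankIndex_two hn z had hz fun e he1 he2 => by
    rcases eq_or_ne e b with rfl | hb
    · exact hz'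
    · exact hz'.trans (h e he1 hb he2)
  refine ⟨ha, hd, ?_⟩
  obtain ⟨r, h1, h2, rfl⟩ := exists_rankIndex hn z b
  have hr : r ≠ 1 := by rintro rfl; exact hab ha
  have hr2 : r ≠ 2 := by rintro rfl; exact hbd hd.symm
  by_contra hne
  have := h (rankIndex hn z 3) (by
    intro h'; rw [ha] at h'
    have := rankIndex_inj hn z (by omega) (by omega) (by omega) (by omega) h'
    omega) (Ne.symm hne) (by
    intro h'; rw [hd] at h'
    have := rankIndex_inj hn z (by omega) (by omega) (by omega) (by omega) h'
    omega)
  exact absurd (rankIndex_mono hn z (show 3 ≤ r by omega) h2) (not_le.2 this)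

/-- Upper bounds use weak inequalities between coordinates and lower bounds strict ones. Both hold
for every `z`, and their expectations agree since the Gaussian law has no atoms, so ties need no
separate treatment. -/
lemma halfCDF_ordStat_le_sum (hn : 0 < n) : halfCDF (ordStat z 1) ≤
    ∑ a : Fin n, halfCDF (z a) * ∏ e ∈ {a}ᶜ, leInd (z a) (z e) := by
  have h : halfCDF (ordStat z 1) ≤ halfCDF (z (rankIndex hn z 1)) *
      ∏ e ∈ {rankIndex hn z 1}ᶜ, leInd (z (rankIndex hn z 1)) (z e) := by
    rw [← ordStat_eq hn z le_rfl hn, prod_leInd_eq_one z fun e _ => ordStat_one_le z e, mul_one]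
  exact h.trans (Finset.single_le_sum (f := fun a => halfCDF (z a) *
    ∏ e ∈ {a}ᶜ, leInd (z a) (z e)) (fun a _ => mul_nonneg (halfCDF_pos _).le
      (prod_mem fun e => leInd_mem _ _).1) (Finset.mem_univ _))

lemma sum_le_halfCDF_ordStat (hn : 0 < n) :
    ∑ a : Fin n, halfCDF (z a) * ∏ e ∈ {a}ᶜ, ltInd (z a) (z e) ≤ halfCDF (ordStat z 1) := by
  rw [Finset.sum_eq_single (rankIndex hn z 1)]
  · rw [ordStat_eq hn z le_rfl hn]
    exact mul_le_of_le_one_right (halfCDF_pos _).le (prod_mem fun e => ltInd_mem _ _).2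
  · intro a _ ha
    by_contra hne
    have h := lt_of_prod_ltInd_ne_zero (right_ne_zero_of_mul hne)
    exact ha (eq_rankIndex_one hn z fun e he => h e (by simpa using he))
  · simp

lemma gapKernel_zero_full {x y w : ℝ} (h1 : x ≤ y) (h2 : y ≤ w) :
    gapKernel 0 fullWeight x y w = edgeProb x y w := by
  simp [gapKernel, fullWeight, h1, h2, edgeProb]

lemma gapKernel_zero_cut_le (x y w : ℝ) : gapKernel 0 cutWeight x y w ≤ edgeProb x y w := by
  rw [gapKernel, pow_zero, mul_one]
  exact mul_le_of_le_one_left (halfCDF_pos _).le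
    ((isGapWeight_cutWeight (m := 0) (by norm_num)).le_one _ _ _)

lemma lt_of_gapKernel_zero_cut_ne_zero {x y w : ℝ} (h : gapKernel 0 cutWeight x y w ≠ 0) :
    x < y ∧ y < w := by
  have h1 : cutWeight x y w ≠ 0 := left_ne_zero_of_mul (left_ne_zero_of_mul h)
  simp only [cutWeight, ne_eq, ite_eq_right_iff, one_ne_zero, imp_false, not_not] at h1
  exact ⟨h1.1, h1.2.1⟩

lemma injective_rankIndex_three {i j k : ℕ} (hi : 1 ≤ i) (hij : i < j) (hjk : j < k)
    (hk : k ≤ n) : Injective ![rankIndex hn z i, rankIndex hn z j, rankIndex hn z k] := by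
  have h1 : rankIndex hn z i ≠ rankIndex hn z j := fun h => by
    have := rankIndex_inj hn z (by omega) (by omega) (by omega) (by omega) h; omega
  have h2 : rankIndex hn z i ≠ rankIndex hn z k := fun h => by
    have := rankIndex_inj hn z (by omega) (by omega) (by omega) (by omega) h; omega
  have h3 : rankIndex hn z j ≠ rankIndex hn z k := fun h => by
    have := rankIndex_inj hn z (by omega) (by omega) (by omega) (by omega) h; omega
  intro a b hab
  fin_cases a <;> fin_cases b <;> simp_all

/-- The remaining coordinates are only required to exceed the minimum, not the second smallest
value. This relaxation costs nothing to leading order because the relevant gap is tiny, and it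
yields the power of `1 - Φ(x)` alone. -/
lemma sum_pair_two_le (hn : 0 < n) :
    ∑ j ∈ Finset.Icc 3 n, edgeProb (ordStat z 1) (ordStat z 2) (ordStat z j) ≤
    ∑ t ∈ injTuples 3 n, gapKernel 0 fullWeight (z (t 0)) (z (t 1)) (z (t 2)) *
      ∏ e ∈ {t 0, t 1, t 2}ᶜ, leInd (z (t 0)) (z e) := by
  refine sum_le_sum_of_maps (fun j => ![rankIndex hn z 1, rankIndex hn z 2, rankIndex hn z j])
    ?_ ?_ ?_ ?_
  · intro j hj k hk hjk
    simp only [Finset.coe_Icc, mem_Icc] at hj hk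
    have := congrFun hjk 2
    exact rankIndex_inj hn z (by omega) (by omega) (by omega) (by omega) this
  · intro j hj
    rw [Finset.mem_Icc] at hj
    exact Finset.mem_filter.2 ⟨Finset.mem_univ _,
      injective_rankIndex_three hn z le_rfl (by norm_num) (by omega) hj.2⟩
  · intro j hj
    rw [Finset.mem_Icc] at hj
    simp only [Matrix.cons_val]
    rw [← ordStat_eq hn z le_rfl hn, ← ordStat_eq hn z (by norm_num) (by omega),
      ← ordStat_eq hn z (by omega) hj.2, prod_leInd_eq_one z fun e _ => ordStat_one_le z e, mul_one,
      gapKernel_zero_full (ordStat_mono z le_rfl (by norm_num) (by omega))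
        (ordStat_mono z (by norm_num) (by omega) hj.2)]
  · intro t _
    exact mul_nonneg (gapKernel_mem (isGapWeight_fullWeight (by norm_num)) _ _ _).1
      (prod_mem fun e => leInd_mem _ _).1

/-- A nonzero summand forces `t 0` and `t 1` to have ranks one and two, so each term on the right is
hit at most once. -/
lemma le_sum_pair_two (hn : 0 < n) :
    ∑ t ∈ injTuples 3 n, gapKernel 0 cutWeight (z (t 0)) (z (t 1)) (z (t 2)) *
      ∏ e ∈ {t 0, t 1, t 2}ᶜ, ltInd (z (t 1)) (z e) ≤
    ∑ j ∈ Finset.Icc 3 n, edgeProb (ordStat z 1) (ordStat z 2) (ordStat z j) := by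
  refine sum_le_sum_of_covers (fun j => ![rankIndex hn z 1, rankIndex hn z 2, rankIndex hn z j])
    ?_ ?_ ?_ ?_
  · intro j hj k hk hjk
    simp only [Finset.coe_Icc, mem_Icc] at hj hk
    have := congrFun hjk 2
    exact rankIndex_inj hn z (by omega) (by omega) (by omega) (by omega) this
  · intro t ht hne
    have hinj : Injective t := (Finset.mem_filter.1 ht).2
    obtain ⟨h1, h2⟩ := lt_of_gapKernel_zero_cut_ne_zero (left_ne_zero_of_mul hne)
    have h3 := lt_of_prod_ltInd_ne_zero (right_ne_zero_of_mul hne)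
    obtain ⟨ha, hb⟩ := eq_rankIndex_two hn z (hinj.ne (by decide : (0 : Fin 3) ≠ 1)) h1
      fun e he1 he2 => by
        rcases eq_or_ne e (t 2) with rfl | hc
        · exact h2
        · exact h3 e (by simp [he1, he2, hc])
    obtain ⟨r, hr1, hr2, hr⟩ := exists_rankIndex hn z (t 2)
    have hne1 : r ≠ 1 := by
      rintro rfl
      exact hinj.ne (by decide : (0 : Fin 3) ≠ 2) (ha.trans hr)
    have hne2 : r ≠ 2 := by
      rintro rfl
      exact hinj.ne (by decide : (1 : Fin 3) ≠ 2) (hb.trans hr)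
    refine ⟨r, Finset.mem_Icc.2 ⟨by omega, hr2⟩, ?_⟩
    ext i
    fin_cases i <;> simp [ha, hb, hr]
  · intro j hj
    rw [Finset.mem_Icc] at hj
    simp only [Matrix.cons_val]
    rw [← ordStat_eq hn z le_rfl hn, ← ordStat_eq hn z (by norm_num) (by omega),
      ← ordStat_eq hn z (by omega) hj.2]
    exact (mul_le_of_le_one_right
      (gapKernel_mem (isGapWeight_cutWeight (by norm_num)) _ _ _).1
      (prod_mem fun e => ltInd_mem _ _).2).trans (gapKernel_zero_cut_le _ _ _)
  · intro t
    exact mul_nonneg (gapKernel_mem (isGapWeight_cutWeight (by norm_num)) _ _ _).1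
      (prod_mem fun e => ltInd_mem _ _).1

lemma injective_rankIndex_four {i j k l : ℕ} (hi : 1 ≤ i ∧ i ≤ n) (hj : 1 ≤ j ∧ j ≤ n)
    (hk : 1 ≤ k ∧ k ≤ n) (hl : 1 ≤ l ∧ l ≤ n) (hij : i ≠ j) (hik : i ≠ k) (hil : i ≠ l)
    (hjk : j ≠ k) (hjl : j ≠ l) (hkl : k ≠ l) : Injective
    ![rankIndex hn z i, rankIndex hn z j, rankIndex hn z k, rankIndex hn z l] := by
  have key : ∀ {i j : ℕ}, 1 ≤ i ∧ i ≤ n → 1 ≤ j ∧ j ≤ n → i ≠ j →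
      rankIndex hn z i ≠ rankIndex hn z j := fun hi hj hij h =>
    hij (rankIndex_inj hn z hi.1 hi.2 hj.1 hj.2 h)
  have h1 := key hi hj hij
  have h2 := key hi hk hik
  have h3 := key hi hl hil
  have h4 := key hj hk hjk
  have h5 := key hj hl hjl
  have h6 := key hk hl hkl
  have h1' := h1.symm
  have h2' := h2.symm
  have h3' := h3.symm
  have h4' := h4.symm
  have h5' := h5.symm
  have h6' := h6.symm
  clear key
  intro a b hab
  fin_cases a <;> fin_cases b <;> simp_all

/-- The indicator that `d` lies between `x` and `y`. -/
noncomputable def betweenInd (x y d : ℝ) : ℝ := if x ≤ d ∧ d ≤ y then 1 else 0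

/-- The indicator that `d` lies strictly between `x` and `y`. -/
noncomputable def strictBetweenInd (x y d : ℝ) : ℝ := if x < d ∧ d < y then 1 else 0

lemma betweenInd_mem (x y d : ℝ) : 0 ≤ betweenInd x y d ∧ betweenInd x y d ≤ 1 := by
  unfold betweenInd; split_ifs <;> norm_num

lemma strictBetweenInd_mem (x y d : ℝ) :
    0 ≤ strictBetweenInd x y d ∧ strictBetweenInd x y d ≤ 1 := by
  unfold strictBetweenInd; split_ifs <;> norm_num

/-- For `i ≥ 3` the second smallest coordinate lies between the first and the `i`-th. Recording it
as `t 3` produces the extra factor `Φ(y) - Φ(x)` that makes `B_n` smaller than `A_n`. -/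
lemma sum_pair_ge_three_le (hn : 0 < n) :
    ∑ i ∈ Finset.Icc 3 n, ∑ j ∈ Finset.Ioc i n,
      edgeProb (ordStat z 1) (ordStat z i) (ordStat z j) ≤
    ∑ t ∈ injTuples 4 n, gapKernel 0 fullWeight (z (t 0)) (z (t 1)) (z (t 2)) *
      betweenInd (z (t 0)) (z (t 1)) (z (t 3)) *
      ∏ e ∈ {t 0, t 1, t 2, t 3}ᶜ, leInd (z (t 0)) (z e) := by
  rw [Finset.sum_sigma']
  refine sum_le_sum_of_maps (fun p => ![rankIndex hn z 1, rankIndex hn z p.1, rankIndex hn z p.2,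
    rankIndex hn z 2]) ?_ ?_ ?_ ?_
  · rintro ⟨i, j⟩ hp ⟨i', j'⟩ hp' h
    simp only [Finset.coe_sigma, Finset.coe_Icc, Finset.coe_Ioc, mem_sigma_iff, mem_Icc,
      mem_Ioc] at hp hp'
    have h1 : i = i' :=
      rankIndex_inj hn z (by omega) (by omega) (by omega) (by omega) (congrFun h 1)
    have h2 : j = j' :=
      rankIndex_inj hn z (by omega) (by omega) (by omega) (by omega) (congrFun h 2)
    subst h1 h2
    rfl
  · rintro ⟨i, j⟩ hp
    simp only [Finset.mem_sigma, Finset.mem_Icc, Finset.mem_Ioc] at hp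
    exact Finset.mem_filter.2 ⟨Finset.mem_univ _, injective_rankIndex_four hn z (i := 1) (j := i)
      (k := j) (l := 2) (by omega) (by omega) (by omega) (by omega) (by omega) (by omega) (by omega) (by omega) (by omega)
      (by omega)⟩
  · rintro ⟨i, j⟩ hp
    simp only [Finset.mem_sigma, Finset.mem_Icc, Finset.mem_Ioc] at hp
    simp only [Matrix.cons_val]
    rw [← ordStat_eq hn z le_rfl hn, ← ordStat_eq hn z (r := i) (by omega) (by omega),
      ← ordStat_eq hn z (r := j) (by omega) (by omega),
      ← ordStat_eq hn z (r := 2) (by omega) (by omega),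
      prod_leInd_eq_one z fun e _ => ordStat_one_le z e, mul_one,
      gapKernel_zero_full (ordStat_mono z le_rfl (by omega) (by omega))
        (ordStat_mono z (by omega) (by omega) (by omega)), betweenInd,
      if_pos ⟨ordStat_mono z (by omega) (by omega) (by omega),
        ordStat_mono z (by omega) (by omega) (by omega)⟩, mul_one]
  · intro t _
    exact mul_nonneg (mul_nonneg (gapKernel_mem (isGapWeight_fullWeight (by norm_num)) _ _ _).1
      (betweenInd_mem _ _ _).1) (prod_mem fun e => leInd_mem _ _).1

/-- Only the row of the third order statistic is kept. It already carries the leading order of the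
double sum. -/
lemma le_sum_pair_three (hn : 0 < n) :
    ∑ t ∈ injTuples 4 n, gapKernel 0 cutWeight (z (t 0)) (z (t 1)) (z (t 2)) *
      strictBetweenInd (z (t 0)) (z (t 1)) (z (t 3)) *
      ∏ e ∈ {t 0, t 1, t 2, t 3}ᶜ, ltInd (z (t 1)) (z e) ≤
    ∑ j ∈ Finset.Ioc 3 n, edgeProb (ordStat z 1) (ordStat z 3) (ordStat z j) := by
  refine sum_le_sum_of_covers (fun j => ![rankIndex hn z 1, rankIndex hn z 3, rankIndex hn z j,
    rankIndex hn z 2]) ?_ ?_ ?_ ?_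
  · intro j hj k hk hjk
    simp only [Finset.coe_Ioc, mem_Ioc] at hj hk
    exact rankIndex_inj hn z (by omega) (by omega) (by omega) (by omega) (congrFun hjk 2)
  · intro t ht hne
    have hinj : Injective t := (Finset.mem_filter.1 ht).2
    obtain ⟨h1, h2⟩ := lt_of_gapKernel_zero_cut_ne_zero
      (left_ne_zero_of_mul (left_ne_zero_of_mul hne))
    have h3 := lt_of_prod_ltInd_ne_zero (right_ne_zero_of_mul hne)
    have h4 := right_ne_zero_of_mul (left_ne_zero_of_mul hne)
    simp only [strictBetweenInd, ne_eq, ite_eq_right_iff, one_ne_zero, imp_false, not_not] at h4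
    obtain ⟨ha, hd, hb⟩ := eq_rankIndex_three hn z (hinj.ne (by decide : (0 : Fin 4) ≠ 1))
      (hinj.ne (by decide : (0 : Fin 4) ≠ 3)) (hinj.ne (by decide : (1 : Fin 4) ≠ 3)) h4.1 h4.2
      fun e he1 he2 he3 => by
        rcases eq_or_ne e (t 2) with rfl | hc
        · exact h2
        · exact h3 e (by simp [he1, he2, he3, hc])
    obtain ⟨r, hr1, hr2, hr⟩ := exists_rankIndex hn z (t 2)
    have hne1 : r ≠ 1 := by
      rintro rfl
      exact hinj.ne (by decide : (0 : Fin 4) ≠ 2) (ha.trans hr)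
    have hne2 : r ≠ 3 := by
      rintro rfl
      exact hinj.ne (by decide : (1 : Fin 4) ≠ 2) (hb.trans hr)
    have hne3 : r ≠ 2 := by
      rintro rfl
      exact hinj.ne (by decide : (3 : Fin 4) ≠ 2) (hd.trans hr)
    refine ⟨r, Finset.mem_Ioc.2 ⟨by omega, hr2⟩, ?_⟩
    ext i
    fin_cases i <;> simp [ha, hb, hr, hd]
  · intro j hj
    rw [Finset.mem_Ioc] at hj
    simp only [Matrix.cons_val]
    rw [← ordStat_eq hn z (r := 1) le_rfl hn, ← ordStat_eq hn z (r := 3) (by norm_num) (by omega),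
      ← ordStat_eq hn z (r := j) (by omega) hj.2]
    have h0 := (gapKernel_mem (m := 0) (isGapWeight_cutWeight (by norm_num)) (ordStat z 1)
      (ordStat z 3) (ordStat z j)).1
    exact (mul_le_of_le_one_right (mul_nonneg h0 (strictBetweenInd_mem _ _ _).1)
      (prod_mem fun e => ltInd_mem _ _).2).trans ((mul_le_of_le_one_right h0
        (strictBetweenInd_mem _ _ _).2).trans (gapKernel_zero_cut_le _ _ _))
  · intro t
    exact mul_nonneg (mul_nonneg (gapKernel_mem (isGapWeight_cutWeight (by norm_num)) _ _ _).1
      (strictBetweenInd_mem _ _ _).1) (prod_mem fun e => ltInd_mem _ _).1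

end OrderStatistics

end StQP

namespace StQP

/-! ### Replacing products by sums, and measurability. -/

section Expectations

open Real Set Function

/-- The law of `n` independent standard normal variables. -/
noncomputable def normalPi (n : ℕ) : Measure (Fin n → ℝ) := Measure.pi fun _ => gaussianReal 0 1

instance (n : ℕ) : IsProbabilityMeasure (normalPi n) := by unfold normalPi; infer_instance

lemma one_sub_prod_le_sum {κ : Type*} (s : Finset κ) {p : κ → ℝ} (h : ∀ j, 0 ≤ p j ∧ p j ≤ 1) :
    1 - ∏ j ∈ s, (1 - p j) ≤ ∑ j ∈ s, p j := by
  classical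
  induction s using Finset.induction_on with
  | empty => simp
  | insert a s ha ih =>
    rw [Finset.prod_insert ha, Finset.sum_insert ha]
    have := prod_mem (T := s) (w := fun j => 1 - p j)
      fun j => ⟨by linarith [(h j).2], by linarith [(h j).1]⟩
    nlinarith [h a]

/-- A Bonferroni-type bound. Every nonlinear correction becomes the square of a sum, which is then
dominated by `(n * halfCDF (ordStat z 1)) ^ 2`. -/
lemma sum_sub_sq_le_one_sub_prod {κ : Type*} (s : Finset κ) {p : κ → ℝ}
    (h : ∀ j, 0 ≤ p j ∧ p j ≤ 1) :
    ∑ j ∈ s, p j - (∑ j ∈ s, p j) ^ 2 ≤ 1 - ∏ j ∈ s, (1 - p j) := by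
  classical
  induction s using Finset.induction_on with
  | empty => simp
  | insert a s ha ih =>
    rw [Finset.prod_insert ha, Finset.sum_insert ha]
    have h0 : 0 ≤ ∑ j ∈ s, p j := Finset.sum_nonneg fun j _ => (h j).1
    obtain ⟨h1, h2⟩ := h a
    set Y := ∑ j ∈ s, p j
    have h3 : (1 - p a) * ∏ j ∈ s, (1 - p j) ≤ (1 - p a) * (1 - (Y - Y ^ 2)) :=
      mul_le_mul_of_nonneg_left (by linarith) (by linarith)
    nlinarith [mul_nonneg h1 h0, mul_nonneg h1 (sq_nonneg Y), sq_nonneg (p a)]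

lemma pow_sub_pow_le {a b : ℝ} (hb : 0 ≤ b) (hab : b ≤ a) (N : ℕ) :
    a ^ N - b ^ N ≤ N * (a - b) * a ^ (N - 1) := by
  induction N with
  | zero => simp
  | succ N ih =>
    rcases Nat.eq_zero_or_pos N with rfl | hN
    · simp
    have e : a ^ N = a * a ^ (N - 1) := by rw [← pow_succ']; congr 1; omega
    have h1 : b * (a ^ N - b ^ N) ≤ a * (N * (a - b) * a ^ (N - 1)) := by
      have h2 : 0 ≤ a ^ N - b ^ N := sub_nonneg.2 (pow_le_pow_left₀ hb hab N)
      calc b * (a ^ N - b ^ N) ≤ a * (a ^ N - b ^ N) := by gcongr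
        _ ≤ _ := by gcongr; linarith
    have e2 : a ^ (N + 1) - b ^ (N + 1) = a ^ N * (a - b) + b * (a ^ N - b ^ N) := by ring
    rw [e2, Nat.add_sub_cancel]
    push_cast
    calc _ ≤ a ^ N * (a - b) + a * (N * (a - b) * a ^ (N - 1)) := by linarith
      _ = a ^ N * (a - b) + N * (a - b) * (a * a ^ (N - 1)) := by ring
      _ = _ := by rw [← e]; ring

section Pointwise

variable {n : ℕ} (z : Fin n → ℝ)

/-- The integrand of `termS` as a function of the diagonal. -/
noncomputable def valS : ℝ := 1 - (1 - halfCDF (ordStat z 1)) ^ (n - 1)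

/-- The integrand of `termA` as a function of the diagonal. -/
noncomputable def valA : ℝ := (1 - halfCDF (ordStat z 1)) ^ (n - 1) *
  (1 - ∏ j ∈ Finset.Icc 3 n, (1 - edgeProb (ordStat z 1) (ordStat z 2) (ordStat z j)))

/-- The integrand of `termB` as a function of the diagonal. -/
noncomputable def valB : ℝ := (1 - halfCDF (ordStat z 1)) ^ (n - 1) *
  (∏ j ∈ Finset.Icc 3 n, (1 - edgeProb (ordStat z 1) (ordStat z 2) (ordStat z j))) *
  (1 - ∏ i ∈ Finset.Icc 3 n, ∏ j ∈ Finset.Ioc i n,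
    (1 - edgeProb (ordStat z 1) (ordStat z i) (ordStat z j)))

lemma one_sub_mem {p : ℝ} (h : 0 ≤ p ∧ p ≤ 1) : 0 ≤ 1 - p ∧ 1 - p ≤ 1 :=
  ⟨by linarith [h.2], by linarith [h.1]⟩

lemma edgeProb_mem (x y w : ℝ) : 0 ≤ edgeProb x y w ∧ edgeProb x y w ≤ 1 :=
  ⟨(edgeProb_pos _ _ _).le, edgeProb_le_one _ _ _⟩

lemma halfCDF_mem (x : ℝ) : 0 ≤ halfCDF x ∧ halfCDF x ≤ 1 := ⟨(halfCDF_pos x).le, halfCDF_le_one x⟩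

lemma pow_mem {p : ℝ} (h : 0 ≤ p ∧ p ≤ 1) (N : ℕ) : 0 ≤ p ^ N ∧ p ^ N ≤ 1 :=
  ⟨pow_nonneg h.1 N, pow_le_one₀ h.1 h.2⟩

lemma mul_mem_unit {p q : ℝ} (h : 0 ≤ p ∧ p ≤ 1) (h' : 0 ≤ q ∧ q ≤ 1) : 0 ≤ p * q ∧ p * q ≤ 1 :=
  ⟨mul_nonneg h.1 h'.1, mul_le_one₀ h.2 h'.1 h'.2⟩

lemma valS_mem : 0 ≤ valS z ∧ valS z ≤ 1 := one_sub_mem (pow_mem (one_sub_mem (halfCDF_mem _)) _)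

lemma valA_mem : 0 ≤ valA z ∧ valA z ≤ 1 :=
  mul_mem_unit (pow_mem (one_sub_mem (halfCDF_mem _)) _)
    (one_sub_mem (prod_mem fun _ => one_sub_mem (edgeProb_mem _ _ _)))

lemma valB_mem : 0 ≤ valB z ∧ valB z ≤ 1 :=
  mul_mem_unit (mul_mem_unit (pow_mem (one_sub_mem (halfCDF_mem _)) _)
    (prod_mem fun _ => one_sub_mem (edgeProb_mem _ _ _)))
    (one_sub_mem (prod_mem fun _ => prod_mem fun _ => one_sub_mem (edgeProb_mem _ _ _)))

lemma one_sub_pow_bounds {q : ℝ} (h : 0 ≤ q ∧ q ≤ 1) (N : ℕ) :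
    N * q - (N * q) ^ 2 ≤ 1 - (1 - q) ^ N ∧ 1 - (1 - q) ^ N ≤ N * q := by
  have h1 := one_sub_prod_le_sum (Finset.range N) (p := fun _ => q) fun _ => h
  have h2 := sum_sub_sq_le_one_sub_prod (Finset.range N) (p := fun _ => q) fun _ => h
  simp only [Finset.prod_const, Finset.card_range, Finset.sum_const, nsmul_eq_mul] at h1 h2
  exact ⟨h2, h1⟩

lemma natCast_sub_one_mul_le {q : ℝ} (hq : 0 ≤ q) : ((n - 1 : ℕ) : ℝ) * q ≤ n * q := by
  gcongr; exact Nat.sub_le n 1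

lemma valS_le : valS z ≤ n * halfCDF (ordStat z 1) :=
  (one_sub_pow_bounds (halfCDF_mem _) _).2.trans (natCast_sub_one_mul_le (halfCDF_pos _).le)

lemma le_valS : ((n - 1 : ℕ) : ℝ) * halfCDF (ordStat z 1) - (n * halfCDF (ordStat z 1)) ^ 2 ≤
    valS z := by
  have h := (one_sub_pow_bounds (halfCDF_mem (ordStat z 1)) (n - 1)).1
  have h1 := natCast_sub_one_mul_le (n := n) (halfCDF_pos (ordStat z 1)).le
  have h2 : (((n - 1 : ℕ) : ℝ) * halfCDF (ordStat z 1)) ^ 2 ≤ (n * halfCDF (ordStat z 1)) ^ 2 := by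
    have := (halfCDF_pos (ordStat z 1)).le
    gcongr
  unfold valS
  linarith

lemma sum_edgeProb_le {s : Finset ℕ} (hs : s.card ≤ n) (i : ℕ) :
    ∑ j ∈ s, edgeProb (ordStat z 1) (ordStat z i) (ordStat z j) ≤ n * halfCDF (ordStat z 1) := by
  calc _ ≤ ∑ _j ∈ s, halfCDF (ordStat z 1) := Finset.sum_le_sum fun j _ => edgeProb_le _ _ _
    _ = s.card * halfCDF (ordStat z 1) := by simp
    _ ≤ _ := by
      have := (halfCDF_pos (ordStat z 1)).le
      gcongr

lemma valA_le : valA z ≤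
    ∑ j ∈ Finset.Icc 3 n, edgeProb (ordStat z 1) (ordStat z 2) (ordStat z j) := by
  refine (mul_le_of_le_one_left ?_ (pow_mem (one_sub_mem (halfCDF_mem _)) _).2).trans
    (one_sub_prod_le_sum _ fun j => edgeProb_mem _ _ _)
  exact (one_sub_mem (prod_mem fun _ => one_sub_mem (edgeProb_mem _ _ _))).1

lemma le_valA : ∑ j ∈ Finset.Icc 3 n, edgeProb (ordStat z 1) (ordStat z 2) (ordStat z j) -
    2 * (n * halfCDF (ordStat z 1)) ^ 2 ≤ valA z := by
  set Y := ∑ j ∈ Finset.Icc 3 n, edgeProb (ordStat z 1) (ordStat z 2) (ordStat z j) with hY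
  set q := n * halfCDF (ordStat z 1) with hq
  have hYq : Y ≤ q := sum_edgeProb_le z (by simp) 2
  have hY0 : 0 ≤ Y := Finset.sum_nonneg fun j _ => (edgeProb_pos _ _ _).le
  have h1 := one_sub_prod_le_sum (Finset.Icc 3 n)
    fun j => edgeProb_mem (ordStat z 1) (ordStat z 2) (ordStat z j)
  have h2 := sum_sub_sq_le_one_sub_prod (Finset.Icc 3 n)
    fun j => edgeProb_mem (ordStat z 1) (ordStat z 2) (ordStat z j)
  have h3 : 1 - q ≤ (1 - halfCDF (ordStat z 1)) ^ (n - 1) := by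
    have := (valS_le z); unfold valS at this; linarith
  unfold valA
  have h4 := (one_sub_mem (prod_mem (T := Finset.Icc 3 n) fun j =>
    one_sub_mem (edgeProb_mem (ordStat z 1) (ordStat z 2) (ordStat z j)))).1
  set V := 1 - ∏ j ∈ Finset.Icc 3 n, (1 - edgeProb (ordStat z 1) (ordStat z 2) (ordStat z j))
  have h5 : (1 - q) * V ≤ (1 - halfCDF (ordStat z 1)) ^ (n - 1) * V := by gcongr
  nlinarith

lemma valB_le : valB z ≤ ∑ i ∈ Finset.Icc 3 n, ∑ j ∈ Finset.Ioc i n,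
    edgeProb (ordStat z 1) (ordStat z i) (ordStat z j) := by
  have hP : ∀ i, 0 ≤ 1 - ∏ j ∈ Finset.Ioc i n,
      (1 - edgeProb (ordStat z 1) (ordStat z i) (ordStat z j)) ∧
      1 - ∏ j ∈ Finset.Ioc i n, (1 - edgeProb (ordStat z 1) (ordStat z i) (ordStat z j)) ≤ 1 :=
    fun i => one_sub_mem (prod_mem fun _ => one_sub_mem (edgeProb_mem _ _ _))
  have h1 := one_sub_prod_le_sum (Finset.Icc 3 n) hP
  simp only [sub_sub_cancel] at h1
  refine (mul_le_of_le_one_left ?_ ?_).trans (h1.trans (Finset.sum_le_sum fun i _ =>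
    one_sub_prod_le_sum _ fun j => edgeProb_mem _ _ _))
  · exact (one_sub_mem (prod_mem fun _ => prod_mem fun _ => one_sub_mem (edgeProb_mem _ _ _))).1
  · exact (mul_mem_unit (pow_mem (one_sub_mem (halfCDF_mem _)) _)
      (prod_mem fun _ => one_sub_mem (edgeProb_mem _ _ _))).2

/-- Dropping all rows but `i = 3` only enlarges the product. With `q = n * halfCDF (ordStat z 1)`,
each of the two survival factors is at least `1 - q`, which costs `2 q²`, and linearizing the third
row costs one more `q²`. -/
lemma le_valB (hn : 3 ≤ n) :
    ∑ j ∈ Finset.Ioc 3 n, edgeProb (ordStat z 1) (ordStat z 3) (ordStat z j) -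
    3 * (n * halfCDF (ordStat z 1)) ^ 2 ≤ valB z := by
  set Y := ∑ j ∈ Finset.Ioc 3 n, edgeProb (ordStat z 1) (ordStat z 3) (ordStat z j) with hY
  set q := n * halfCDF (ordStat z 1) with hq
  have hq0 : 0 ≤ q := mul_nonneg n.cast_nonneg (halfCDF_pos _).le
  have hYq : Y ≤ q := sum_edgeProb_le z (by simp) 3
  have hY0 : 0 ≤ Y := Finset.sum_nonneg fun j _ => (edgeProb_pos _ _ _).le
  have h1 := one_sub_prod_le_sum (Finset.Ioc 3 n)
    fun j => edgeProb_mem (ordStat z 1) (ordStat z 3) (ordStat z j)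
  have h2 := sum_sub_sq_le_one_sub_prod (Finset.Ioc 3 n)
    fun j => edgeProb_mem (ordStat z 1) (ordStat z 3) (ordStat z j)
  have h3 : 1 - q ≤ (1 - halfCDF (ordStat z 1)) ^ (n - 1) := by
    have := (valS_le z); unfold valS at this; linarith
  have h3' : 1 - q ≤ ∏ j ∈ Finset.Icc 3 n,
      (1 - edgeProb (ordStat z 1) (ordStat z 2) (ordStat z j)) := by
    have := one_sub_prod_le_sum (Finset.Icc 3 n)
      fun j => edgeProb_mem (ordStat z 1) (ordStat z 2) (ordStat z j)
    have h := sum_edgeProb_le z (s := Finset.Icc 3 n) (by simp) 2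
    linarith
  have h6 : ∏ i ∈ Finset.Icc 3 n, ∏ j ∈ Finset.Ioc i n,
      (1 - edgeProb (ordStat z 1) (ordStat z i) (ordStat z j)) ≤
      ∏ j ∈ Finset.Ioc 3 n, (1 - edgeProb (ordStat z 1) (ordStat z 3) (ordStat z j)) := by
    rw [← Finset.mul_prod_erase _ _ (Finset.mem_Icc.2 ⟨le_rfl, hn⟩)]
    exact mul_le_of_le_one_right (prod_mem fun _ => one_sub_mem (edgeProb_mem _ _ _)).1
      (prod_mem fun _ => prod_mem fun _ => one_sub_mem (edgeProb_mem _ _ _)).2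
  have h4 := (one_sub_mem (prod_mem (T := Finset.Ioc 3 n) fun j =>
    one_sub_mem (edgeProb_mem (ordStat z 1) (ordStat z 3) (ordStat z j)))).1
  have h7 := pow_mem (one_sub_mem (halfCDF_mem (ordStat z 1))) (n - 1)
  have h8 := prod_mem (T := Finset.Icc 3 n) fun j =>
    one_sub_mem (edgeProb_mem (ordStat z 1) (ordStat z 2) (ordStat z j))
  unfold valB
  set V := 1 - ∏ j ∈ Finset.Ioc 3 n, (1 - edgeProb (ordStat z 1) (ordStat z 3) (ordStat z j))
  set a := (1 - halfCDF (ordStat z 1)) ^ (n - 1)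
  set b := ∏ j ∈ Finset.Icc 3 n, (1 - edgeProb (ordStat z 1) (ordStat z 2) (ordStat z j))
  have h9 : 1 - 2 * q ≤ a * b := by
    have : 0 ≤ (1 - a) * (1 - b) := mul_nonneg (by linarith [h7.2]) (by linarith [h8.2])
    nlinarith
  have h10 : a * b * V ≤ a * b * (1 - ∏ i ∈ Finset.Icc 3 n, ∏ j ∈ Finset.Ioc i n,
      (1 - edgeProb (ordStat z 1) (ordStat z i) (ordStat z j))) := by
    exact mul_le_mul_of_nonneg_left (by linarith) (mul_nonneg h7.1 h8.1)
  have h11 : (1 - 2 * q) * V ≤ a * b * V := by gcongr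
  nlinarith

end Pointwise

section Measurability

variable {n : ℕ}

lemma measurable_edgeProb : Measurable fun p : ℝ × ℝ × ℝ => edgeProb p.1 p.2.1 p.2.2 :=
  continuous_halfCDF.measurable.comp
    (by fun_prop : Measurable fun p : ℝ × ℝ × ℝ => p.1 - √((p.2.1 - p.1) * (p.2.2 - p.1)))

lemma measurable_edgeProb_ordStat (i j : ℕ) :
    Measurable fun z : Fin n → ℝ => edgeProb (ordStat z 1) (ordStat z i) (ordStat z j) :=
  measurable_edgeProb.comp ((measurable_ordStat 1).prodMk
    ((measurable_ordStat i).prodMk (measurable_ordStat j)))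

lemma measurable_halfCDF_ordStat :
    Measurable fun z : Fin n → ℝ => halfCDF (ordStat z 1) :=
  continuous_halfCDF.measurable.comp (measurable_ordStat 1)

lemma measurable_valS : Measurable (valS (n := n)) :=
  ((measurable_halfCDF_ordStat.const_sub 1).pow_const _).const_sub 1

lemma measurable_valA : Measurable (valA (n := n)) :=
  ((measurable_halfCDF_ordStat.const_sub 1).pow_const _).mul
    ((Finset.measurable_fun_prod _ fun j _ =>
      (measurable_edgeProb_ordStat 2 j).const_sub 1).const_sub 1)

lemma measurable_valB : Measurable (valB (n := n)) :=
  (((measurable_halfCDF_ordStat.const_sub 1).pow_const _).mul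
    (Finset.measurable_fun_prod _ fun j _ => (measurable_edgeProb_ordStat 2 j).const_sub 1)).mul
    ((Finset.measurable_fun_prod _ fun i _ => Finset.measurable_fun_prod _ fun j _ =>
      (measurable_edgeProb_ordStat i j).const_sub 1).const_sub 1)

lemma integrable_of_mem {α : Type*} [MeasurableSpace α] {μ : Measure α} [IsFiniteMeasure μ]
    {f : α → ℝ} (hf : Measurable f) (h : ∀ x, 0 ≤ f x ∧ f x ≤ 1) : Integrable f μ :=
  Integrable.of_bound hf.aestronglyMeasurable 1 (ae_of_all _ fun x => by
    rw [norm_of_nonneg (h x).1]; exact (h x).2)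

lemma measurable_leInd : Measurable fun p : ℝ × ℝ => leInd p.1 p.2 :=
  Measurable.ite (measurableSet_le measurable_fst measurable_snd) measurable_const measurable_const

lemma measurable_ltInd : Measurable fun p : ℝ × ℝ => ltInd p.1 p.2 :=
  Measurable.ite (measurableSet_lt measurable_fst measurable_snd) measurable_const measurable_const

lemma measurable_betweenInd : Measurable fun p : ℝ × ℝ × ℝ => betweenInd p.1 p.2.1 p.2.2 :=
  Measurable.ite ((measurableSet_le measurable_fst measurable_snd.snd).inter
    (measurableSet_le measurable_snd.snd measurable_snd.fst)) measurable_const measurable_const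

lemma measurable_strictBetweenInd :
    Measurable fun p : ℝ × ℝ × ℝ => strictBetweenInd p.1 p.2.1 p.2.2 :=
  Measurable.ite ((measurableSet_lt measurable_fst measurable_snd.snd).inter
    (measurableSet_lt measurable_snd.snd measurable_snd.fst)) measurable_const measurable_const

instance : NullSingletonClass (gaussianReal 0 1) := nullSingletonClass_gaussianReal one_ne_zero

lemma integral_leInd (x : ℝ) : ∫ e, leInd x e ∂(gaussianReal 0 1) = 1 - stdNormalCDF x := by
  have e : leInd x = (Ici x).indicator fun _ => 1 := by
    ext e; simp [leInd, indicator]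
  rw [e, integral_indicator measurableSet_Ici, setIntegral_const, stdNormalCDF_eq_real,
    ← probReal_compl_eq_one_sub measurableSet_Iic, compl_Iic, smul_eq_mul, mul_one,
    measureReal_congr Ioi_ae_eq_Ici]

lemma integral_ltInd (x : ℝ) : ∫ e, ltInd x e ∂(gaussianReal 0 1) = 1 - stdNormalCDF x := by
  have e : ltInd x = (Ioi x).indicator fun _ => 1 := by
    ext e; simp [ltInd, indicator]
  rw [e, integral_indicator measurableSet_Ioi, setIntegral_const, stdNormalCDF_eq_real,
    ← probReal_compl_eq_one_sub measurableSet_Iic, compl_Iic, smul_eq_mul, mul_one]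

lemma stdNormalCDF_sub_eq {x y : ℝ} (h : x ≤ y) :
    stdNormalCDF y - stdNormalCDF x = (gaussianReal 0 1).real (Ioc x y) := by
  rw [stdNormalCDF_eq_real, stdNormalCDF_eq_real, ← Iic_sdiff_Iic,
    measureReal_sdiff (Iic_subset_Iic.2 h) measurableSet_Iic]

lemma integral_betweenInd {x y : ℝ} (h : x ≤ y) :
    ∫ d, betweenInd x y d ∂(gaussianReal 0 1) = stdNormalCDF y - stdNormalCDF x := by
  have e : betweenInd x y = (Icc x y).indicator fun _ => 1 := by
    ext e; simp [betweenInd, indicator]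
  rw [e, integral_indicator measurableSet_Icc, setIntegral_const, smul_eq_mul, mul_one,
    stdNormalCDF_sub_eq h, measureReal_congr Ioc_ae_eq_Icc]

lemma integral_strictBetweenInd {x y : ℝ} (h : x ≤ y) :
    ∫ d, strictBetweenInd x y d ∂(gaussianReal 0 1) = stdNormalCDF y - stdNormalCDF x := by
  have e : strictBetweenInd x y = (Ioo x y).indicator fun _ => 1 := by
    ext e; simp [strictBetweenInd, indicator]
  rw [e, integral_indicator measurableSet_Ioo, setIntegral_const, smul_eq_mul, mul_one,
    stdNormalCDF_sub_eq h, measureReal_congr Ioo_ae_eq_Ioc]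

end Measurability

end Expectations

end StQP

namespace StQP

/-! ### Asymptotics of the three expectations. -/

section ExpectationAsymptotics

open Real Set Function

lemma integral_triple {F : ℝ → ℝ → ℝ → ℝ} (hF : Measurable fun p : ℝ × ℝ × ℝ => F p.1 p.2.1 p.2.2)
    (hF1 : ∀ x y w, 0 ≤ F x y w ∧ F x y w ≤ 1) (μ : Measure ℝ) [IsProbabilityMeasure μ] :
    ∫ x, ∫ w, ∫ y, F x y w ∂μ ∂μ ∂μ = ∫ p, F p.1 p.2.2 p.2.1 ∂(μ.prod (μ.prod μ)) := by
  have hm : Measurable fun p : ℝ × ℝ × ℝ => F p.1 p.2.2 p.2.1 :=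
    hF.comp (by fun_prop : Measurable fun p : ℝ × ℝ × ℝ => (p.1, p.2.2, p.2.1))
  rw [integral_prod _ (integrable_of_mem hm fun p => hF1 _ _ _)]
  congr 1; ext x
  rw [integral_prod]
  exact integrable_of_mem (hm.comp measurable_prodMk_left) fun p => hF1 _ _ _

/-- The normalized contribution of the pairs with gap kernel of order `m`. -/
noncomputable def gapMean (m : ℕ) (c : ℝ → ℝ → ℝ → ℝ) (N : ℕ) : ℝ :=
  ∫ x, gapIntegral m c x * (1 - stdNormalCDF x) ^ N ∂(gaussianReal 0 1)

variable {m : ℕ} {c : ℝ → ℝ → ℝ → ℝ}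

lemma measurable_one_sub_pow (N : ℕ) : Measurable fun x => (1 - stdNormalCDF x) ^ N := by
  simpa using measurable_pow_mul_pow 0 N

lemma one_sub_pow_mem (N : ℕ) (x : ℝ) :
    0 ≤ (1 - stdNormalCDF x) ^ N ∧ (1 - stdNormalCDF x) ^ N ≤ 1 := by
  simpa using pow_mul_pow_mem 0 N x

lemma gapMean_eq_triple (m : ℕ) (c : ℝ → ℝ → ℝ → ℝ) (N : ℕ) : gapMean m c N =
    ∫ x, ∫ w, ∫ y, gapKernel m c x y w * (1 - stdNormalCDF x) ^ N
      ∂(gaussianReal 0 1) ∂(gaussianReal 0 1) ∂(gaussianReal 0 1) := by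
  simp_rw [integral_mul_const]
  rfl

lemma gapMean_eq (hc : IsGapWeight m c) (N : ℕ) : gapMean m c N =
    ∫ p : ℝ × ℝ × ℝ, gapKernel m c p.1 p.2.2 p.2.1 * (1 - stdNormalCDF p.1) ^ N
      ∂((gaussianReal 0 1).prod ((gaussianReal 0 1).prod (gaussianReal 0 1))) := by
  rw [gapMean_eq_triple]
  exact integral_triple (F := fun x y w => gapKernel m c x y w * (1 - stdNormalCDF x) ^ N)
    ((measurable_gapKernel hc).mul ((measurable_one_sub_pow N).comp measurable_fst))
    (fun x y w => mul_mem_unit (gapKernel_mem hc x y w) (one_sub_pow_mem N x)) _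

lemma gapKernel_succ (x y w : ℝ) :
    gapKernel m c x y w * (stdNormalCDF y - stdNormalCDF x) = gapKernel (m + 1) c x y w := by
  simp only [gapKernel]; ring

/-- Moving the power of `1 - Φ` from `y` down to `x` costs at most `N (Φ(y) - Φ(x)) (1 - Φ(x)) ^ (N
- 1)`. The extra increment of `Φ` raises the order of the gap kernel by one. -/
lemma gapMean_sub_le (hc : IsGapWeight m c) (hc' : IsGapWeight (m + 1) c) (N : ℕ) :
    gapMean m c N - N * gapMean (m + 1) c (N - 1) ≤
      ∫ x, ∫ w, ∫ y, gapKernel m c x y w * (1 - stdNormalCDF y) ^ N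
        ∂(gaussianReal 0 1) ∂(gaussianReal 0 1) ∂(gaussianReal 0 1) := by
  have hm : Measurable fun p : ℝ × ℝ × ℝ => gapKernel m c p.1 p.2.1 p.2.2 *
      (1 - stdNormalCDF p.2.1) ^ N :=
    (measurable_gapKernel hc).mul ((measurable_one_sub_pow N).comp measurable_snd.fst)
  have hb : ∀ x y w : ℝ, 0 ≤ gapKernel m c x y w * (1 - stdNormalCDF y) ^ N ∧
      gapKernel m c x y w * (1 - stdNormalCDF y) ^ N ≤ 1 := fun x y w =>
    mul_mem_unit (gapKernel_mem hc x y w) (one_sub_pow_mem N y)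
  have hsw : Measurable fun p : ℝ × ℝ × ℝ => (p.1, p.2.2, p.2.1) := by fun_prop
  have i1 : ∀ {m'} (_ : IsGapWeight m' c) (N' : ℕ), Integrable (fun p : ℝ × ℝ × ℝ =>
      gapKernel m' c p.1 p.2.2 p.2.1 * (1 - stdNormalCDF p.1) ^ N')
      ((gaussianReal 0 1).prod ((gaussianReal 0 1).prod (gaussianReal 0 1))) := fun hcc N' =>
    integrable_of_mem (((measurable_gapKernel hcc).comp hsw).mul
      ((measurable_one_sub_pow N').comp measurable_fst))
      fun p => mul_mem_unit (gapKernel_mem hcc _ _ _) (one_sub_pow_mem N' _)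
  rw [integral_triple (F := fun x y w => gapKernel m c x y w * (1 - stdNormalCDF y) ^ N) hm hb,
    gapMean_eq hc, gapMean_eq hc', ← integral_const_mul, ← integral_sub (i1 hc N)
      ((i1 hc' (N - 1)).const_mul _)]
  refine integral_mono ((i1 hc N).sub ((i1 hc' (N - 1)).const_mul _))
    (integrable_of_mem (hm.comp hsw) fun p => hb _ _ _) fun p => ?_
  obtain ⟨x, w, y⟩ := p
  simp only
  by_cases h : gapKernel m c x y w = 0
  · simp [← gapKernel_succ, h]
  have hxy : x ≤ y := (hc.supp x y w fun h0 => h (by simp [gapKernel, h0])).1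
  have h1 := pow_sub_pow_le (a := 1 - stdNormalCDF x) (b := 1 - stdNormalCDF y)
    (by linarith [stdNormalCDF_le_one y]) (by linarith [stdNormalCDF_mono hxy]) N
  have h2 := mul_le_mul_of_nonneg_left h1 (gapKernel_mem hc x y w).1
  rw [← gapKernel_succ]
  linarith

variable {n : ℕ}

lemma integral_halfCDF_le_aux (a : Fin n) :
    ∫ z, halfCDF (z a) * ∏ e ∈ {a}ᶜ, leInd (z a) (z e) ∂(normalPi n) =
      ∫ x, halfCDF x * (1 - stdNormalCDF x) ^ (n - 1) ∂(gaussianReal 0 1) := by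
  have := integral_pi_one (gaussianReal 0 1) continuous_halfCDF.measurable halfCDF_mem
    measurable_leInd leInd_mem a
  simp only [integral_leInd, Fintype.card_fin] at this
  exact this

lemma integral_halfCDF_lt_aux (a : Fin n) :
    ∫ z, halfCDF (z a) * ∏ e ∈ {a}ᶜ, ltInd (z a) (z e) ∂(normalPi n) =
      ∫ x, halfCDF x * (1 - stdNormalCDF x) ^ (n - 1) ∂(gaussianReal 0 1) := by
  have := integral_pi_one (gaussianReal 0 1) continuous_halfCDF.measurable halfCDF_mem
    measurable_ltInd ltInd_mem a
  simp only [integral_ltInd, Fintype.card_fin] at this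
  exact this

lemma measurable_prod_ind {v : ℝ → ℝ → ℝ} (hv : Measurable fun p : ℝ × ℝ => v p.1 p.2)
    (a : Fin n) (T : Finset (Fin n)) : Measurable fun z : Fin n → ℝ => ∏ e ∈ T, v (z a) (z e) :=
  Finset.measurable_fun_prod _ fun e _ =>
    hv.comp ((measurable_pi_apply (X := fun _ : Fin n => ℝ) a).prodMk
      (measurable_pi_apply (X := fun _ : Fin n => ℝ) e))

lemma measurable_comp_three {F : ℝ → ℝ → ℝ → ℝ}
    (hF : Measurable fun p : ℝ × ℝ × ℝ => F p.1 p.2.1 p.2.2) (a b c : Fin n) :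
    Measurable fun z : Fin n → ℝ => F (z a) (z b) (z c) := by
  have hp := fun e : Fin n => measurable_pi_apply (X := fun _ : Fin n => ℝ) e
  exact hF.comp ((hp a).prodMk ((hp b).prodMk (hp c)))

lemma integral_halfCDF_ordStat (hn : 0 < n) : ∫ z, halfCDF (ordStat z 1) ∂(normalPi n) =
    n * ∫ x, halfCDF x * (1 - stdNormalCDF x) ^ (n - 1) ∂(gaussianReal 0 1) := by
  have hq : Integrable (fun z : Fin n → ℝ => halfCDF (ordStat z 1)) (normalPi n) :=
    integrable_of_mem measurable_halfCDF_ordStat fun _ => halfCDF_mem _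
  have i1 : ∀ a : Fin n, Integrable (fun z : Fin n → ℝ => halfCDF (z a) *
      ∏ e ∈ {a}ᶜ, leInd (z a) (z e)) (normalPi n) := fun a =>
    integrable_of_mem ((continuous_halfCDF.measurable.comp (measurable_pi_apply a)).mul
      (measurable_prod_ind measurable_leInd a _))
      fun z => mul_mem_unit (halfCDF_mem _) (prod_mem fun _ => leInd_mem _ _)
  have i2 : ∀ a : Fin n, Integrable (fun z : Fin n → ℝ => halfCDF (z a) *
      ∏ e ∈ {a}ᶜ, ltInd (z a) (z e)) (normalPi n) := fun a =>
    integrable_of_mem ((continuous_halfCDF.measurable.comp (measurable_pi_apply a)).mul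
      (measurable_prod_ind measurable_ltInd a _))
      fun z => mul_mem_unit (halfCDF_mem _) (prod_mem fun _ => ltInd_mem _ _)
  apply le_antisymm
  · refine (integral_mono hq (integrable_finsetSum _ fun a _ => i1 a)
      fun z => halfCDF_ordStat_le_sum z hn).trans ?_
    rw [integral_finsetSum _ fun a _ => i1 a]
    simp [integral_halfCDF_le_aux]
  · refine le_trans ?_ (integral_mono (integrable_finsetSum _ fun a _ => i2 a) hq
      fun z => sum_le_halfCDF_ordStat z hn)
    rw [integral_finsetSum _ fun a _ => i2 a]
    simp [integral_halfCDF_lt_aux]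

lemma injTuples_ne {k : ℕ} {t : Fin k → Fin n} (ht : t ∈ injTuples k n) {i j : Fin k}
    (h : i ≠ j) : t i ≠ t j := fun h' => h ((Finset.mem_filter.1 ht).2 h')

lemma integral_sum_pair_two_le (hn : 0 < n) :
    ∫ z, ∑ j ∈ Finset.Icc 3 n, edgeProb (ordStat z 1) (ordStat z 2) (ordStat z j) ∂(normalPi n) ≤
      n.descFactorial 3 * gapMean 0 fullWeight (n - 3) := by
  have hw : IsGapWeight 0 fullWeight := isGapWeight_fullWeight (by norm_num)
  have i1 : ∀ t : Fin 3 → Fin n, Integrable (fun z : Fin n → ℝ =>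
      gapKernel 0 fullWeight (z (t 0)) (z (t 1)) (z (t 2)) *
      ∏ e ∈ {t 0, t 1, t 2}ᶜ, leInd (z (t 0)) (z e)) (normalPi n) := fun t =>
    integrable_of_mem ((measurable_comp_three (measurable_gapKernel hw) _ _ _).mul
      (measurable_prod_ind measurable_leInd _ _))
      fun z => mul_mem_unit (gapKernel_mem hw _ _ _) (prod_mem fun _ => leInd_mem _ _)
  refine (integral_mono (integrable_finsetSum _ fun j _ =>
    integrable_of_mem (measurable_edgeProb_ordStat 2 j) fun z => edgeProb_mem _ _ _)
    (integrable_finsetSum _ fun t _ => i1 t) fun z => sum_pair_two_le z hn).trans (le_of_eq ?_)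
  rw [integral_finsetSum _ fun t _ => i1 t, ← card_injTuples, ← nsmul_eq_mul, ← Finset.sum_const]
  refine Finset.sum_congr rfl fun t ht => ?_
  have h := integral_pi_three (gaussianReal 0 1) (v := fun x _ e => leInd x e)
    (measurable_gapKernel hw) (gapKernel_mem hw)
    (measurable_leInd.comp (by fun_prop : Measurable fun p : ℝ × ℝ × ℝ => (p.1, p.2.2)))
    (fun x _ e => leInd_mem x e) (injTuples_ne ht (by decide : (0 : Fin 3) ≠ 1))
    (injTuples_ne ht (by decide : (0 : Fin 3) ≠ 2)) (injTuples_ne ht (by decide : (1 : Fin 3) ≠ 2))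
  simp only [integral_leInd, Fintype.card_fin] at h
  rw [gapMean_eq_triple]
  exact h

lemma le_integral_sum_pair_two (hn : 0 < n) :
    n.descFactorial 3 * (gapMean 0 cutWeight (n - 3) - n * gapMean 1 cutWeight (n - 4)) ≤
    ∫ z, ∑ j ∈ Finset.Icc 3 n, edgeProb (ordStat z 1) (ordStat z 2) (ordStat z j)
      ∂(normalPi n) := by
  have hw : IsGapWeight 0 cutWeight := isGapWeight_cutWeight (by norm_num)
  have hw1 : IsGapWeight 1 cutWeight := isGapWeight_cutWeight (by norm_num)
  have i1 : ∀ t : Fin 3 → Fin n, Integrable (fun z : Fin n → ℝ =>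
      gapKernel 0 cutWeight (z (t 0)) (z (t 1)) (z (t 2)) *
      ∏ e ∈ {t 0, t 1, t 2}ᶜ, ltInd (z (t 1)) (z e)) (normalPi n) := fun t =>
    integrable_of_mem ((measurable_comp_three (measurable_gapKernel hw) _ _ _).mul
      (measurable_prod_ind measurable_ltInd _ _))
      fun z => mul_mem_unit (gapKernel_mem hw _ _ _) (prod_mem fun _ => ltInd_mem _ _)
  refine le_trans ?_ (integral_mono (integrable_finsetSum _ fun t _ => i1 t)
    (integrable_finsetSum _ fun j _ =>
      integrable_of_mem (measurable_edgeProb_ordStat 2 j) fun z => edgeProb_mem _ _ _)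
    fun z => le_sum_pair_two z hn)
  rw [integral_finsetSum _ fun t _ => i1 t, ← card_injTuples, ← nsmul_eq_mul, ← Finset.sum_const]
  refine Finset.sum_le_sum fun t ht => ?_
  have h := integral_pi_three (gaussianReal 0 1) (v := fun _ y e => ltInd y e)
    (measurable_gapKernel hw) (gapKernel_mem hw)
    (measurable_ltInd.comp (by fun_prop : Measurable fun p : ℝ × ℝ × ℝ => (p.2.1, p.2.2)))
    (fun _ y e => ltInd_mem y e) (injTuples_ne ht (by decide : (0 : Fin 3) ≠ 1))
    (injTuples_ne ht (by decide : (0 : Fin 3) ≠ 2)) (injTuples_ne ht (by decide : (1 : Fin 3) ≠ 2))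
  simp only [integral_ltInd, Fintype.card_fin] at h
  have h2 := gapMean_sub_le hw hw1 (n - 3)
  rw [← h] at h2
  refine le_trans ?_ h2
  have h3 : (0 : ℝ) ≤ gapMean 1 cutWeight (n - 4) :=
    integral_nonneg fun x => (mul_mem_unit (gapIntegral_mem hw1 x) (one_sub_pow_mem _ x)).1
  have h4 : ((n - 3 : ℕ) : ℝ) ≤ n := by exact_mod_cast Nat.sub_le n 3
  have h5 : n - 3 - 1 = n - 4 := by omega
  rw [h5, zero_add]
  have := mul_le_mul_of_nonneg_right h4 h3
  linarith

lemma integral_betweenInd_mul {x y w : ℝ} :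
    gapKernel 0 fullWeight x y w * (∫ d, betweenInd x y d ∂(gaussianReal 0 1)) =
      gapKernel 1 fullWeight x y w := by
  rw [← gapKernel_succ]
  by_cases h : fullWeight x y w = 0
  · simp [gapKernel, h]
  · rw [integral_betweenInd ((isGapWeight_fullWeight (m := 0) (by norm_num)).supp x y w h).1]

lemma integral_strictBetweenInd_mul {x y w : ℝ} :
    gapKernel 0 cutWeight x y w * (∫ d, strictBetweenInd x y d ∂(gaussianReal 0 1)) =
      gapKernel 1 cutWeight x y w := by
  rw [← gapKernel_succ]
  by_cases h : cutWeight x y w = 0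
  · simp [gapKernel, h]
  · rw [integral_strictBetweenInd ((isGapWeight_cutWeight (m := 0) (by norm_num)).supp x y w h).1]

lemma integral_sum_pair_ge_three_le (hn : 0 < n) :
    ∫ z, ∑ i ∈ Finset.Icc 3 n, ∑ j ∈ Finset.Ioc i n,
      edgeProb (ordStat z 1) (ordStat z i) (ordStat z j) ∂(normalPi n) ≤
      n.descFactorial 4 * gapMean 1 fullWeight (n - 4) := by
  have hw : IsGapWeight 0 fullWeight := isGapWeight_fullWeight (by norm_num)
  have i1 : ∀ t : Fin 4 → Fin n, Integrable (fun z : Fin n → ℝ =>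
      gapKernel 0 fullWeight (z (t 0)) (z (t 1)) (z (t 2)) *
      betweenInd (z (t 0)) (z (t 1)) (z (t 3)) *
      ∏ e ∈ {t 0, t 1, t 2, t 3}ᶜ, leInd (z (t 0)) (z e)) (normalPi n) := fun t =>
    integrable_of_mem (((measurable_comp_three (measurable_gapKernel hw) _ _ _).mul
      (measurable_comp_three measurable_betweenInd _ _ _)).mul
      (measurable_prod_ind measurable_leInd _ _))
      fun z => mul_mem_unit (mul_mem_unit (gapKernel_mem hw _ _ _) (betweenInd_mem _ _ _))
        (prod_mem fun _ => leInd_mem _ _)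
  refine (integral_mono (integrable_finsetSum _ fun i _ => integrable_finsetSum _ fun j _ =>
    integrable_of_mem (measurable_edgeProb_ordStat i j) fun z => edgeProb_mem _ _ _)
    (integrable_finsetSum _ fun t _ => i1 t) fun z => sum_pair_ge_three_le z hn).trans (le_of_eq ?_)
  rw [integral_finsetSum _ fun t _ => i1 t, ← card_injTuples, ← nsmul_eq_mul, ← Finset.sum_const]
  refine Finset.sum_congr rfl fun t ht => ?_
  have h := integral_pi_four (gaussianReal 0 1) (v := fun x _ e => leInd x e)
    (measurable_gapKernel hw) (gapKernel_mem hw)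
    (measurable_leInd.comp (by fun_prop : Measurable fun p : ℝ × ℝ × ℝ => (p.1, p.2.2)))
    (fun x _ e => leInd_mem x e) measurable_betweenInd betweenInd_mem
    (injTuples_ne ht (by decide : (0 : Fin 4) ≠ 1))
    (injTuples_ne ht (by decide : (0 : Fin 4) ≠ 2)) (injTuples_ne ht (by decide : (1 : Fin 4) ≠ 2))
    (injTuples_ne ht (by decide : (0 : Fin 4) ≠ 3)) (injTuples_ne ht (by decide : (1 : Fin 4) ≠ 3))
    (injTuples_ne ht (by decide : (2 : Fin 4) ≠ 3))
  simp only [integral_leInd, Fintype.card_fin, integral_betweenInd_mul] at h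
  rw [gapMean_eq_triple]
  exact h

lemma le_integral_sum_pair_three (hn : 0 < n) :
    n.descFactorial 4 * (gapMean 1 cutWeight (n - 4) - n * gapMean 2 cutWeight (n - 5)) ≤
    ∫ z, ∑ j ∈ Finset.Ioc 3 n, edgeProb (ordStat z 1) (ordStat z 3) (ordStat z j)
      ∂(normalPi n) := by
  have hw : IsGapWeight 0 cutWeight := isGapWeight_cutWeight (by norm_num)
  have hw1 : IsGapWeight 1 cutWeight := isGapWeight_cutWeight (by norm_num)
  have hw2 : IsGapWeight 2 cutWeight := isGapWeight_cutWeight (by norm_num)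
  have i1 : ∀ t : Fin 4 → Fin n, Integrable (fun z : Fin n → ℝ =>
      gapKernel 0 cutWeight (z (t 0)) (z (t 1)) (z (t 2)) *
      strictBetweenInd (z (t 0)) (z (t 1)) (z (t 3)) *
      ∏ e ∈ {t 0, t 1, t 2, t 3}ᶜ, ltInd (z (t 1)) (z e)) (normalPi n) := fun t =>
    integrable_of_mem (((measurable_comp_three (measurable_gapKernel hw) _ _ _).mul
      (measurable_comp_three measurable_strictBetweenInd _ _ _)).mul
      (measurable_prod_ind measurable_ltInd _ _))
      fun z => mul_mem_unit (mul_mem_unit (gapKernel_mem hw _ _ _) (strictBetweenInd_mem _ _ _))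
        (prod_mem fun _ => ltInd_mem _ _)
  refine le_trans ?_ (integral_mono (integrable_finsetSum _ fun t _ => i1 t)
    (integrable_finsetSum _ fun j _ =>
      integrable_of_mem (measurable_edgeProb_ordStat 3 j) fun z => edgeProb_mem _ _ _)
    fun z => le_sum_pair_three z hn)
  rw [integral_finsetSum _ fun t _ => i1 t, ← card_injTuples, ← nsmul_eq_mul, ← Finset.sum_const]
  refine Finset.sum_le_sum fun t ht => ?_
  have h := integral_pi_four (gaussianReal 0 1) (v := fun _ y e => ltInd y e)
    (measurable_gapKernel hw) (gapKernel_mem hw)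
    (measurable_ltInd.comp (by fun_prop : Measurable fun p : ℝ × ℝ × ℝ => (p.2.1, p.2.2)))
    (fun _ y e => ltInd_mem y e) measurable_strictBetweenInd strictBetweenInd_mem
    (injTuples_ne ht (by decide : (0 : Fin 4) ≠ 1))
    (injTuples_ne ht (by decide : (0 : Fin 4) ≠ 2)) (injTuples_ne ht (by decide : (1 : Fin 4) ≠ 2))
    (injTuples_ne ht (by decide : (0 : Fin 4) ≠ 3)) (injTuples_ne ht (by decide : (1 : Fin 4) ≠ 3))
    (injTuples_ne ht (by decide : (2 : Fin 4) ≠ 3))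
  simp only [integral_ltInd, Fintype.card_fin, integral_strictBetweenInd_mul] at h
  have h2 := gapMean_sub_le hw1 hw2 (n - 4)
  rw [← h] at h2
  refine le_trans ?_ h2
  have h3 : (0 : ℝ) ≤ gapMean 2 cutWeight (n - 5) :=
    integral_nonneg fun x => (mul_mem_unit (gapIntegral_mem hw2 x) (one_sub_pow_mem _ x)).1
  have h4 : ((n - 4 : ℕ) : ℝ) ≤ n := by exact_mod_cast Nat.sub_le n 4
  have h5 : n - 4 - 1 = n - 5 := by omega
  rw [h5, one_add_one_eq_two]
  have := mul_le_mul_of_nonneg_right h4 h3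
  linarith

/-- The second moment controlling the nonlinear corrections. -/
noncomputable def secondMoment (n : ℕ) : ℝ :=
  ∫ z, (n * halfCDF (ordStat z 1)) ^ 2 ∂(normalPi n)

lemma integrable_sq : Integrable (fun z : Fin n → ℝ => (n * halfCDF (ordStat z 1)) ^ 2)
    (normalPi n) := by
  simp_rw [mul_pow]
  exact (integrable_of_mem (measurable_halfCDF_ordStat.pow_const 2)
    fun z => pow_mem (halfCDF_mem _) 2).const_mul _

/-- Either the minimum is below `-minScaleLow n` and the tail bound applies, or all coordinates
exceed that level, which has probability at most `exp (-minScale n ^ 3)`. -/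
lemma secondMoment_le : ∀ᶠ n : ℕ in atTop, secondMoment n ≤
    n ^ 2 * (exp (-(2 * minScaleLow n ^ 2)) + exp (-minScale n ^ 3)) := by
  filter_upwards [eventually_one_sub_pow_le 0, eventually_gt_atTop 0] with n h hn
  simp only [Nat.sub_zero, Nat.cast_zero, exp_zero, one_mul] at h
  have hr : 0 ≤ minScaleLow n := sqrt_nonneg _
  have hpt : ∀ z : Fin n → ℝ, (n * halfCDF (ordStat z 1)) ^ 2 ≤
      n ^ 2 * (exp (-(2 * minScaleLow n ^ 2)) +
        ∏ e ∈ Finset.univ, ltInd (-minScaleLow n) (z e)) := by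
    intro z
    rw [mul_pow]
    gcongr
    have hp := prod_mem (T := Finset.univ) fun e => ltInd_mem (-minScaleLow n) (z e)
    rcases le_or_gt (ordStat z 1) (-minScaleLow n) with hz | hz
    · have h1 : halfCDF (ordStat z 1) ≤ exp (-minScaleLow n ^ 2) :=
        (halfCDF_mono hz).trans (halfCDF_neg_le_exp hr)
      have h2 : halfCDF (ordStat z 1) ^ 2 ≤ exp (-minScaleLow n ^ 2) ^ 2 :=
        pow_le_pow_left₀ (halfCDF_pos _).le h1 2
      rw [← exp_nat_mul] at h2
      push_cast at h2
      rw [mul_neg] at h2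
      linarith [hp.1]
    · have h1 : ∏ e ∈ Finset.univ, ltInd (-minScaleLow n) (z e) = 1 :=
        Finset.prod_eq_one fun e _ => if_pos (hz.trans_le (ordStat_one_le z e))
      have := (pow_mem (halfCDF_mem (ordStat z 1)) 2).2
      rw [h1]
      linarith [exp_pos (-(2 * minScaleLow n ^ 2))]
  have hi : Integrable (fun z : Fin n → ℝ => ∏ e ∈ Finset.univ, ltInd (-minScaleLow n) (z e))
      (normalPi n) := integrable_of_mem (Finset.measurable_fun_prod _ fun e _ =>
        measurable_ltInd.comp (measurable_const.prodMk
          (measurable_pi_apply (X := fun _ : Fin n => ℝ) e)))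
        fun z => prod_mem fun e => ltInd_mem _ _
  have := integral_mono integrable_sq (((integrable_const _).add hi).const_mul _) hpt
  refine this.trans ?_
  simp only [Pi.add_apply]
  rw [integral_const_mul, integral_add (integrable_const _) hi, normalPi,
    integral_prod_pi (gaussianReal 0 1) Finset.univ (ltInd (-minScaleLow n)), integral_ltInd,
    Finset.card_univ, Fintype.card_fin]
  simp only [integral_const, probReal_univ, smul_eq_mul, one_mul]
  gcongr

lemma secondMoment_nonneg (n : ℕ) : 0 ≤ secondMoment n := integral_nonneg fun _ => sq_nonneg _

lemma tendsto_mul_secondMoment (s : ℝ) :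
    Tendsto (fun n : ℕ => n * minScale n ^ s * secondMoment n) atTop (𝓝 0) := by
  have h1 := tendsto_natCast_pow_mul_exp_low (a := 3) (β := 2) (by norm_num) s
  have h2 := tendsto_natCast_pow_mul_exp_cube 3 s
  have h := h1.add h2
  rw [add_zero] at h
  refine squeeze_zero' ?_ ?_ h
  · filter_upwards [eventually_one_le_minScale] with n hn
    have := secondMoment_nonneg n
    positivity
  · filter_upwards [eventually_one_le_minScale, secondMoment_le] with n hn hs
    calc _ ≤ n * minScale n ^ s *
          (n ^ 2 * (exp (-(2 * minScaleLow n ^ 2)) + exp (-minScale n ^ 3))) := by gcongr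
      _ = _ := by ring

lemma tendsto_descFactorial_div (k : ℕ) :
    Tendsto (fun n : ℕ => (n.descFactorial k : ℝ) / n ^ k) atTop (𝓝 1) := by
  induction k with
  | zero => simp
  | succ k ih =>
    have h1 : Tendsto (fun n : ℕ => ((n - k : ℕ) : ℝ) / n) atTop (𝓝 1) := by
      have h2 := (tendsto_const_nhds (x := (k : ℝ))).div_atTop tendsto_natCast_atTop_atTop
      have h3 := (tendsto_const_nhds (x := (1 : ℝ))).sub h2
      rw [sub_zero] at h3
      refine h3.congr' ?_
      filter_upwards [eventually_ge_atTop k, eventually_gt_atTop 0] with n hn h0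
      rw [Nat.cast_sub hn]
      have : (n : ℝ) ≠ 0 := by positivity
      field_simp
    have := h1.mul ih
    rw [one_mul] at this
    refine this.congr fun n => ?_
    rw [Nat.descFactorial_succ]
    push_cast
    rw [div_mul_div_comm, pow_succ']

lemma tendsto_gapMean (hc : IsGapWeight m c) (j : ℕ) :
    Tendsto (fun n : ℕ => (n : ℝ) ^ (m + 4) * minScale n ^ (2 * m + 1) * gapMean m c (n - j)) atTop
      (𝓝 (2 * (2 * m + 1).factorial / 2 ^ (2 * m + 2) * √π * (m + 3).factorial)) :=
  tendsto_integral_gapIntegral hc j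

lemma tendsto_descFactorial_mul_gapMean (hc : IsGapWeight m c) (j : ℕ) :
    Tendsto (fun n : ℕ => (n : ℝ) * minScale n ^ (2 * m + 1) *
      (n.descFactorial (m + 3) * gapMean m c (n - j))) atTop
      (𝓝 (2 * (2 * m + 1).factorial / 2 ^ (2 * m + 2) * √π * (m + 3).factorial)) := by
  have h := (tendsto_descFactorial_div (m + 3)).mul (tendsto_gapMean hc j)
  rw [one_mul] at h
  refine h.congr' ?_
  filter_upwards [eventually_gt_atTop 0] with n hn
  have : (n : ℝ) ≠ 0 := by positivity
  field_simp
  ring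

/-- Raising the order by one gains `1 / (n L²)`. The prefactor `n` cancels the first part and `L⁻²`
remains, so the loss in `gapMean_sub_le` is of lower order. -/
lemma tendsto_descFactorial_mul_gapMean_succ (hc : IsGapWeight (m + 1) c) (j : ℕ) :
    Tendsto (fun n : ℕ => (n : ℝ) * minScale n ^ (2 * m + 1) *
      (n.descFactorial (m + 3) * (n * gapMean (m + 1) c (n - j)))) atTop (𝓝 0) := by
  have h := ((tendsto_descFactorial_div (m + 3)).mul (tendsto_gapMean hc j)).mul
    ((tendsto_inv_atTop_zero.comp tendsto_minScale).pow 2)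
  rw [zero_pow two_ne_zero, mul_zero] at h
  refine h.congr' ?_
  filter_upwards [eventually_gt_atTop 0, eventually_one_le_minScale] with n hn hL
  have : (n : ℝ) ≠ 0 := by positivity
  have : minScale n ≠ 0 := by positivity
  simp only [comp]
  field_simp
  ring

theorem tendsto_integral_valS : Tendsto (fun n : ℕ => n * (minScale n)⁻¹ *
    ∫ z, valS z ∂(normalPi n)) atTop (𝓝 (√π * 2)) := by
  have hmain : Tendsto (fun n : ℕ => n * (minScale n)⁻¹ *
      (n * ∫ z, halfCDF (ordStat z 1) ∂(normalPi n))) atTop (𝓝 (√π * 2)) := by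
    refine (tendsto_integral_halfCDF 1).congr' ?_
    filter_upwards [eventually_gt_atTop 0] with n hn
    rw [integral_halfCDF_ordStat hn]; ring
  have hr : Tendsto (fun n : ℕ => ((n - 1 : ℕ) : ℝ) / n) atTop (𝓝 1) := by
    have := tendsto_descFactorial_div 2
    refine this.congr' ?_
    filter_upwards [eventually_gt_atTop 0] with n hn
    have : (n : ℝ) ≠ 0 := by positivity
    simp [Nat.descFactorial]
    field_simp
  have hlow := (hr.mul hmain).sub (tendsto_mul_secondMoment (-1))
  rw [one_mul, sub_zero] at hlow
  have hq : ∀ n, Integrable (fun z : Fin n → ℝ => halfCDF (ordStat z 1)) (normalPi n) := fun n =>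
    integrable_of_mem measurable_halfCDF_ordStat fun _ => halfCDF_mem _
  have hS : ∀ n, Integrable (valS (n := n)) (normalPi n) := fun n =>
    integrable_of_mem measurable_valS valS_mem
  refine tendsto_of_tendsto_of_tendsto_of_le_of_le' hlow hmain ?_ ?_
  · filter_upwards [eventually_one_le_minScale, eventually_gt_atTop 0] with n hL hn
    have h := integral_mono (((hq n).const_mul ((n - 1 : ℕ) : ℝ)).sub integrable_sq) (hS n) le_valS
    rw [integral_sub' ((hq n).const_mul _) integrable_sq, integral_const_mul] at h
    have h0 : (n : ℝ) ≠ 0 := by positivity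
    have hL0 : 0 ≤ n * (minScale n)⁻¹ := by positivity
    have := mul_le_mul_of_nonneg_left h hL0
    refine le_trans (le_of_eq ?_) this
    rw [rpow_neg_one, secondMoment]
    field_simp
  · filter_upwards [eventually_one_le_minScale] with n hL
    have h := integral_mono (hS n) ((hq n).const_mul (n : ℝ)) valS_le
    rw [integral_const_mul] at h
    gcongr

/-- The upper bound uses the full weight. The lower bound uses the cut weight, whose correction
needs order one more. Both give the constant of the gap integral with `m = 0`. -/
theorem tendsto_integral_valA : Tendsto (fun n : ℕ => n * minScale n *
    ∫ z, valA z ∂(normalPi n)) atTop (𝓝 (3 * √π)) := by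
  have hw : IsGapWeight 0 fullWeight := isGapWeight_fullWeight (by norm_num)
  have hc : IsGapWeight 0 cutWeight := isGapWeight_cutWeight (by norm_num)
  have hc1 : IsGapWeight 1 cutWeight := isGapWeight_cutWeight (by norm_num)
  have hup := tendsto_descFactorial_mul_gapMean hw 3
  have hlow := ((tendsto_descFactorial_mul_gapMean hc 3).sub
    (tendsto_descFactorial_mul_gapMean_succ hc1 4)).sub
    ((tendsto_mul_secondMoment 1).const_mul 2)
  have hC : (2 * ((2 * 0 + 1).factorial : ℝ) / 2 ^ (2 * 0 + 2) * √π * ((0 + 3).factorial : ℝ)) =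
      3 * √π := by norm_num [Nat.factorial]; ring
  rw [hC] at hup hlow
  rw [show 3 * √π - 0 - 2 * 0 = 3 * √π by ring] at hlow
  have hA : ∀ n, Integrable (valA (n := n)) (normalPi n) := fun n =>
    integrable_of_mem measurable_valA valA_mem
  have hY : ∀ n, Integrable (fun z : Fin n → ℝ => ∑ j ∈ Finset.Icc 3 n,
      edgeProb (ordStat z 1) (ordStat z 2) (ordStat z j)) (normalPi n) := fun n =>
    integrable_finsetSum _ fun j _ =>
      integrable_of_mem (measurable_edgeProb_ordStat 2 j) fun z => edgeProb_mem _ _ _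
  refine tendsto_of_tendsto_of_tendsto_of_le_of_le' hlow hup ?_ ?_
  · filter_upwards [eventually_one_le_minScale, eventually_gt_atTop 0] with n hL hn
    have h := integral_mono ((hY n).sub (integrable_sq.const_mul 2)) (hA n) le_valA
    rw [integral_sub' (hY n) (integrable_sq.const_mul 2), integral_const_mul] at h
    have h1 := le_integral_sum_pair_two hn
    have hL0 : 0 ≤ n * minScale n := by positivity
    have h2 := mul_le_mul_of_nonneg_left ((sub_le_sub_right h1 _).trans h) hL0
    refine le_trans (le_of_eq ?_) h2
    rw [rpow_one, secondMoment]
    simp only [mul_zero, zero_add, pow_one]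
    ring
  · filter_upwards [eventually_one_le_minScale, eventually_gt_atTop 0] with n hL hn
    have h := (integral_mono (hA n) (hY n) valA_le).trans (integral_sum_pair_two_le hn)
    simp only [mul_zero, zero_add, pow_one]
    gcongr

/-- The same sandwich with `m = 1`. The correction now has order two, which is admissible only for
the cut weight. -/
theorem tendsto_integral_valB : Tendsto (fun n : ℕ => n * minScale n ^ 3 *
    ∫ z, valB z ∂(normalPi n)) atTop (𝓝 (18 * √π)) := by
  have hw : IsGapWeight 1 fullWeight := isGapWeight_fullWeight (by norm_num)
  have hc : IsGapWeight 1 cutWeight := isGapWeight_cutWeight (by norm_num)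
  have hc1 : IsGapWeight 2 cutWeight := isGapWeight_cutWeight (by norm_num)
  have hup := tendsto_descFactorial_mul_gapMean hw 4
  have hlow := ((tendsto_descFactorial_mul_gapMean hc 4).sub
    (tendsto_descFactorial_mul_gapMean_succ hc1 5)).sub
    ((tendsto_mul_secondMoment 3).const_mul 3)
  have hC : (2 * ((2 * 1 + 1).factorial : ℝ) / 2 ^ (2 * 1 + 2) * √π * ((1 + 3).factorial : ℝ)) =
      18 * √π := by norm_num [Nat.factorial]; ring
  rw [hC] at hup hlow
  rw [show 18 * √π - 0 - 3 * 0 = 18 * √π by ring] at hlow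
  have hB : ∀ n, Integrable (valB (n := n)) (normalPi n) := fun n =>
    integrable_of_mem measurable_valB valB_mem
  have hY : ∀ n, Integrable (fun z : Fin n → ℝ => ∑ j ∈ Finset.Ioc 3 n,
      edgeProb (ordStat z 1) (ordStat z 3) (ordStat z j)) (normalPi n) := fun n =>
    integrable_finsetSum _ fun j _ =>
      integrable_of_mem (measurable_edgeProb_ordStat 3 j) fun z => edgeProb_mem _ _ _
  have hY' : ∀ n, Integrable (fun z : Fin n → ℝ => ∑ i ∈ Finset.Icc 3 n, ∑ j ∈ Finset.Ioc i n,
      edgeProb (ordStat z 1) (ordStat z i) (ordStat z j)) (normalPi n) := fun n =>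
    integrable_finsetSum _ fun i _ => integrable_finsetSum _ fun j _ =>
      integrable_of_mem (measurable_edgeProb_ordStat i j) fun z => edgeProb_mem _ _ _
  refine tendsto_of_tendsto_of_tendsto_of_le_of_le' hlow hup ?_ ?_
  · filter_upwards [eventually_one_le_minScale, eventually_ge_atTop 3] with n hL hn
    have h := integral_mono ((hY n).sub (integrable_sq.const_mul 3)) (hB n)
      fun z => le_valB z hn
    rw [integral_sub' (hY n) (integrable_sq.const_mul 3), integral_const_mul] at h
    have h1 := le_integral_sum_pair_three (show 0 < n by omega)
    have hL0 : 0 ≤ n * minScale n ^ 3 := by positivity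
    have h2 := mul_le_mul_of_nonneg_left ((sub_le_sub_right h1 _).trans h) hL0
    refine le_trans (le_of_eq ?_) h2
    have e : minScale n ^ (3 : ℝ) = minScale n ^ 3 := by norm_cast
    rw [e, secondMoment]
    norm_num
    ring
  · filter_upwards [eventually_one_le_minScale, eventually_gt_atTop 0] with n hL hn
    have h := (integral_mono (hB n) (hY' n) valB_le).trans (integral_sum_pair_ge_three_le hn)
    change n * minScale n ^ 3 * _ ≤ n * minScale n ^ 3 * (n.descFactorial 4 * gapMean 1 fullWeight (n - 4))
    gcongr

end ExpectationAsymptotics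

end StQP

namespace StQP
-- The terms of the theorem as Gaussian integrals over the diagonal.
section Terms
open Real

variable {n : ℕ} {Ω : Type*} [MeasurableSpace Ω] {P : Measure Ω} [IsProbabilityMeasure P]
  {Q : Ω → Matrix (Fin n) (Fin n) ℝ}

lemma IsGOE.aemeasurable_apply (hQ : IsGOE P Q) (p : {p : Fin n × Fin n // p.1 ≤ p.2}) :
    AEMeasurable (fun ω => Q ω p.1.1 p.1.2) P := by
  obtain ⟨⟨i, j⟩, h⟩ := p
  rcases eq_or_lt_of_le (show i ≤ j from h) with rfl | h'
  · exact (hQ.diag i).aemeasurable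
  · exact (hQ.offDiag i j h').aemeasurable

lemma IsGOE.aemeasurable_diag (hQ : IsGOE P Q) : AEMeasurable (fun ω => (Q ω).diag) P :=
  aemeasurable_pi_lambda _ fun i => (hQ.diag i).aemeasurable

lemma IsGOE.map_diag (hQ : IsGOE P Q) : P.map (fun ω => (Q ω).diag) = normalPi n := by
  have hinj : Function.Injective
      fun i : Fin n => (⟨(i, i), le_rfl⟩ : {p : Fin n × Fin n // p.1 ≤ p.2}) :=
    fun i j h => congrArg (fun p => p.1.1) h
  have h := (iIndepFun_iff_map_fun_eq_pi_map fun i => (hQ.diag i).aemeasurable).1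
    (hQ.indep.precomp hinj)
  simp only [(hQ.diag _).map_eq] at h
  exact h

lemma IsGOE.integral_diag (hQ : IsGOE P Q) {f : (Fin n → ℝ) → ℝ} (hf : Measurable f) :
    ∫ ω, f (Q ω).diag ∂P = ∫ z, f z ∂(normalPi n) := by
  rw [← hQ.map_diag, integral_map hQ.aemeasurable_diag hf.aestronglyMeasurable]

/-- `diagOrderStat A r` unfolds to `ordStat A.diag r`, so the integrand is by definition `valS` of
the diagonal. The same holds for the next two terms. -/
lemma IsGOE.termS_eq (hQ : IsGOE P Q) : termS P Q = ∫ z, valS z ∂(normalPi n) :=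
  hQ.integral_diag measurable_valS

lemma IsGOE.termA_eq (hQ : IsGOE P Q) : termA P Q = ∫ z, valA z ∂(normalPi n) :=
  hQ.integral_diag measurable_valA

lemma IsGOE.termB_eq (hQ : IsGOE P Q) : termB P Q = ∫ z, valB z ∂(normalPi n) :=
  hQ.integral_diag measurable_valB

lemma minScale_eq (n : ℕ) : minScale n = √2 * √(log n) := by
  rw [minScale, sqrt_mul zero_le_two]

lemma sqrt_log_ne_zero {n : ℕ} (h : 1 ≤ minScale n) : √(log n) ≠ 0 := by
  intro h0
  rw [minScale_eq, h0] at h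
  norm_num at h

lemma isEquivalent_of_tendsto_mul {f g : ℕ → ℝ} {a : ℝ} {u : ℕ → ℝ}
    (hf : Tendsto (fun n => u n * f n) atTop (𝓝 a)) (ha : a ≠ 0)
    (hg : ∀ᶠ n in atTop, u n ≠ 0 ∧ g n = a * (u n)⁻¹) : f ~[atTop] g := by
  refine isEquivalent_of_tendsto_one ?_
  have h := hf.const_mul a⁻¹
  rw [inv_mul_cancel₀ ha] at h
  refine h.congr' ?_
  filter_upwards [hg] with n hn
  simp only [Pi.div_apply, hn.2]
  have := hn.1
  field_simp

lemma isEquivalent_integral_valS : (fun n : ℕ => ∫ z, valS z ∂(normalPi n)) ~[atTop]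
    fun n : ℕ => 2 * √(2 * π) * (√(log n) / n) := by
  refine isEquivalent_of_tendsto_mul tendsto_integral_valS (by positivity) ?_
  filter_upwards [eventually_one_le_minScale, eventually_gt_atTop 0] with n hL hn
  refine ⟨by positivity, ?_⟩
  have := sqrt_log_ne_zero hL
  rw [minScale_eq, sqrt_mul zero_le_two]
  field_simp

lemma isEquivalent_integral_valA : (fun n : ℕ => ∫ z, valA z ∂(normalPi n)) ~[atTop]
    fun n : ℕ => 3 * √(π / 2) * (1 / (n * √(log n))) := by
  refine isEquivalent_of_tendsto_mul tendsto_integral_valA (by positivity) ?_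
  filter_upwards [eventually_one_le_minScale, eventually_gt_atTop 0] with n hL hn
  refine ⟨by positivity, ?_⟩
  have := sqrt_log_ne_zero hL
  rw [minScale_eq, sqrt_div pi_pos.le]
  field_simp

lemma isEquivalent_integral_valB : (fun n : ℕ => ∫ z, valB z ∂(normalPi n)) ~[atTop]
    fun n : ℕ => 9 * √(π / 2) * (1 / (n * log n ^ (3 / 2 : ℝ))) := by
  refine isEquivalent_of_tendsto_mul tendsto_integral_valB (by positivity) ?_
  filter_upwards [eventually_one_le_minScale, eventually_gt_atTop 0] with n hL hn
  refine ⟨by positivity, ?_⟩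
  have h0 := sqrt_log_ne_zero hL
  have hl : 0 ≤ log n := log_natCast_nonneg n
  have e : log n ^ (3 / 2 : ℝ) = √(log n) ^ 3 := by
    rw [sqrt_eq_rpow, ← rpow_natCast, ← rpow_mul hl]; norm_num
  have e2 : √2 ^ 3 = 2 * √2 := by
    rw [pow_succ, sq_sqrt zero_le_two]
  rw [minScale_eq, sqrt_div pi_pos.le, e, mul_pow, e2]
  field_simp
  norm_num

lemma tendsto_zero_of_le_term {f : ℕ → ℝ}
    (hf : Tendsto (fun n : ℕ => n * minScale n ^ 3 * f n) atTop (𝓝 0)) :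
    f =o[atTop] fun n : ℕ => ∫ z, valB z ∂(normalPi n) := by
  have h := hf.div tendsto_integral_valB (by positivity)
  rw [zero_div] at h
  have hB := tendsto_integral_valB.eventually_ne (show 18 * √π ≠ 0 by positivity)
  refine (isLittleO_iff_tendsto' ?_).2 (h.congr' ?_)
  · filter_upwards [hB] with n hn h0
    simp [h0] at hn
  · filter_upwards [eventually_one_le_minScale, eventually_gt_atTop 0] with n hL hn
    simp only [Pi.div_apply]
    exact mul_div_mul_left _ _ (by positivity)

end Terms
end StQP

namespace StQP
-- Optimality conditions, and edges with a value below the diagonal minimum.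
section Simplex
open Real

variable {n : ℕ} {A : Matrix (Fin n) (Fin n) ℝ} {x y : Fin n → ℝ}

lemma dotProduct_mulVec_comm (hA : A.IsSymm) (x y : Fin n → ℝ) :
    x ⬝ᵥ A *ᵥ y = y ⬝ᵥ A *ᵥ x := by
  rw [Matrix.dotProduct_mulVec, ← Matrix.mulVec_transpose, hA.eq, dotProduct_comm]

lemma quadForm_add_smul (hA : A.IsSymm) (a b : ℝ) (x y : Fin n → ℝ) :
    (a • x + b • y) ⬝ᵥ A *ᵥ (a • x + b • y) =
      a ^ 2 * (x ⬝ᵥ A *ᵥ x) + 2 * a * b * (y ⬝ᵥ A *ᵥ x) + b ^ 2 * (y ⬝ᵥ A *ᵥ y) := by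
  simp only [Matrix.mulVec_add, Matrix.mulVec_smul, add_dotProduct, dotProduct_add, smul_dotProduct,
    dotProduct_smul, smul_eq_mul, dotProduct_mulVec_comm hA x y]
  ring

lemma single_quadForm (A : Matrix (Fin n) (Fin n) ℝ) (i : Fin n) :
    Pi.single i 1 ⬝ᵥ A *ᵥ Pi.single i 1 = A i i := by
  simp

lemma IsMinimizer.quadForm_le_apply (h : IsMinimizer A x) (i : Fin n) :
    x ⬝ᵥ A *ᵥ x ≤ A i i := by
  have := h.2 _ (single_mem_stdSimplex ℝ i)
  rwa [single_quadForm] at this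

/-- First-order optimality. Moving by `t` towards the vertex `i` changes the value by `t (t K - 2 (l
- g))`. The chosen `t` keeps `t |K| ≤ l - g`, so the change would be negative if `g < l`. -/
lemma IsMinimizer.quadForm_le_mulVec (hA : A.IsSymm) (h : IsMinimizer A x) (i : Fin n) :
    x ⬝ᵥ A *ᵥ x ≤ (A *ᵥ x) i := by
  by_contra! hlt
  set l := x ⬝ᵥ A *ᵥ x
  set g := (A *ᵥ x) i
  set K := l - 2 * g + A i i
  have hd : 0 < l - g := by linarith
  have hK := abs_nonneg K
  set t := (l - g) / (l - g + |K|) with ht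
  have ht0 : 0 < t := by positivity
  have ht1 : t ≤ 1 := by rw [ht, div_le_one (by positivity)]; linarith
  have hmem : (1 - t) • x + t • Pi.single i 1 ∈ stdSimplex ℝ (Fin n) :=
    convex_stdSimplex ℝ _ h.1 (single_mem_stdSimplex ℝ i) (by linarith) ht0.le (by ring)
  have hq := h.2 _ hmem
  rw [quadForm_add_smul hA, single_quadForm, single_dotProduct, one_mul] at hq
  change l ≤ (1 - t) ^ 2 * l + 2 * (1 - t) * t * g + t ^ 2 * A i i at hq
  have h1 : 0 ≤ t * (t * K - 2 * (l - g)) := by simp only [K]; linarith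
  have h2 : 0 ≤ t * K - 2 * (l - g) := nonneg_of_mul_nonneg_right h1 ht0
  have h3 : t * |K| ≤ l - g := by
    rw [ht, div_mul_eq_mul_div, div_le_iff₀ (by positivity)]
    nlinarith
  have h4 := mul_le_mul_of_nonneg_left (le_abs_self K) ht0.le
  linarith

/-- Complementary slackness: the excesses `(A x)_j - xᵀ A x` are nonnegative and their average with
weights `x j` is zero. -/
lemma IsMinimizer.mulVec_eq (hA : A.IsSymm) (h : IsMinimizer A x) {i : Fin n} (hi : 0 < x i) :
    (A *ᵥ x) i = x ⬝ᵥ A *ᵥ x := by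
  have hs : ∑ j, x j * ((A *ᵥ x) j - x ⬝ᵥ A *ᵥ x) = 0 := by
    simp only [mul_sub, Finset.sum_sub_distrib, ← Finset.sum_mul, h.1.2, one_mul]
    exact sub_self _
  have hz := (Finset.sum_eq_zero_iff_of_nonneg fun j _ =>
    mul_nonneg (h.1.1 j) (sub_nonneg.2 (h.quadForm_le_mulVec hA j))).1 hs i (Finset.mem_univ _)
  rcases mul_eq_zero.1 hz with h0 | h0
  · exact absurd h0 hi.ne'
  · linarith

lemma kappa_eq (hu : ∃! x, IsMinimizer A x) (hx : IsMinimizer A x) :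
    kappa A = {i | 0 < x i}.ncard := by
  rw [kappa, dif_pos hu, hu.unique hu.exists.choose_spec hx]

lemma exists_pos_of_mem_stdSimplex (hx : x ∈ stdSimplex ℝ (Fin n)) : ∃ i, 0 < x i := by
  by_contra! h
  have := Finset.sum_nonpos fun i (_ : i ∈ Finset.univ) => h i
  rw [hx.2] at this
  linarith

lemma kappa_pos (hu : ∃! x, IsMinimizer A x) : 0 < kappa A := by
  obtain ⟨x, hx, -⟩ := id hu
  rw [kappa_eq hu hx, Set.ncard_pos]
  exact exists_pos_of_mem_stdSimplex hx.1

lemma eq_single_of_support (hx : x ∈ stdSimplex ℝ (Fin n)) {k : Fin n}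
    (hk : ∀ i, i ≠ k → ¬ 0 < x i) : x = Pi.single k 1 := by
  have h0 : ∀ i, i ≠ k → x i = 0 := fun i hi => le_antisymm (not_lt.1 (hk i hi)) (hx.1 i)
  have hsum := hx.2
  rw [Finset.sum_eq_single k (fun i _ hi => h0 i hi) (by simp)] at hsum
  funext i
  by_cases hi : i = k
  · subst hi; simpa using hsum
  · rw [h0 i hi, Pi.single_eq_of_ne hi]

lemma kappa_eq_one_iff (hu : ∃! x, IsMinimizer A x) : kappa A = 1 ↔ MinDiagVertexOptimal A := by
  constructor
  · intro h
    obtain ⟨x, hx, -⟩ := id hu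
    rw [kappa_eq hu hx, Set.ncard_eq_one] at h
    obtain ⟨k, hk⟩ := h
    have hxk : x = Pi.single k 1 := eq_single_of_support hx.1 fun i hi h => hi <| by
      have : i ∈ ({k} : Set (Fin n)) := hk ▸ h
      exact this
    subst hxk
    refine ⟨k, fun j => ?_, hx⟩
    rw [← single_quadForm A k]
    exact hx.quadForm_le_apply j
  · rintro ⟨i, -, hi⟩
    rw [kappa_eq hu hi, Set.ncard_eq_one]
    refine ⟨i, Set.ext fun j => ?_⟩
    by_cases h : j = i
    · subst h; simp
    · simp [h]

/-- Some off-diagonal entry is so small that its edge of the simplex carries a value below `m`. -/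
def SomeEdgeBelow (A : Matrix (Fin n) (Fin n) ℝ) (m : ℝ) : Prop :=
  ∃ i j, i < j ∧ A i j < m - √((A i i - m) * (A j j - m))

lemma SomeEdgeBelow.exists_quadForm_lt (hA : A.IsSymm) {m : ℝ} (hm : ∀ i, m ≤ A i i)
    (h : SomeEdgeBelow A m) : ∃ y ∈ stdSimplex ℝ (Fin n), y ⬝ᵥ A *ᵥ y < m := by
  obtain ⟨i, j, -, hlt⟩ := h
  rw [sqrt_mul (sub_nonneg.2 (hm i))] at hlt
  set u := √(A i i - m) with hu
  set v := √(A j j - m) with hv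
  have hu2 : A i i = m + u ^ 2 := by rw [hu, sq_sqrt (sub_nonneg.2 (hm i))]; ring
  have hv2 : A j j = m + v ^ 2 := by rw [hv, sq_sqrt (sub_nonneg.2 (hm j))]; ring
  have hu0 : 0 ≤ u := sqrt_nonneg _
  have hv0 : 0 ≤ v := sqrt_nonneg _
  set d := m - u * v - A i j with hd
  have hd0 : 0 < d := by linarith
  -- Weights proportional to `(v, u)` would kill the square `(a u - b v)²`. They are undefined for
  -- `u = v = 0` and give a mere vertex if just one vanishes, so both are shifted by `ε`. The square
  -- becomes of order `ε² (u - v)²`, and this `ε` makes it smaller than `2 d (u + ε) (v + ε)`.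
  set ε := 2 * d / (u + v + 1) with hε
  have hε0 : 0 < ε := by positivity
  have hε1 : ε * (u + v) ≤ 2 * d := by
    rw [hε, div_mul_eq_mul_div, div_le_iff₀ (by positivity)]
    nlinarith
  have hw : 0 < u + v + 2 * ε := by positivity
  refine ⟨((v + ε) / (u + v + 2 * ε)) • Pi.single i 1 + ((u + ε) / (u + v + 2 * ε)) • Pi.single j 1,
    convex_stdSimplex ℝ _ (single_mem_stdSimplex ℝ i) (single_mem_stdSimplex ℝ j) (by positivity)
      (by positivity) (by field_simp; ring), ?_⟩
  rw [quadForm_add_smul hA, single_quadForm, single_quadForm]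
  have hij : Pi.single j 1 ⬝ᵥ A *ᵥ Pi.single i 1 = A i j := by
    simp [hA.apply i j]
  have hAij : A i j = m - u * v - d := by rw [hd]; ring
  rw [hij, hu2, hv2, hAij]
  have key : ε * (u - v) ^ 2 < 2 * d * (u + v + ε) := by
    have h1 : ε * (u - v) ^ 2 ≤ ε * (u + v) * (u + v) := by nlinarith [mul_nonneg hu0 hv0]
    have h2 := mul_le_mul_of_nonneg_right hε1 (add_nonneg hu0 hv0)
    nlinarith [mul_pos hd0 hε0]
  have e : ((v + ε) / (u + v + 2 * ε)) ^ 2 * (m + u ^ 2) +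
      2 * ((v + ε) / (u + v + 2 * ε)) * ((u + ε) / (u + v + 2 * ε)) * (m - u * v - d) +
      ((u + ε) / (u + v + 2 * ε)) ^ 2 * (m + v ^ 2) = m +
      (ε ^ 2 * (u - v) ^ 2 - 2 * d * (u + ε) * (v + ε)) / (u + v + 2 * ε) ^ 2 := by
    field_simp
    ring
  rw [e]
  have : (ε ^ 2 * (u - v) ^ 2 - 2 * d * (u + ε) * (v + ε)) / (u + v + 2 * ε) ^ 2 < 0 := by
    refine div_neg_of_neg_of_pos ?_ (by positivity)
    have := mul_lt_mul_of_pos_left key hε0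
    nlinarith [mul_nonneg hd0.le (mul_nonneg hu0 hv0)]
  linarith

lemma SomeEdgeBelow.one_lt_kappa (hA : A.IsSymm) {m : ℝ} (hm : ∀ i, m ≤ A i i)
    (h : SomeEdgeBelow A m) (hu : ∃! x, IsMinimizer A x) : 1 < kappa A := by
  refine lt_of_le_of_ne (kappa_pos hu) fun h1 => ?_
  obtain ⟨i, -, hi⟩ := (kappa_eq_one_iff hu).1 h1.symm
  obtain ⟨y, hy, hlt⟩ := h.exists_quadForm_lt hA hm
  have := hi.2 y hy
  rw [single_quadForm] at this
  linarith [hm i]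

lemma someEdgeBelow_of_kappa_eq_two (hA : A.IsSymm) {m : ℝ} {k : Fin n} (hk : A k k = m)
    (hm : ∀ i, m ≤ A i i) (hu : ∃! x, IsMinimizer A x) (h2 : kappa A = 2) :
    SomeEdgeBelow A m := by
  obtain ⟨x, hx, -⟩ := id hu
  have hlt : x ⬝ᵥ A *ᵥ x < m := by
    -- If the minimum were equal to `m`, the vertex `k` would be a minimizer and `κ` would be one.
    refine lt_of_le_of_ne (hk ▸ hx.quadForm_le_apply k) fun he => ?_
    have : kappa A = 1 := (kappa_eq_one_iff hu).2 ⟨k, fun j => hk ▸ hm j,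
      single_mem_stdSimplex ℝ k, fun y hy => by
        rw [single_quadForm, hk, ← he]; exact hx.2 y hy⟩
    omega
  rw [kappa_eq hu hx, Set.ncard_eq_two] at h2
  obtain ⟨i, j, hij, hS⟩ := h2
  have hpos : ∀ a, 0 < x a ↔ a = i ∨ a = j := fun a => by
    change a ∈ {i | 0 < x i} ↔ _
    rw [hS]; simp
  have h0 : ∀ a, a ≠ i → a ≠ j → x a = 0 := fun a h1 h2 =>
    le_antisymm (not_lt.1 fun h => ((hpos a).1 h).elim h1 h2) (hx.1.1 a)
  have hxe : x = x i • Pi.single i 1 + x j • Pi.single j 1 := by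
    funext a
    by_cases h1 : a = i
    · subst h1; simp [hij]
    by_cases h2 : a = j
    · subst h2; simp [h1]
    simp [h1, h2, h0 a h1 h2]
  have hsum : x i + x j = 1 := by
    rw [← hx.1.2, ← Finset.sum_pair hij]
    exact Finset.sum_subset (Finset.subset_univ _) fun a _ ha => by
      simp only [Finset.mem_insert, Finset.mem_singleton, not_or] at ha
      exact h0 a ha.1 ha.2
  have hxi := (hpos i).2 (Or.inl rfl)
  have hxj := (hpos j).2 (Or.inr rfl)
  have hAij : Pi.single j 1 ⬝ᵥ A *ᵥ Pi.single i 1 = A i j := by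
    simp [hA.apply i j]
  rw [hxe, quadForm_add_smul hA, single_quadForm, single_quadForm, hAij] at hlt
  have key : A i j < m - √((A i i - m) * (A j j - m)) := by
    rw [sqrt_mul (sub_nonneg.2 (hm i))]
    set u := √(A i i - m) with hu
    set v := √(A j j - m) with hv
    have hu2 : A i i = m + u ^ 2 := by rw [hu, sq_sqrt (sub_nonneg.2 (hm i))]; ring
    have hv2 : A j j = m + v ^ 2 := by rw [hv, sq_sqrt (sub_nonneg.2 (hm j))]; ring
    rw [hu2, hv2] at hlt
    have hm2 : m = (x i + x j) ^ 2 * m := by rw [hsum]; ring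
    -- The value minus `m` is `(x i * u - x j * v)² + 2 * x i * x j * (A i j - m + u * v)`. It is
    -- negative, so the second term must be.
    have h1 : x i * x j * (A i j - m + u * v) < 0 := by
      nlinarith [sq_nonneg (x i * u - x j * v)]
    have h2 : A i j - m + u * v < 0 := by
      by_contra! h
      exact absurd h1 (not_lt.2 (mul_nonneg (mul_pos hxi hxj).le h))
    linarith
  rcases lt_or_gt_of_ne hij with h | h
  · exact ⟨i, j, h, key⟩
  · exact ⟨j, i, h, by rwa [hA.apply i j, mul_comm]⟩

end Simplex
end StQP

namespace StQP
-- Entries forced by a minimizer with support of size at least three.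
section LargeSupport
open Real

variable {n : ℕ} {A : Matrix (Fin n) (Fin n) ℝ} {x : Fin n → ℝ} {r : ℝ}

/-- The entry `A i j` is at most `-1.12 r`, or it is at most `-r` and `A i i` is at
most `-0.75 r`. -/
def HeavyPair (A : Matrix (Fin n) (Fin n) ℝ) (r : ℝ) (i j : Fin n) : Prop :=
  A i j ≤ -(1.12 * r) ∨ (A i j ≤ -r ∧ A i i ≤ -(0.75 * r))

/-- One of the configurations of very negative entries forced by a minimizer with support of
size at least three. -/
def BadConfiguration (A : Matrix (Fin n) (Fin n) ℝ) (r : ℝ) : Prop :=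
  (∃ i j k l, i ≠ j ∧ i ≠ k ∧ i ≠ l ∧ j ≠ k ∧ j ≠ l ∧ k ≠ l ∧
    A i j ≤ -r ∧ A i k ≤ -r ∧ A i l ≤ -r) ∨
  (∃ i j l, i ≠ j ∧ i ≠ l ∧ j ≠ l ∧ HeavyPair A r i j ∧ (A i l ≤ -r ∨ A j l ≤ -r)) ∨
  ∃ i j k l, i ≠ j ∧ i ≠ k ∧ i ≠ l ∧ j ≠ k ∧ j ≠ l ∧ k ≠ l ∧ HeavyPair A r i j ∧ HeavyPair A r k l

/-- The indices in the support of `x`, other than `i`, at which row `i` of `A` is at most `-r`. -/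
noncomputable def lowNeighbors (A : Matrix (Fin n) (Fin n) ℝ) (x : Fin n → ℝ) (r : ℝ) (i : Fin n) :
    Finset (Fin n) :=
  {j | j ≠ i ∧ 0 < x j ∧ A i j ≤ -r}

lemma mem_lowNeighbors {i j : Fin n} :
    j ∈ lowNeighbors A x r i ↔ j ≠ i ∧ 0 < x j ∧ A i j ≤ -r := by
  simp [lowNeighbors]

/-- On the support, the row average `∑ j, A i j * x j` equals the minimal value. The diagonal entry
is at least that value, so if all other entries in the support exceeded `-r`, the average would be
too large. -/
lemma IsMinimizer.lowNeighbors_nonempty (hA : A.IsSymm) (h : IsMinimizer A x)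
    (hr : x ⬝ᵥ A *ᵥ x ≤ -r) {i k : Fin n} (hi : 0 < x i) (hk : 0 < x k) (hik : k ≠ i) :
    (lowNeighbors A x r i).Nonempty := by
  by_contra hne
  rw [Finset.not_nonempty_iff_eq_empty] at hne
  have hgt : ∀ j, j ≠ i → 0 < x j → -r < A i j := fun j hj hxj => by
    by_contra! hle
    have : j ∈ lowNeighbors A x r i := mem_lowNeighbors.2 ⟨hj, hxj, hle⟩
    simp [hne] at this
  have hlt : ∑ j, (x ⬝ᵥ A *ᵥ x) * x j < ∑ j, A i j * x j := by
    refine Finset.sum_lt_sum (fun j _ => ?_) ⟨k, Finset.mem_univ _, ?_⟩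
    · by_cases hj : j = i
      · subst hj
        exact mul_le_mul_of_nonneg_right (h.quadForm_le_apply j) (h.1.1 j)
      rcases (h.1.1 j).eq_or_lt with h0 | h0
      · change (0 : ℝ) = x j at h0
        simp [← h0]
      · exact mul_le_mul_of_nonneg_right (hr.trans (hgt j hj h0).le) h0.le
    · exact mul_lt_mul_of_pos_right (hr.trans_lt (hgt k hik hk)) hk
  rw [← Finset.mul_sum, h.1.2, mul_one, ← h.mulVec_eq hA hi] at hlt
  exact lt_irrefl _ hlt

/-- Otherwise the diagonal raises the row average above `-r` by at least `0.25 r x_i`, while at most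
two low neighbors lower it by at most `0.12 r x_i` each, because `x_i` is maximal among them. As `2
* 0.12 < 0.25`, the average would exceed `-r`. The constants must also make a heavy pair cost more
than `exp (-(5/4) r²)`. -/
lemma IsMinimizer.exists_heavyPair (hA : A.IsSymm) (h : IsMinimizer A x) (hr0 : 0 < r)
    (hr : x ⬝ᵥ A *ᵥ x ≤ -r) {i : Fin n} (hi : 0 < x i) (hne : (lowNeighbors A x r i).Nonempty)
    (hcard : (lowNeighbors A x r i).card ≤ 2) (hmax : ∀ j ∈ lowNeighbors A x r i, x j ≤ x i) :
    ∃ j ∈ lowNeighbors A x r i, HeavyPair A r i j := by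
  by_contra! hno
  have hlow : ∀ j ∈ lowNeighbors A x r i, -(1.12 * r) < A i j := fun j hj => by
    by_contra! hle
    exact hno j hj (Or.inl hle)
  have hdiag : -(0.75 * r) < A i i := by
    by_contra! hle
    obtain ⟨j, hj⟩ := hne
    exact hno j hj (Or.inr ⟨(mem_lowNeighbors.1 hj).2.2, hle⟩)
  have hle : ∀ j, -r * x j + (if j = i then 0.25 * r * x i else 0) +
      (if j ∈ lowNeighbors A x r i then -(0.12 * r * x i) else 0) ≤ A i j * x j := fun j => by
    have hx0 : 0 ≤ x j := h.1.1 j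
    by_cases hj : j = i
    · subst hj
      have : j ∉ lowNeighbors A x r j := fun hm => (mem_lowNeighbors.1 hm).1 rfl
      rw [if_pos rfl, if_neg this]
      nlinarith
    · rw [if_neg hj]
      by_cases hm : j ∈ lowNeighbors A x r i
      · rw [if_pos hm]
        have h1 := mul_le_mul_of_nonneg_right (hlow j hm).le hx0
        have h2 := mul_le_mul_of_nonneg_left (hmax j hm) hr0.le
        nlinarith
      · rw [if_neg hm, add_zero, add_zero]
        rcases hx0.eq_or_lt with h0 | h0
        · simp [← h0]
        refine mul_le_mul_of_nonneg_right ?_ hx0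
        by_contra! hlt
        exact hm (mem_lowNeighbors.2 ⟨hj, h0, hlt.le⟩)
  have hsum := Finset.sum_le_sum fun j (_ : j ∈ Finset.univ) => hle j
  rw [Finset.sum_add_distrib, Finset.sum_add_distrib, ← Finset.mul_sum, h.1.2,
    Finset.sum_ite_eq' _ i, if_pos (Finset.mem_univ _), ← Finset.sum_filter,
    Finset.filter_univ_mem, Finset.sum_const, nsmul_eq_mul] at hsum
  have hmul : ∑ j, A i j * x j = x ⬝ᵥ A *ᵥ x := h.mulVec_eq hA hi
  rw [hmul] at hsum
  have hc : ((lowNeighbors A x r i).card : ℝ) ≤ 2 := by exact_mod_cast hcard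
  have hrx := mul_pos hr0 hi
  have := mul_le_mul_of_nonneg_right hc hrx.le
  nlinarith

lemma badConfiguration_of_three_le_card {i : Fin n} (h : 3 ≤ (lowNeighbors A x r i).card) :
    BadConfiguration A r := by
  obtain ⟨j, k, l, hj, hk, hl, hjk, hjl, hkl⟩ := Finset.two_lt_card_iff.1 h
  rw [mem_lowNeighbors] at hj hk hl
  exact Or.inl ⟨i, j, k, l, hj.1.symm, hk.1.symm, hl.1.symm, hjk, hjl, hkl, hj.2.2, hk.2.2, hl.2.2⟩

/-- An index `i` with the largest weight has three low neighbors, or it has a heavy neighbor `j`. In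
the latter case take `c` of largest weight in the rest of the support. If `i` has another low
neighbor or `c` is low with `j`, a path appears. Otherwise the low neighbors of `c` avoid `i` and
`j`, so `c` dominates them and has three low neighbors or yields a second, disjoint heavy pair. -/
theorem IsMinimizer.badConfiguration (hA : A.IsSymm) (h : IsMinimizer A x) (hr0 : 0 < r)
    (hr : x ⬝ᵥ A *ᵥ x ≤ -r) (h3 : 2 < {i | 0 < x i}.ncard) : BadConfiguration A r := by
  set S : Finset (Fin n) := {i | 0 < x i} with hS
  have hmem : ∀ i, i ∈ S ↔ 0 < x i := fun i => by simp [hS]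
  have hcard : 2 < S.card := by
    rw [← Set.ncard_coe_finset]
    convert h3 using 2
    ext i
    simp [hS]
  obtain ⟨i, hiS, himax⟩ := S.exists_max_image x (Finset.card_pos.1 (by omega))
  have hi := (hmem i).1 hiS
  have hother : ∀ c ∈ S, ∃ k, 0 < x k ∧ k ≠ c := fun c _ => by
    obtain ⟨k, hk, hkc⟩ := S.exists_mem_ne (by omega) c
    exact ⟨k, (hmem k).1 hk, hkc⟩
  have hnon : ∀ c ∈ S, (lowNeighbors A x r c).Nonempty := fun c hc => by
    obtain ⟨k, hk, hkc⟩ := hother c hc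
    exact h.lowNeighbors_nonempty hA hr ((hmem c).1 hc) hk hkc
  by_cases hci : 3 ≤ (lowNeighbors A x r i).card
  · exact badConfiguration_of_three_le_card hci
  obtain ⟨j, hj, hheavy⟩ := h.exists_heavyPair hA hr0 hr hi (hnon i hiS) (by omega)
    fun j hj => himax j ((hmem j).2 (mem_lowNeighbors.1 hj).2.1)
  have hji := (mem_lowNeighbors.1 hj).1
  by_cases hpath : ∃ l, l ≠ j ∧ l ∈ lowNeighbors A x r i
  · obtain ⟨l, hlj, hl⟩ := hpath
    have hl' := mem_lowNeighbors.1 hl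
    exact Or.inr (Or.inl ⟨i, j, l, hji.symm, hl'.1.symm, hlj.symm, hheavy, Or.inl hl'.2.2⟩)
  push Not at hpath
  have hrest : ((S.erase i).erase j).Nonempty := by
    rw [← Finset.card_pos]
    have h1 := Finset.pred_card_le_card_erase (s := S) (a := i)
    have h2 := Finset.pred_card_le_card_erase (s := S.erase i) (a := j)
    omega
  obtain ⟨c, hc, hcmax⟩ := ((S.erase i).erase j).exists_max_image x hrest
  simp only [Finset.mem_erase] at hc hcmax
  obtain ⟨hcj, hci', hcS⟩ := hc
  have hxc := (hmem c).1 hcS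
  have hic : ¬ A c i ≤ -r := fun hle =>
    hpath c hcj (mem_lowNeighbors.2 ⟨hci', hxc, by rwa [hA.apply c i]⟩)
  by_cases hcj' : A c j ≤ -r
  · exact Or.inr (Or.inl ⟨i, j, c, hji.symm, hci'.symm, hcj.symm, hheavy,
      Or.inr (by rwa [hA.apply c j])⟩)
  by_cases hcc : 3 ≤ (lowNeighbors A x r c).card
  · exact badConfiguration_of_three_le_card hcc
  have hdis : ∀ l ∈ lowNeighbors A x r c, l ≠ i ∧ l ≠ j := fun l hl => by
    have hl' := mem_lowNeighbors.1 hl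
    exact ⟨fun e => hic (e ▸ hl'.2.2), fun e => hcj' (e ▸ hl'.2.2)⟩
  obtain ⟨l, hl, hheavy'⟩ := h.exists_heavyPair hA hr0 hr hxc (hnon c hcS) (by omega)
    fun l hl => hcmax l ⟨(hdis l hl).2, (hdis l hl).1, (hmem l).2 (mem_lowNeighbors.1 hl).2.1⟩
  exact Or.inr (Or.inr ⟨i, j, c, l, hji.symm, hci'.symm, (hdis l hl).1.symm, hcj.symm,
    (hdis l hl).2.symm, (mem_lowNeighbors.1 hl).1.symm, hheavy, hheavy'⟩)

end LargeSupport
end StQP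

namespace StQP
-- Almost sure uniqueness of the minimizer and measurability of its support size.
section Uniqueness
open Real
open Function (update)

variable {n : ℕ}

/-- The position on or above the diagonal that holds the entries `(i, j)` and `(j, i)`. -/
def triPos (i j : Fin n) : {p : Fin n × Fin n // p.1 ≤ p.2} := ⟨(min i j, max i j), min_le_max⟩

lemma triPos_eq_iff {i j k l : Fin n} :
    triPos i j = triPos k l ↔ (i = k ∧ j = l) ∨ (i = l ∧ j = k) := by
  simp only [triPos, Subtype.mk.injEq, Prod.mk.injEq]
  constructor
  · rintro ⟨h1, h2⟩
    rcases le_total i j with hij | hij <;> rcases le_total k l with hkl | hkl <;>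
      simp_all
  · rintro (⟨rfl, rfl⟩ | ⟨rfl, rfl⟩)
    · simp
    · simp [min_comm, max_comm]

/-- The symmetric matrix with the given entries on and above the diagonal. -/
def symMat (v : {p : Fin n × Fin n // p.1 ≤ p.2} → ℝ) : Matrix (Fin n) (Fin n) ℝ :=
  Matrix.of fun i j => v (triPos i j)

/-- The entries of a matrix on and above the diagonal. -/
def upperPart (A : Matrix (Fin n) (Fin n) ℝ) (p : {p : Fin n × Fin n // p.1 ≤ p.2}) : ℝ :=
  A p.1.1 p.1.2

lemma symMat_apply (v : {p : Fin n × Fin n // p.1 ≤ p.2} → ℝ) (i j : Fin n) :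
    symMat v i j = v (triPos i j) := rfl

lemma upperPart_triPos {A : Matrix (Fin n) (Fin n) ℝ} (hA : A.IsSymm) (i j : Fin n) :
    upperPart A (triPos i j) = A i j := by
  rcases le_total i j with h | h
  · simp [upperPart, triPos, h]
  · simp [upperPart, triPos, h, hA.apply i j]

lemma symMat_upperPart {A : Matrix (Fin n) (Fin n) ℝ} (hA : A.IsSymm) :
    symMat (upperPart A) = A := by
  ext i j
  exact upperPart_triPos hA i j

lemma quadForm_eq_sum (A : Matrix (Fin n) (Fin n) ℝ) (x : Fin n → ℝ) :
    x ⬝ᵥ A *ᵥ x = ∑ i, ∑ j, x i * x j * A i j := by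
  simp only [dotProduct, Matrix.mulVec, Finset.mul_sum]
  exact Finset.sum_congr rfl fun i _ => Finset.sum_congr rfl fun j _ => by ring

lemma exists_isMinimizer (hn : 1 ≤ n) (A : Matrix (Fin n) (Fin n) ℝ) : ∃ x, IsMinimizer A x := by
  have hcont : Continuous fun x : Fin n → ℝ => x ⬝ᵥ A *ᵥ x := by
    simp only [quadForm_eq_sum]
    fun_prop
  obtain ⟨x, hx, hmin⟩ := (isCompact_stdSimplex ℝ (Fin n)).exists_isMinOn
    ⟨_, single_mem_stdSimplex ℝ (⟨0, hn⟩ : Fin n)⟩ hcont.continuousOn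
  exact ⟨x, hx, fun y hy => hmin hy⟩

/-- The minimum over the simplex of the quadratic form with the given upper triangle. -/
noncomputable def simplexMin (v : {p : Fin n × Fin n // p.1 ≤ p.2} → ℝ) : ℝ :=
  sInf ((fun x => x ⬝ᵥ symMat v *ᵥ x) '' stdSimplex ℝ (Fin n))

lemma IsMinimizer.simplexMin_eq {v : {p : Fin n × Fin n // p.1 ≤ p.2} → ℝ} {x : Fin n → ℝ}
    (h : IsMinimizer (symMat v) x) : simplexMin v = x ⬝ᵥ symMat v *ᵥ x :=
  IsLeast.csInf_eq ⟨⟨x, h.1, rfl⟩, by rintro _ ⟨y, hy, rfl⟩; exact h.2 y hy⟩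

lemma simplexMin_le (hn : 1 ≤ n) (v : {p : Fin n × Fin n // p.1 ≤ p.2} → ℝ) {x : Fin n → ℝ}
    (hx : x ∈ stdSimplex ℝ (Fin n)) : simplexMin v ≤ x ⬝ᵥ symMat v *ᵥ x := by
  obtain ⟨y, hy⟩ := exists_isMinimizer hn (symMat v)
  exact hy.simplexMin_eq ▸ hy.2 x hx

/-- The coefficients `y i * y j` are nonnegative on the simplex. -/
lemma simplexMin_mono (hn : 1 ≤ n) {v w : {p : Fin n × Fin n // p.1 ≤ p.2} → ℝ} (h : v ≤ w) :
    simplexMin v ≤ simplexMin w := by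
  obtain ⟨y, hy⟩ := exists_isMinimizer hn (symMat w)
  rw [hy.simplexMin_eq]
  refine (simplexMin_le hn v hy.1).trans ?_
  rw [quadForm_eq_sum, quadForm_eq_sum]
  exact Finset.sum_le_sum fun i _ => Finset.sum_le_sum fun j _ =>
    mul_le_mul_of_nonneg_left (h _) (mul_nonneg (hy.1.1 i) (hy.1.1 j))

lemma simplexMin_le_add_dist (hn : 1 ≤ n) (v w : {p : Fin n × Fin n // p.1 ≤ p.2} → ℝ) :
    simplexMin v ≤ simplexMin w + dist v w := by
  obtain ⟨y, hy⟩ := exists_isMinimizer hn (symMat w)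
  rw [hy.simplexMin_eq]
  refine (simplexMin_le hn v hy.1).trans ?_
  have h1 : ∑ i, ∑ j, y i * y j * dist v w = dist v w := by
    simp only [← Finset.sum_mul, ← Finset.mul_sum, hy.1.2, mul_one, one_mul]
  rw [← h1, quadForm_eq_sum, quadForm_eq_sum, ← Finset.sum_add_distrib]
  refine Finset.sum_le_sum fun i _ => ?_
  rw [← Finset.sum_add_distrib]
  refine Finset.sum_le_sum fun j _ => ?_
  rw [← mul_add]
  refine mul_le_mul_of_nonneg_left ?_ (mul_nonneg (hy.1.1 i) (hy.1.1 j))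
  have h2 := (le_abs_self _).trans (dist_le_pi_dist v w (triPos i j))
  simp only [symMat_apply]
  linarith

lemma continuous_simplexMin (hn : 1 ≤ n) : Continuous (simplexMin (n := n)) := by
  refine (LipschitzWith.of_le_add fun v w => ?_ : LipschitzWith 1 (simplexMin (n := n))).continuous
  exact simplexMin_le_add_dist hn v w

lemma quadForm_symMat_update (v : {p : Fin n × Fin n // p.1 ≤ p.2} → ℝ) (i : Fin n) (s : ℝ)
    (x : Fin n → ℝ) :
    x ⬝ᵥ symMat (update v (triPos i i) s) *ᵥ x =
      x ⬝ᵥ symMat v *ᵥ x + (s - v (triPos i i)) * x i ^ 2 := by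
  have hentry : ∀ j k, x j * x k * symMat (update v (triPos i i) s) j k =
      x j * x k * symMat v j k +
        if j = i then (if k = i then (s - v (triPos i i)) * x i ^ 2 else 0) else 0 := by
    intro j k
    simp only [symMat_apply]
    by_cases h : j = i ∧ k = i
    · obtain ⟨rfl, rfl⟩ := h
      simp only [Function.update_self, if_pos]
      ring
    · have hne : triPos j k ≠ triPos i i := fun e => h (by simpa using triPos_eq_iff.1 e)
      rw [Function.update_of_ne hne, ← ite_and, if_neg h, add_zero]
  simp only [quadForm_eq_sum, hentry, Finset.sum_add_distrib]
  simp

/-- The envelope argument: a minimizer `x` gives an affine function of `s` with slope `x i ^ 2`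
lying above the minimum value and touching it at `s = v (triPos i i)`. Where the derivative exists,
it must equal that slope. -/
lemma IsMinimizer.deriv_simplexMin_update (hn : 1 ≤ n)
    {v : {p : Fin n × Fin n // p.1 ≤ p.2} → ℝ} {x : Fin n → ℝ} (h : IsMinimizer (symMat v) x)
    {i : Fin n} (hd : DifferentiableAt ℝ (fun s => simplexMin (update v (triPos i i) s))
      (v (triPos i i))) :
    deriv (fun s => simplexMin (update v (triPos i i) s)) (v (triPos i i)) = x i ^ 2 := by
  set g : ℝ → ℝ := fun s => simplexMin (update v (triPos i i) s)
  have hlin : HasDerivAt (fun s => simplexMin v + (s - v (triPos i i)) * x i ^ 2)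
      (1 * x i ^ 2) (v (triPos i i)) :=
    (((hasDerivAt_id _).sub_const _).mul_const _).const_add _
  have hmin : IsLocalMin (fun s => simplexMin v + (s - v (triPos i i)) * x i ^ 2 - g s)
      (v (triPos i i)) := by
    refine Eventually.of_forall fun s => ?_
    have h1 : g (v (triPos i i)) = simplexMin v := by
      simp only [g, Function.update_eq_self]
    have h2 := simplexMin_le hn (update v (triPos i i) s) h.1
    rw [quadForm_symMat_update, ← h.simplexMin_eq] at h2
    simp only [h1]
    simp only [g]
    linarith
  have := hmin.hasDerivAt_eq_zero (hlin.sub hd.hasDerivAt)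
  linarith

section Differentiable

variable {v : {p : Fin n × Fin n // p.1 ≤ p.2} → ℝ}

lemma existsUnique_isMinimizer_of_differentiableAt
    (hd : ∀ i, DifferentiableAt ℝ (fun s => simplexMin (update v (triPos i i) s)) (v (triPos i i)))
    (hn : 1 ≤ n) :
    ∃! x, IsMinimizer (symMat v) x := by
  obtain ⟨x, hx⟩ := exists_isMinimizer hn (symMat v)
  refine ⟨x, hx, fun y hy => funext fun i => ?_⟩
  have h := (hy.deriv_simplexMin_update hn (hd i)).symm.trans (hx.deriv_simplexMin_update hn (hd i))
  exact (pow_left_inj₀ (hy.1.1 i) (hx.1.1 i) two_ne_zero).1 h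

-- The support of the minimizer is read off from the derivatives, which are measurable in `v`. This
-- avoids any measurable selection of a minimizer.
open Classical in
lemma kappa_eq_card_of_differentiableAt
    (hd : ∀ i, DifferentiableAt ℝ (fun s => simplexMin (update v (triPos i i) s)) (v (triPos i i)))
    (hn : 1 ≤ n) : kappa (symMat v) = ∑ i, if 0 < deriv (fun s => simplexMin (update v (triPos i i) s)) (v (triPos i i))
      then 1 else 0 := by
  obtain ⟨x, hx, hu⟩ := existsUnique_isMinimizer_of_differentiableAt hd hn
  rw [kappa_eq ⟨x, hx, hu⟩ hx, Finset.sum_boole, Nat.cast_id, ← Set.ncard_coe_finset]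
  congr 1
  ext i
  simp only [Finset.coe_filter, Finset.mem_univ, true_and, Set.mem_ofPred_eq,
    hx.deriv_simplexMin_update hn (hd i)]
  exact ⟨fun h => pow_pos h 2, fun h => (hx.1.1 i).lt_of_ne fun h0 => by
    rw [← h0] at h; simp at h⟩

end Differentiable

/-- The variances of the entries on and above the diagonal. -/
noncomputable def goeVar (p : {p : Fin n × Fin n // p.1 ≤ p.2}) : ℝ≥0 :=
  if p.1.1 = p.1.2 then 1 else 1 / 2

lemma goeVar_ne_zero (p : {p : Fin n × Fin n // p.1 ≤ p.2}) : goeVar p ≠ 0 := by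
  rw [goeVar]; split <;> norm_num

lemma continuous_simplexMin_update (hn : 1 ≤ n) (p : {p : Fin n × Fin n // p.1 ≤ p.2}) :
    Continuous (Function.uncurry fun (v : {p : Fin n × Fin n // p.1 ≤ p.2} → ℝ) (s : ℝ) =>
      simplexMin (update v p s)) :=
  (continuous_simplexMin hn).comp (continuous_fst.update p continuous_snd)

lemma measurable_pair_apply (p : {p : Fin n × Fin n // p.1 ≤ p.2}) :
    Measurable fun v : {p : Fin n × Fin n // p.1 ≤ p.2} → ℝ => (v, v p) :=
  measurable_id.prodMk (measurable_pi_apply p)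

lemma measurableSet_differentiableAt_simplexMin (hn : 1 ≤ n)
    (p : {p : Fin n × Fin n // p.1 ≤ p.2}) :
    MeasurableSet {v : {p : Fin n × Fin n // p.1 ≤ p.2} → ℝ |
      DifferentiableAt ℝ (fun s => simplexMin (update v p s)) (v p)} :=
  measurable_pair_apply p
    (measurableSet_of_differentiableAt_with_param ℝ (continuous_simplexMin_update hn p))

lemma measurable_deriv_simplexMin (hn : 1 ≤ n) (p : {p : Fin n × Fin n // p.1 ≤ p.2}) :
    Measurable fun v : {p : Fin n × Fin n // p.1 ≤ p.2} → ℝ =>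
      deriv (fun s => simplexMin (update v p s)) (v p) := by
  have h := measurable_deriv_with_param (continuous_simplexMin_update hn p)
  have h2 := h.comp (measurable_pair_apply p)
  simpa only [Function.comp_def] using h2

/-- Along each coordinate line the minimum is monotone, hence differentiable almost everywhere by
Lebesgue's theorem. Resampling the coordinate `p` and Fubini transfer this to the product law. -/
lemma ae_differentiableAt_simplexMin (hn : 1 ≤ n) (p : {p : Fin n × Fin n // p.1 ≤ p.2}) :
    ∀ᵐ v ∂(Measure.pi fun q : {p : Fin n × Fin n // p.1 ≤ p.2} => gaussianReal 0 (goeVar q)),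
      DifferentiableAt ℝ (fun s => simplexMin (update v p s)) (v p) := by
  have hp := measurePreserving_update
    (fun q : {p : Fin n × Fin n // p.1 ≤ p.2} => gaussianReal 0 (goeVar q)) p
  have hS := measurableSet_differentiableAt_simplexMin hn p
  rw [← hp.map_eq, ae_map_iff hp.measurable.aemeasurable hS, ae_iff]
  refine (Measure.prod_apply_symm (hp.measurable hS).compl).trans ?_
  rw [lintegral_eq_zero_iff'
    (measurable_measure_prodMk_right (hp.measurable hS).compl).aemeasurable]
  refine ae_of_all _ fun w => ?_
  have hmono : Monotone fun s => simplexMin (update w p s) := fun s t hst =>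
    simplexMin_mono hn (update_le_update_iff.2 ⟨hst, fun _ _ => le_rfl⟩)
  have : ∀ᵐ s ∂(gaussianReal 0 (goeVar p)),
      DifferentiableAt ℝ (fun s => simplexMin (update w p s)) s :=
    (gaussianReal_absolutelyContinuous 0 (goeVar_ne_zero p)).ae_le hmono.ae_differentiableAt
  rw [ae_iff] at this
  refine Eq.trans (congrArg _ (Set.ext fun s => ?_)) this
  simp

lemma ae_forall_differentiableAt_simplexMin (hn : 1 ≤ n) :
    ∀ᵐ v ∂(Measure.pi fun q : {p : Fin n × Fin n // p.1 ≤ p.2} => gaussianReal 0 (goeVar q)),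
      ∀ i, DifferentiableAt ℝ (fun s => simplexMin (update v (triPos i i) s))
        (v (triPos i i)) :=
  ae_all_iff.2 fun _ => ae_differentiableAt_simplexMin hn _

variable {Ω : Type*} [MeasurableSpace Ω] {P : Measure Ω} [IsProbabilityMeasure P]
  {Q : Ω → Matrix (Fin n) (Fin n) ℝ}

lemma IsGOE.aemeasurable_upperPart (hQ : IsGOE P Q) : AEMeasurable (fun ω => upperPart (Q ω)) P :=
  aemeasurable_pi_lambda _ hQ.aemeasurable_apply

lemma IsGOE.map_apply (hQ : IsGOE P Q) (p : {p : Fin n × Fin n // p.1 ≤ p.2}) :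
    P.map (fun ω => Q ω p.1.1 p.1.2) = gaussianReal 0 (goeVar p) := by
  obtain ⟨⟨i, j⟩, h⟩ := p
  rcases eq_or_lt_of_le (show i ≤ j from h) with rfl | h'
  · simpa [goeVar] using (hQ.diag i).map_eq
  · simpa [goeVar, h'.ne] using (hQ.offDiag i j h').map_eq

lemma IsGOE.map_upperPart (hQ : IsGOE P Q) :
    P.map (fun ω => upperPart (Q ω)) = Measure.pi fun p => gaussianReal 0 (goeVar p) := by
  have h := (iIndepFun_iff_map_fun_eq_pi_map hQ.aemeasurable_apply).1 hQ.indep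
  simp only [hQ.map_apply] at h
  exact h

lemma IsGOE.ae_differentiableAt (hQ : IsGOE P Q) (hn : 1 ≤ n) : ∀ᵐ ω ∂P,
    ∀ i, DifferentiableAt ℝ (fun s => simplexMin (update (upperPart (Q ω)) (triPos i i) s))
        (upperPart (Q ω) (triPos i i)) :=
  ae_of_ae_map hQ.aemeasurable_upperPart <| by
    rw [hQ.map_upperPart]; exact ae_forall_differentiableAt_simplexMin hn

lemma IsGOE.ae_existsUnique (hQ : IsGOE P Q) (hn : 1 ≤ n) :
    ∀ᵐ ω ∂P, ∃! x, IsMinimizer (Q ω) x := by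
  filter_upwards [hQ.ae_differentiableAt hn] with ω hω
  have := existsUnique_isMinimizer_of_differentiableAt hω hn
  rwa [symMat_upperPart (hQ.symm ω)] at this

lemma IsGOE.aemeasurable_kappa (hQ : IsGOE P Q) : AEMeasurable (fun ω => kappa (Q ω)) P := by
  rcases Nat.eq_zero_or_pos n with rfl | hn
  · have : (fun ω => kappa (Q ω)) = fun _ => kappa 0 := funext fun ω => by
      rw [Subsingleton.elim (Q ω) 0]
    rw [this]
    exact aemeasurable_const
  classical
  have hm : Measurable fun v : {p : Fin n × Fin n // p.1 ≤ p.2} → ℝ =>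
      ∑ i, if 0 < deriv (fun s => simplexMin (update v (triPos i i) s)) (v (triPos i i))
        then 1 else 0 :=
    Finset.measurable_fun_sum _ fun i _ => Measurable.ite
      (measurableSet_lt measurable_const (measurable_deriv_simplexMin hn _)) measurable_const
        measurable_const
  refine (hm.comp_aemeasurable hQ.aemeasurable_upperPart).congr ?_
  filter_upwards [hQ.ae_differentiableAt hn] with ω hω
  have := kappa_eq_card_of_differentiableAt hω hn
  rw [symMat_upperPart (hQ.symm ω)] at this
  exact this.symm

end Uniqueness
end StQP

namespace StQP
-- Probability of a support of size at least three.
section RareEvents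
open Real

variable {n : ℕ} {Ω : Type*} [MeasurableSpace Ω] {P : Measure Ω} [IsProbabilityMeasure P]
  {Q : Ω → Matrix (Fin n) (Fin n) ℝ} {r : ℝ}

lemma measureReal_le_card_mul {ι : Type*} [Fintype ι] {s : ι → Set Ω} {t : Set Ω} {b : ℝ}
    (ht : t ⊆ ⋃ i, s i) (hs : ∀ i, P.real (s i) ≤ b) : P.real t ≤ Fintype.card ι * b := by
  refine (measureReal_mono ht).trans ((measureReal_iUnion_fintype_le s).trans ?_)
  refine (Finset.sum_le_card_nsmul _ _ b fun i _ => hs i).trans ?_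
  rw [nsmul_eq_mul, Finset.card_univ]

/-- Lets the union bounds run over all index tuples: those that violate the distinctness condition
`p` give the empty event. -/
lemma measureReal_le_of_imp {p : Prop} {s t : Set Ω} {b : ℝ} (hb : 0 ≤ b)
    (hst : ∀ ω ∈ s, p ∧ ω ∈ t) (ht : p → P.real t ≤ b) : P.real s ≤ b := by
  by_cases hp : p
  · exact (measureReal_mono fun ω hω => (hst ω hω).2).trans (ht hp)
  · have : s = ∅ := Set.eq_empty_of_forall_notMem fun ω hω => hp (hst ω hω).1
    simpa [this] using hb

lemma indepFun_measureReal_le {α β : Type*} [MeasurableSpace α] [MeasurableSpace β] {X : Ω → α}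
    {Y : Ω → β} (h : IndepFun X Y P) {s : Set α} {t : Set β} (hs : MeasurableSet s)
    (ht : MeasurableSet t) {a b : ℝ} (ha : P.real (X ⁻¹' s) ≤ a) (hb : P.real (Y ⁻¹' t) ≤ b) :
    P.real {ω | X ω ∈ s ∧ Y ω ∈ t} ≤ a * b := by
  have := h.measure_inter_preimage_eq_mul s t hs ht
  change P.real (X ⁻¹' s ∩ Y ⁻¹' t) ≤ _
  rw [measureReal_def, this, ENNReal.toReal_mul]
  exact mul_le_mul ha hb measureReal_nonneg (measureReal_nonneg.trans ha)

/-- The entry of the random matrix at a position on or above the diagonal. -/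
def entry (Q : Ω → Matrix (Fin n) (Fin n) ℝ) (p : {p : Fin n × Fin n // p.1 ≤ p.2}) (ω : Ω) : ℝ :=
  upperPart (Q ω) p

lemma IsGOE.entry_triPos (hQ : IsGOE P Q) (i j : Fin n) (ω : Ω) :
    entry Q (triPos i j) ω = Q ω i j := upperPart_triPos (hQ.symm ω) i j

lemma IsGOE.iIndepFun_entry (hQ : IsGOE P Q) : iIndepFun (entry Q) P := hQ.indep

lemma IsGOE.aemeasurable_entry (hQ : IsGOE P Q) (p : {p : Fin n × Fin n // p.1 ≤ p.2}) :
    AEMeasurable (entry Q p) P := hQ.aemeasurable_apply p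

lemma IsGOE.measureReal_entry (hQ : IsGOE P Q) (p : {p : Fin n × Fin n // p.1 ≤ p.2}) {s : Set ℝ}
    (hs : MeasurableSet s) : P.real (entry Q p ⁻¹' s) = (gaussianReal 0 (goeVar p)).real s := by
  rw [← hQ.map_apply p, map_measureReal_apply_of_aemeasurable (hQ.aemeasurable_apply p) hs]
  rfl

lemma IsGOE.measureReal_offDiag_le (hQ : IsGOE P Q) {i j : Fin n} (hij : i ≠ j) {t : ℝ}
    (ht : 0 ≤ t) : P.real (entry Q (triPos i j) ⁻¹' Set.Iic (-t)) ≤ exp (-t ^ 2) := by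
  have hv : goeVar (triPos i j) = 1 / 2 := by
    have : min i j ≠ max i j := by simpa using hij
    simp [goeVar, triPos, this]
  rw [hQ.measureReal_entry _ measurableSet_Iic, hv, ← halfCDF_eq_real]
  exact halfCDF_neg_le_exp ht

lemma IsGOE.measureReal_diag_le (hQ : IsGOE P Q) (i : Fin n) {t : ℝ} (ht : 0 ≤ t) :
    P.real (entry Q (triPos i i) ⁻¹' Set.Iic (-t)) ≤ exp (-t ^ 2 / 2) := by
  have hv : goeVar (triPos i i) = 1 := by simp [goeVar, triPos]
  rw [hQ.measureReal_entry _ measurableSet_Iic, hv, ← stdNormalCDF_eq_real]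
  exact stdNormalCDF_neg_le_exp ht

/-- The pairs of values (off-diagonal, diagonal) that form a heavy pair. -/
def heavySet (r : ℝ) : Set (ℝ × ℝ) :=
  {p | p.1 ≤ -(1.12 * r) ∨ (p.1 ≤ -r ∧ p.2 ≤ -(0.75 * r))}

lemma measurableSet_heavySet (r : ℝ) : MeasurableSet (heavySet r) :=
  (measurableSet_le measurable_fst measurable_const).union
    ((measurableSet_le measurable_fst measurable_const).inter
      (measurableSet_le measurable_snd measurable_const))

lemma triPos_ne_diag {i j : Fin n} (k : Fin n) (hij : i ≠ j) : triPos i j ≠ triPos k k := fun h => by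
  rcases triPos_eq_iff.1 h with ⟨rfl, rfl⟩ | ⟨rfl, rfl⟩ <;> exact hij rfl

lemma IsGOE.heavyPair_iff (hQ : IsGOE P Q) (i j : Fin n) (ω : Ω) :
    HeavyPair (Q ω) r i j ↔ (entry Q (triPos i j) ω, entry Q (triPos i i) ω) ∈ heavySet r := by
  simp only [hQ.entry_triPos]
  rfl

lemma IsGOE.measureReal_heavySet_le (hQ : IsGOE P Q) (hr : 0 ≤ r) {i j : Fin n} (hij : i ≠ j) :
    P.real ((fun ω => (entry Q (triPos i j) ω, entry Q (triPos i i) ω)) ⁻¹' heavySet r) ≤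
      2 * exp (-(1.2544 * r ^ 2)) := by
  have h1 := hQ.measureReal_offDiag_le hij (t := 1.12 * r) (by positivity)
  have h2 := indepFun_measureReal_le (hQ.iIndepFun_entry.indepFun (triPos_ne_diag i hij))
    measurableSet_Iic measurableSet_Iic (hQ.measureReal_offDiag_le hij hr)
    (hQ.measureReal_diag_le i (t := 0.75 * r) (by positivity))
  have h3 := measureReal_union_le (μ := P) (entry Q (triPos i j) ⁻¹' Set.Iic (-(1.12 * r)))
    {ω | entry Q (triPos i j) ω ∈ Set.Iic (-r) ∧ entry Q (triPos i i) ω ∈ Set.Iic (-(0.75 * r))}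
  refine LE.le.trans (le_trans (measureReal_mono fun ω hω => ?_) h3) ?_
  · exact hω
  have e1 : exp (-(1.12 * r) ^ 2) = exp (-(1.2544 * r ^ 2)) := by congr 1; ring
  -- `1 + 0.75² / 2 = 1.28125` exceeds `1.12² = 1.2544`, so the first alternative determines the
  -- exponent.
  have e2 : exp (-r ^ 2) * exp (-(0.75 * r) ^ 2 / 2) ≤ exp (-(1.2544 * r ^ 2)) := by
    rw [← exp_add, exp_le_exp]
    nlinarith [sq_nonneg r]
  linarith

lemma IsGOE.measureReal_star_le (hQ : IsGOE P Q) (hr : 0 ≤ r) :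
    P.real {ω | ∃ i j k l, i ≠ j ∧ i ≠ k ∧ i ≠ l ∧ j ≠ k ∧ j ≠ l ∧ k ≠ l ∧
      Q ω i j ≤ -r ∧ Q ω i k ≤ -r ∧ Q ω i l ≤ -r} ≤ n ^ 4 * exp (-(3 * r ^ 2)) := by
  have key : ∀ t : Fin n × Fin n × Fin n × Fin n, P.real {ω | (t.1 ≠ t.2.1 ∧ t.1 ≠ t.2.2.1 ∧
      t.1 ≠ t.2.2.2 ∧ t.2.1 ≠ t.2.2.1 ∧ t.2.1 ≠ t.2.2.2 ∧ t.2.2.1 ≠ t.2.2.2) ∧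
      (Q ω t.1 t.2.1 ≤ -r ∧ Q ω t.1 t.2.2.1 ≤ -r) ∧ Q ω t.1 t.2.2.2 ≤ -r} ≤
        exp (-(3 * r ^ 2)) := by
    rintro ⟨i, j, k, l⟩
    refine measureReal_le_of_imp (exp_pos _).le (fun ω hω => hω) ?_
    rintro ⟨hij, hik, hil, hjk, hjl, hkl⟩
    dsimp only at *
    have n1 : triPos i j ≠ triPos i k := fun h => by
      rcases triPos_eq_iff.1 h with ⟨-, h⟩ | ⟨h, -⟩
      exacts [hjk h, hik h]
    have n2 : triPos i j ≠ triPos i l := fun h => by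
      rcases triPos_eq_iff.1 h with ⟨-, h⟩ | ⟨h, -⟩
      exacts [hjl h, hil h]
    have n3 : triPos i k ≠ triPos i l := fun h => by
      rcases triPos_eq_iff.1 h with ⟨-, h⟩ | ⟨h, -⟩
      exacts [hkl h, hil h]
    have h1 := indepFun_measureReal_le (hQ.iIndepFun_entry.indepFun n1) measurableSet_Iic
      measurableSet_Iic (hQ.measureReal_offDiag_le hij hr) (hQ.measureReal_offDiag_le hik hr)
    have h2 := indepFun_measureReal_le
      (hQ.iIndepFun_entry.indepFun_prodMk₀ hQ.aemeasurable_entry _ _ _ n2 n3)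
      (measurableSet_Iic.prod measurableSet_Iic) measurableSet_Iic h1
      (hQ.measureReal_offDiag_le hil hr)
    simp only [Set.mem_prod, Set.mem_Iic, hQ.entry_triPos] at h2
    refine h2.trans (le_of_eq ?_)
    rw [← exp_add, ← exp_add]
    congr 1
    ring
  refine (measureReal_le_card_mul (fun ω hω => ?_) key).trans (le_of_eq ?_)
  · obtain ⟨i, j, k, l, h1, h2, h3, h4, h5, h6, h7, h8, h9⟩ := hω
    exact Set.mem_iUnion.2 ⟨⟨i, j, k, l⟩, ⟨h1, h2, h3, h4, h5, h6⟩, ⟨h7, h8⟩, h9⟩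
  · simp only [Fintype.card_prod, Fintype.card_fin]
    push_cast
    ring

lemma IsGOE.measureReal_path_le (hQ : IsGOE P Q) (hr : 0 ≤ r) :
    P.real {ω | ∃ i j l, i ≠ j ∧ i ≠ l ∧ j ≠ l ∧ HeavyPair (Q ω) r i j ∧
      (Q ω i l ≤ -r ∨ Q ω j l ≤ -r)} ≤ n ^ 3 * (4 * exp (-(2.2544 * r ^ 2))) := by
  have aux : ∀ i j k l : Fin n, i ≠ j → k ≠ l → i ≠ l → j ≠ l →
      P.real {ω | HeavyPair (Q ω) r i j ∧ Q ω k l ≤ -r} ≤ 2 * exp (-(2.2544 * r ^ 2)) := by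
    intro i j k l hij hkl hil hjl
    have n1 : triPos i j ≠ triPos k l := fun h => by
      rcases triPos_eq_iff.1 h with ⟨-, h⟩ | ⟨h, -⟩
      exacts [hjl h, hil h]
    have h2 := indepFun_measureReal_le
      (hQ.iIndepFun_entry.indepFun_prodMk₀ hQ.aemeasurable_entry _ _ _ n1
        (triPos_ne_diag i hkl).symm)
      (measurableSet_heavySet r) measurableSet_Iic (hQ.measureReal_heavySet_le hr hij)
      (hQ.measureReal_offDiag_le hkl hr)
    simp only [Set.mem_Iic, hQ.entry_triPos] at h2
    refine h2.trans (le_of_eq ?_)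
    rw [mul_assoc, ← exp_add]
    congr 2
    ring
  have key : ∀ t : Fin n × Fin n × Fin n, P.real {ω | (t.1 ≠ t.2.1 ∧ t.1 ≠ t.2.2 ∧
      t.2.1 ≠ t.2.2) ∧ ((HeavyPair (Q ω) r t.1 t.2.1 ∧ Q ω t.1 t.2.2 ≤ -r) ∨
        (HeavyPair (Q ω) r t.1 t.2.1 ∧ Q ω t.2.1 t.2.2 ≤ -r))} ≤
        4 * exp (-(2.2544 * r ^ 2)) := by
    rintro ⟨i, j, l⟩
    refine measureReal_le_of_imp (by positivity) (fun ω hω => hω) ?_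
    rintro ⟨hij, hil, hjl⟩
    have h1 := aux i j i l hij hil hil hjl
    have h2 := aux i j j l hij hjl hil hjl
    have h3 := measureReal_union_le (μ := P) {ω | HeavyPair (Q ω) r i j ∧ Q ω i l ≤ -r}
      {ω | HeavyPair (Q ω) r i j ∧ Q ω j l ≤ -r}
    refine h3.trans ?_
    linarith
  refine (measureReal_le_card_mul (fun ω hω => ?_) key).trans (le_of_eq ?_)
  · obtain ⟨i, j, l, h1, h2, h3, h4, h5⟩ := hω
    exact Set.mem_iUnion.2 ⟨⟨i, j, l⟩, ⟨h1, h2, h3⟩,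
      h5.imp (fun h => ⟨h4, h⟩) fun h => ⟨h4, h⟩⟩
  · simp only [Fintype.card_prod, Fintype.card_fin]
    push_cast
    ring

lemma IsGOE.measureReal_disjoint_heavy_le (hQ : IsGOE P Q) (hr : 0 ≤ r) :
    P.real {ω | ∃ i j k l, i ≠ j ∧ i ≠ k ∧ i ≠ l ∧ j ≠ k ∧ j ≠ l ∧ k ≠ l ∧
      HeavyPair (Q ω) r i j ∧ HeavyPair (Q ω) r k l} ≤
        n ^ 4 * (4 * exp (-(2.5088 * r ^ 2))) := by
  have key : ∀ t : Fin n × Fin n × Fin n × Fin n, P.real {ω | (t.1 ≠ t.2.1 ∧ t.1 ≠ t.2.2.1 ∧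
      t.1 ≠ t.2.2.2 ∧ t.2.1 ≠ t.2.2.1 ∧ t.2.1 ≠ t.2.2.2 ∧ t.2.2.1 ≠ t.2.2.2) ∧
      HeavyPair (Q ω) r t.1 t.2.1 ∧ HeavyPair (Q ω) r t.2.2.1 t.2.2.2} ≤
        4 * exp (-(2.5088 * r ^ 2)) := by
    rintro ⟨i, j, k, l⟩
    refine measureReal_le_of_imp (by positivity) (fun ω hω => hω) ?_
    rintro ⟨hij, hik, hil, hjk, hjl, hkl⟩
    dsimp only at *
    have n1 : triPos i j ≠ triPos k l := fun h => by
      rcases triPos_eq_iff.1 h with ⟨h, -⟩ | ⟨h, -⟩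
      exacts [hik h, hil h]
    have n2 : triPos i i ≠ triPos k k := fun h => by
      rcases triPos_eq_iff.1 h with ⟨h, -⟩ | ⟨h, -⟩ <;> exact hik h
    have h2 := indepFun_measureReal_le
      (hQ.iIndepFun_entry.indepFun_prodMk_prodMk₀ hQ.aemeasurable_entry _ _ _ _ n1
        (triPos_ne_diag k hij) (triPos_ne_diag i hkl).symm n2)
      (measurableSet_heavySet r) (measurableSet_heavySet r) (hQ.measureReal_heavySet_le hr hij)
      (hQ.measureReal_heavySet_le hr hkl)
    simp only [← hQ.heavyPair_iff] at h2
    refine h2.trans (le_of_eq ?_)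
    rw [mul_mul_mul_comm, ← exp_add]
    ring_nf
  refine (measureReal_le_card_mul (fun ω hω => ?_) key).trans (le_of_eq ?_)
  · obtain ⟨i, j, k, l, h1, h2, h3, h4, h5, h6, h7, h8⟩ := hω
    exact Set.mem_iUnion.2 ⟨⟨i, j, k, l⟩, ⟨h1, h2, h3, h4, h5, h6⟩, h7, h8⟩
  · simp only [Fintype.card_prod, Fintype.card_fin]
    push_cast
    ring

lemma IsGOE.measureReal_forall_diag_gt (hQ : IsGOE P Q) :
    P.real {ω | ∀ e, -r < Q ω e e} = (1 - stdNormalCDF (-r)) ^ n := by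
  have hm : MeasurableSet (Set.univ.pi fun _ : Fin n => Set.Ioi (-r)) :=
    MeasurableSet.univ_pi fun _ => measurableSet_Ioi
  have h1 : P.real {ω | ∀ e, -r < Q ω e e} =
      (normalPi n).real (Set.univ.pi fun _ => Set.Ioi (-r)) := by
    rw [← hQ.map_diag, map_measureReal_apply_of_aemeasurable hQ.aemeasurable_diag hm]
    congr 1
    ext ω
    simp
  have h2 : (gaussianReal 0 1).real (Set.Ioi (-r)) = 1 - stdNormalCDF (-r) := by
    rw [stdNormalCDF_eq_real, ← Set.compl_Iic, probReal_compl_eq_one_sub measurableSet_Iic]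
  rw [h1, measureReal_def, normalPi, Measure.pi_pi, Finset.prod_const, ENNReal.toReal_pow,
    Finset.card_univ, Fintype.card_fin, ← measureReal_def, h2]

/-- Unless all diagonal entries exceed `-r`, some vertex shows that the minimal value is at most
`-r`, and a support of size above two then forces a bad configuration. -/
lemma IsGOE.measureReal_two_lt_kappa_le (hQ : IsGOE P Q) (hr : 0 < r) :
    P.real {ω | 2 < kappa (Q ω)} ≤ (1 - stdNormalCDF (-r)) ^ n + (n ^ 4 * exp (-(3 * r ^ 2)) +
      (n ^ 3 * (4 * exp (-(2.2544 * r ^ 2))) + n ^ 4 * (4 * exp (-(2.5088 * r ^ 2))))) := by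
  rw [← hQ.measureReal_forall_diag_gt]
  refine le_trans (measureReal_mono fun ω hω => ?_) <| (measureReal_union_le _ _).trans <|
    add_le_add le_rfl <| (measureReal_union_le _ _).trans <|
    add_le_add (hQ.measureReal_star_le hr.le) <| (measureReal_union_le _ _).trans <|
    add_le_add (hQ.measureReal_path_le hr.le) (hQ.measureReal_disjoint_heavy_le hr.le)
  by_cases h : ∀ e, -r < Q ω e e
  · exact Or.inl h
  push Not at h
  obtain ⟨e, he⟩ := h
  have h2 : 2 < kappa (Q ω) := hω
  have hu : ∃! x, IsMinimizer (Q ω) x := by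
    by_contra hu
    rw [kappa, dif_neg hu] at h2
    omega
  obtain ⟨x, hx, -⟩ := id hu
  rw [kappa_eq hu hx] at h2
  exact Or.inr (hx.badConfiguration (hQ.symm ω) hr ((hx.quadForm_le_apply e).trans he) h2)

end RareEvents

section RareEventsLimit
open Real

lemma tendsto_mul_measureReal_two_lt_kappa {Ω : ℕ → Type*} [∀ n, MeasurableSpace (Ω n)]
    {P : ∀ n, Measure (Ω n)} [∀ n, IsProbabilityMeasure (P n)]
    {Q : ∀ n, Ω n → Matrix (Fin n) (Fin n) ℝ} (hQ : ∀ n, IsGOE (P n) (Q n)) :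
    Tendsto (fun n : ℕ => n * minScale n ^ 3 * (P n).real {ω | 2 < kappa (Q n ω)}) atTop
      (𝓝 0) := by
  have h0 := (tendsto_natCast_pow_mul_exp_cube 1 3).const_mul (exp 0)
  have h1 := tendsto_natCast_pow_mul_exp_low (a := 5) (β := 3) (by norm_num) 3
  have h2 := (tendsto_natCast_pow_mul_exp_low (a := 4) (β := 2.2544) (by norm_num) 3).const_mul 4
  -- Since `exp (-r²)` is `n ^ (-2 + o(1))`, the requirement is `a < 2 β`. Two disjoint heavy pairs
  -- are the tight case, `5 < 5.0176`; this fixes the choice of `1.12` and `0.75`.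
  have h3 := (tendsto_natCast_pow_mul_exp_low (a := 5) (β := 2.5088) (by norm_num) 3).const_mul 4
  have h := h0.add (h1.add (h2.add h3))
  simp only [mul_zero, add_zero] at h
  refine squeeze_zero' ?_ ?_ h
  · filter_upwards [eventually_one_le_minScale] with n hn
    positivity
  · filter_upwards [eventually_one_le_minScale, tendsto_minScaleLow.eventually_gt_atTop 0,
      eventually_one_sub_pow_le 0] with n hn hr hp
    have hb := (hQ n).measureReal_two_lt_kappa_le hr
    rw [Nat.sub_zero, Nat.cast_zero] at hp
    have hL : 0 ≤ n * minScale n ^ 3 := by positivity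
    have := mul_le_mul_of_nonneg_left (hb.trans (add_le_add_left hp _)) hL
    refine this.trans (le_of_eq ?_)
    have e : minScale n ^ (3 : ℝ) = minScale n ^ 3 := by norm_cast
    simp only [e]
    ring

end RareEventsLimit
end StQP

namespace StQP
-- The exact probability that some edge carries a value below the diagonal minimum.
section EdgeEvent
open Real

variable {n : ℕ}

/-- A product over unordered pairs is invariant under relabeling. Multiplying `F` by the sign of `j
- i` makes it antisymmetric, so the rule for alternating products applies up to sign, and absolute
values remove the sign. -/
lemma prod_Ioi_comp_perm (σ : Equiv.Perm (Fin n)) {F : Fin n → Fin n → ℝ}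
    (hF : ∀ i j, F i j = F j i) (h0 : ∀ i j, 0 ≤ F i j) :
    ∏ i, ∏ j ∈ Finset.Ioi i, F (σ i) (σ j) = ∏ i, ∏ j ∈ Finset.Ioi i, F i j := by
  set f : Fin n → Fin n → ℝ := fun i j => F i j * (SignType.sign ((j : ℝ) - i) : ℝ) with hf
  have habs : ∀ i j, i ≠ j → |f i j| = F i j := fun i j hij => by
    have hne : (j : ℝ) - i ≠ 0 := sub_ne_zero.2 fun h => hij (Fin.ext (by exact_mod_cast h.symm))
    rw [hf, abs_mul, abs_of_nonneg (h0 i j)]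
    rcases lt_or_gt_of_ne hne with h | h
    · simp [sign_neg h]
    · simp [sign_pos h]
  have hanti : ∀ i j, f i j = -f j i := fun i j => by
    simp only [hf]
    rw [hF i j, ← neg_sub (i : ℝ) (j : ℝ), Left.sign_neg]
    push_cast
    ring
  have h := congrArg abs (σ.prod_Ioi_comp_eq_sign_mul_prod hanti)
  have hs : |((σ.sign : ℤ) : ℝ)| = 1 := by
    rcases Int.units_eq_one_or σ.sign with h | h <;> simp [h]
  rw [abs_mul, hs, one_mul] at h
  simp only [Finset.abs_prod] at h
  calc _ = ∏ i, ∏ j ∈ Finset.Ioi i, |f (σ i) (σ j)| :=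
        Finset.prod_congr rfl fun i _ => Finset.prod_congr rfl fun j hj =>
          (habs _ _ (σ.injective.ne (Finset.mem_Ioi.1 hj).ne)).symm
    _ = ∏ i, ∏ j ∈ Finset.Ioi i, |f i j| := h
    _ = _ := Finset.prod_congr rfl fun i _ => Finset.prod_congr rfl fun j hj =>
        habs _ _ (Finset.mem_Ioi.1 hj).ne

lemma prod_Ioi_fin_eq (g : ℕ → ℕ → ℝ) :
    ∏ i : Fin n, ∏ j ∈ Finset.Ioi i, g (i + 1) (j + 1) =
      ∏ i ∈ Finset.Icc 1 n, ∏ j ∈ Finset.Ioc i n, g i j := by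
  refine Finset.prod_nbij (fun i => (i : ℕ) + 1) (fun i _ => ?_) (fun i _ j _ h => ?_)
    (fun k hk => ?_) (fun i _ => ?_)
  · simp only [Finset.mem_Icc]; omega
  · exact Fin.ext (by simpa using h)
  · simp only [Finset.coe_Icc, Set.mem_Icc] at hk
    exact ⟨⟨k - 1, by omega⟩, by simp, by simp; omega⟩
  · refine Finset.prod_nbij (fun j => (j : ℕ) + 1) (fun j hj => ?_) (fun j _ k _ h => ?_)
      (fun k hk => ?_) (fun j _ => rfl)
    · have : i < j := Finset.mem_Ioi.1 hj
      simp only [Finset.mem_Ioc]; omega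
    · exact Fin.ext (by simpa using h)
    · simp only [Finset.coe_Ioc, Set.mem_Ioc] at hk
      refine ⟨⟨k - 1, by omega⟩, ?_, by simp; omega⟩
      simp only [Finset.coe_Ioi, Set.mem_Ioi, Fin.lt_def]
      omega

/-- The conditional probability, given the diagonal `z`, that no edge carries a value below the
minimum of `z`. -/
noncomputable def noEdgeProb (z : Fin n → ℝ) : ℝ :=
  ∏ i, ∏ j ∈ Finset.Ioi i, (1 - edgeProb (ordStat z 1) (z i) (z j))

lemma noEdgeProb_eq_ordStat (z : Fin n → ℝ) : noEdgeProb z =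
    ∏ i ∈ Finset.Icc 1 n, ∏ j ∈ Finset.Ioc i n,
      (1 - edgeProb (ordStat z 1) (ordStat z i) (ordStat z j)) := by
  rw [← prod_Ioi_fin_eq fun i j => 1 - edgeProb (ordStat z 1) (ordStat z i) (ordStat z j), noEdgeProb,
    ← prod_Ioi_comp_perm (Tuple.sort z) (fun i j => by rw [edgeProb_comm])
      (fun i j => (one_sub_mem (edgeProb_mem _ _ _)).1)]
  have h : ∀ i : Fin n, ordStat z (i + 1) = z (Tuple.sort z i) := fun i => by
    rw [ordStat, dif_pos (by omega)]
    rfl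
  simp only [h]

/-- In the first row every threshold is `Z_(1)` itself, which gives the power `n - 1`. Writing the
product of the rows `i = 1`, `i = 2`, `i ≥ 3` as `a b c`, the identity is `1 - a b c = (1 - a) + a
(1 - b) + a b (1 - c)`. -/
lemma noEdgeProb_eq (hn : 2 ≤ n) (z : Fin n → ℝ) :
    noEdgeProb z = 1 - valS z - valA z - valB z := by
  have h1 : Finset.Icc 1 n = insert 1 (insert 2 (Finset.Icc 3 n)) := by
    ext k; simp only [Finset.mem_insert, Finset.mem_Icc]; omega
  have h2 : Finset.Ioc 2 n = Finset.Icc 3 n := by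
    ext k; simp only [Finset.mem_Ioc, Finset.mem_Icc]; omega
  rw [noEdgeProb_eq_ordStat, h1, Finset.prod_insert (by simp), Finset.prod_insert (by simp), h2]
  simp only [edgeProb_self, Finset.prod_const, Nat.card_Ioc]
  rw [valS, valA, valB]
  ring

instance nullSingletonClass_gaussianReal_half : NullSingletonClass (gaussianReal 0 (1 / 2)) :=
  nullSingletonClass_gaussianReal (by norm_num)

lemma measureReal_Ici_half (c : ℝ) : (gaussianReal 0 (1 / 2)).real (Set.Ici c) = 1 - halfCDF c := by
  rw [halfCDF_eq_real, ← measureReal_congr (Iio_ae_eq_Iic (μ := gaussianReal 0 (1 / 2))),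
    ← Set.compl_Iio, probReal_compl_eq_one_sub measurableSet_Iio]

lemma measureReal_pi_half_ge (c : {p : Fin n × Fin n // p.1 < p.2} → ℝ) :
    (Measure.pi fun _ : {p : Fin n × Fin n // p.1 < p.2} => gaussianReal 0 (1 / 2)).real
      {o | ∀ p, c p ≤ o p} = ∏ p, (1 - halfCDF (c p)) := by
  have : {o | ∀ p, c p ≤ o p} = Set.univ.pi fun p => Set.Ici (c p) := by
    ext o
    simp only [Set.mem_ofPred_eq, Set.mem_univ_pi, Set.mem_Ici]
  rw [this, measureReal_def, Measure.pi_pi, ENNReal.toReal_prod]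
  exact Finset.prod_congr rfl fun p _ => measureReal_Ici_half _

lemma prod_subtype_lt_eq (g : Fin n → Fin n → ℝ) :
    ∏ p : {p : Fin n × Fin n // p.1 < p.2}, g p.1.1 p.1.2 = ∏ i, ∏ j ∈ Finset.Ioi i, g i j := by
  rw [Finset.prod_sigma']
  refine Finset.prod_bij (fun p _ => (⟨p.1.1, p.1.2⟩ : (_ : Fin n) × Fin n)) (fun p _ => ?_)
    (fun p _ q _ h => ?_) (fun q hq => ?_) fun _ _ => rfl
  · simpa using p.2
  · simp only [Sigma.mk.injEq, heq_eq_eq] at h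
    exact Subtype.ext (Prod.ext h.1 h.2)
  · exact ⟨⟨(q.1, q.2), by simpa using hq⟩, Finset.mem_univ _, rfl⟩

variable {Ω : Type*} [MeasurableSpace Ω] {P : Measure Ω} [IsProbabilityMeasure P]
  {Q : Ω → Matrix (Fin n) (Fin n) ℝ}

/-- The entries strictly above the diagonal. -/
def strictUpperPart (A : Matrix (Fin n) (Fin n) ℝ) (p : {p : Fin n × Fin n // p.1 < p.2}) : ℝ :=
  A p.1.1 p.1.2

lemma IsGOE.aemeasurable_strictUpperPart (hQ : IsGOE P Q) :
    AEMeasurable (fun ω => strictUpperPart (Q ω)) P :=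
  aemeasurable_pi_lambda _ fun p => (hQ.offDiag _ _ p.2).aemeasurable

lemma IsGOE.map_strictUpperPart (hQ : IsGOE P Q) :
    P.map (fun ω => strictUpperPart (Q ω)) = Measure.pi fun _ => gaussianReal 0 (1 / 2) := by
  have hinj : Function.Injective fun p : {p : Fin n × Fin n // p.1 < p.2} =>
      (⟨p.1, p.2.le⟩ : {p : Fin n × Fin n // p.1 ≤ p.2}) :=
    fun p q h => Subtype.ext (congrArg (fun p => p.1) h)
  have h := (iIndepFun_iff_map_fun_eq_pi_map fun p : {p : Fin n × Fin n // p.1 < p.2} =>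
    (hQ.offDiag _ _ p.2).aemeasurable).1 (hQ.indep.precomp hinj)
  exact h.trans (congrArg Measure.pi (funext fun p => (hQ.offDiag _ _ p.2).map_eq))

lemma IsGOE.indepFun_diag (hQ : IsGOE P Q) :
    IndepFun (fun ω => (Q ω).diag) (fun ω => strictUpperPart (Q ω)) P := by
  set S : Finset {p : Fin n × Fin n // p.1 ≤ p.2} := {p | p.1.1 = p.1.2} with hS
  set T : Finset {p : Fin n × Fin n // p.1 ≤ p.2} := {p | p.1.1 < p.1.2} with hT
  have hST : Disjoint S T := Finset.disjoint_filter.2 fun p _ h => h.not_lt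
  have h := iIndepFun.indepFun_finset₀ S T hST hQ.indep hQ.aemeasurable_apply
  exact h.comp (φ := fun f i => f ⟨⟨(i, i), le_rfl⟩, by simp [hS]⟩)
    (ψ := fun f (p : {p : Fin n × Fin n // p.1 < p.2}) => f ⟨⟨p.1, p.2.le⟩, by simp [hT, p.2]⟩)
    (measurable_pi_lambda _ fun _ => measurable_pi_apply _)
    (measurable_pi_lambda _ fun _ => measurable_pi_apply _)

/-- The pairs of a diagonal and a strict upper triangle for which no edge carries a value below
the minimum of the diagonal. -/
def noEdgeSet (n : ℕ) : Set ((Fin n → ℝ) × ({p : Fin n × Fin n // p.1 < p.2} → ℝ)) :=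
  {x | ∀ p : {p : Fin n × Fin n // p.1 < p.2}, ordStat x.1 1 -
    √((x.1 p.1.1 - ordStat x.1 1) * (x.1 p.1.2 - ordStat x.1 1)) ≤ x.2 p}

lemma measurableSet_noEdgeSet : MeasurableSet (noEdgeSet n) := by
  have : noEdgeSet n = ⋂ p : {p : Fin n × Fin n // p.1 < p.2}, {x | ordStat x.1 1 -
    √((x.1 p.1.1 - ordStat x.1 1) * (x.1 p.1.2 - ordStat x.1 1)) ≤ x.2 p} := by
    ext; simp [noEdgeSet]
  rw [this]
  refine MeasurableSet.iInter fun p => measurableSet_le ?_ ?_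
  · have h1 : Measurable fun x : (Fin n → ℝ) × ({p : Fin n × Fin n // p.1 < p.2} → ℝ) =>
      ordStat x.1 1 := (measurable_ordStat 1).comp measurable_fst
    have h2 : ∀ i, Measurable fun x : (Fin n → ℝ) × ({p : Fin n × Fin n // p.1 < p.2} → ℝ) =>
      x.1 i := fun i => (measurable_pi_apply i).comp measurable_fst
    exact h1.sub (((h2 _).sub h1).mul ((h2 _).sub h1)).sqrt
  · exact (measurable_pi_apply p).comp measurable_snd

lemma not_someEdgeBelow_iff (A : Matrix (Fin n) (Fin n) ℝ) :
    ¬ SomeEdgeBelow A (ordStat A.diag 1) ↔ (A.diag, strictUpperPart A) ∈ noEdgeSet n := by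
  simp only [SomeEdgeBelow, noEdgeSet, not_exists, not_and, not_lt, Set.mem_ofPred_eq,
    Subtype.forall, Prod.forall]
  rfl

/-- The diagonal is independent of the strict upper triangle. Fubini fixes the diagonal, and the
remaining event is a box for independent `N(0, 1/2)` variables. -/
lemma IsGOE.measureReal_not_someEdgeBelow (hQ : IsGOE P Q) :
    P.real {ω | ¬ SomeEdgeBelow (Q ω) (ordStat (Q ω).diag 1)} =
      ∫ z, noEdgeProb z ∂(normalPi n) := by
  have hmap := (indepFun_iff_map_prod_eq_prod_map_map hQ.aemeasurable_diag
    hQ.aemeasurable_strictUpperPart).1 hQ.indepFun_diag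
  rw [hQ.map_diag, hQ.map_strictUpperPart] at hmap
  have hpre : {ω | ¬ SomeEdgeBelow (Q ω) (ordStat (Q ω).diag 1)} =
      (fun ω => ((Q ω).diag, strictUpperPart (Q ω))) ⁻¹' noEdgeSet n := by
    ext ω
    exact not_someEdgeBelow_iff _
  rw [hpre, ← map_measureReal_apply_of_aemeasurable
    (hQ.aemeasurable_diag.prodMk hQ.aemeasurable_strictUpperPart) measurableSet_noEdgeSet, hmap,
    measureReal_def, Measure.prod_apply measurableSet_noEdgeSet, ← integral_toReal
      (measurable_measure_prodMk_left measurableSet_noEdgeSet).aemeasurable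
      (ae_of_all _ fun _ => measure_lt_top _ _)]
  refine integral_congr_ae (ae_of_all _ fun z => ?_)
  have := measureReal_pi_half_ge fun p : {p : Fin n × Fin n // p.1 < p.2} => ordStat z 1 -
    √((z p.1.1 - ordStat z 1) * (z p.1.2 - ordStat z 1))
  refine this.trans ?_
  exact prod_subtype_lt_eq fun i j => 1 - edgeProb (ordStat z 1) (z i) (z j)

lemma IsGOE.measureReal_someEdgeBelow (hQ : IsGOE P Q) (hn : 2 ≤ n) :
    P.real {ω | SomeEdgeBelow (Q ω) (ordStat (Q ω).diag 1)} =
      termS P Q + termA P Q + termB P Q := by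
  have hS : Integrable (valS (n := n)) (normalPi n) := integrable_of_mem measurable_valS valS_mem
  have hA : Integrable (valA (n := n)) (normalPi n) := integrable_of_mem measurable_valA valA_mem
  have hB : Integrable (valB (n := n)) (normalPi n) := integrable_of_mem measurable_valB valB_mem
  have hnull : NullMeasurableSet {ω | ¬ SomeEdgeBelow (Q ω) (ordStat (Q ω).diag 1)} P := by
    have := (hQ.aemeasurable_diag.prodMk hQ.aemeasurable_strictUpperPart).nullMeasurableSet_preimage
      (measurableSet_noEdgeSet (n := n))
    refine this.congr (ae_of_all _ fun ω => propext (not_someEdgeBelow_iff _).symm)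
  have hc : {ω | SomeEdgeBelow (Q ω) (ordStat (Q ω).diag 1)} =
      {ω | ¬ SomeEdgeBelow (Q ω) (ordStat (Q ω).diag 1)}ᶜ := by ext; simp
  rw [hc, probReal_compl_eq_one_sub₀ hnull, hQ.measureReal_not_someEdgeBelow, hQ.termS_eq,
    hQ.termA_eq, hQ.termB_eq]
  simp only [noEdgeProb_eq hn]
  have h1 : Integrable (fun z : Fin n → ℝ => 1 - valS z) (normalPi n) :=
    (integrable_const 1).sub hS
  have h2 : Integrable (fun z : Fin n → ℝ => 1 - valS z - valA z) (normalPi n) := h1.sub hA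
  rw [integral_sub h2 hB, integral_sub h1 hA, integral_sub (integrable_const _) hS]
  simp
  ring

end EdgeEvent
end StQP

namespace StQP
-- Comparing the support size with the edge event.
section SupportSize
open Real

section Fixed

variable {n : ℕ} {Ω : Type*} [MeasurableSpace Ω] {P : Measure Ω} [IsProbabilityMeasure P]
  {Q : Ω → Matrix (Fin n) (Fin n) ℝ}

lemma measureReal_mono_of_ae {s t : Set Ω} (h : ∀ᵐ ω ∂P, ω ∈ s → ω ∈ t) : P.real s ≤ P.real t :=
  ENNReal.toReal_mono (measure_ne_top _ _) (measure_mono_ae h)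

lemma exists_diag_eq_ordStat_one (hn : 0 < n) (A : Matrix (Fin n) (Fin n) ℝ) :
    ∃ k, A k k = ordStat A.diag 1 :=
  ⟨_, (ordStat_eq hn A.diag le_rfl hn).symm⟩

lemma IsGOE.measureReal_kappa_eq_one (hQ : IsGOE P Q) (hn : 1 ≤ n) :
    P.real {ω | kappa (Q ω) = 1} = 1 - P.real {ω | 1 < kappa (Q ω)} := by
  have hm : NullMeasurableSet {ω | 1 < kappa (Q ω)} P :=
    hQ.aemeasurable_kappa.nullMeasurableSet_preimage (s := Set.Ioi 1) measurableSet_Ioi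
  rw [← probReal_compl_eq_one_sub₀ hm]
  refine measureReal_congr (eventuallyEq_set.2 ?_)
  filter_upwards [hQ.ae_existsUnique hn] with ω hω
  have := kappa_pos hω
  simp only [Set.mem_ofPred_eq, Set.mem_compl_iff]
  omega

lemma IsGOE.measureReal_minDiagVertexOptimal (hQ : IsGOE P Q) (hn : 1 ≤ n) :
    P.real {ω | MinDiagVertexOptimal (Q ω)} = P.real {ω | kappa (Q ω) = 1} := by
  refine measureReal_congr (eventuallyEq_set.2 ?_)
  filter_upwards [hQ.ae_existsUnique hn] with ω hω
  exact (kappa_eq_one_iff hω).symm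

lemma IsGOE.measureReal_kappa_eq_two_le (hQ : IsGOE P Q) (hn : 2 ≤ n) :
    P.real {ω | kappa (Q ω) = 2} ≤ termS P Q + termA P Q + termB P Q := by
  rw [← hQ.measureReal_someEdgeBelow hn]
  refine measureReal_mono_of_ae ?_
  filter_upwards [hQ.ae_existsUnique (show 1 ≤ n by omega)] with ω hω h2
  obtain ⟨k, hk⟩ := exists_diag_eq_ordStat_one (show 0 < n by omega) (Q ω)
  exact someEdgeBelow_of_kappa_eq_two (hQ.symm ω) hk (ordStat_one_le _) hω h2

lemma IsGOE.le_measureReal_one_lt_kappa (hQ : IsGOE P Q) (hn : 2 ≤ n) :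
    termS P Q + termA P Q + termB P Q ≤ P.real {ω | 1 < kappa (Q ω)} := by
  rw [← hQ.measureReal_someEdgeBelow hn]
  refine measureReal_mono_of_ae ?_
  filter_upwards [hQ.ae_existsUnique (show 1 ≤ n by omega)] with ω hω h2
  exact SomeEdgeBelow.one_lt_kappa (hQ.symm ω) (ordStat_one_le _) h2 hω

lemma measureReal_one_lt_kappa_le : P.real {ω | 1 < kappa (Q ω)} ≤
    P.real {ω | kappa (Q ω) = 2} + P.real {ω | 2 < kappa (Q ω)} := by
  refine (measureReal_mono fun ω hω => ?_).trans (measureReal_union_le _ _)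
  have h : 1 < kappa (Q ω) := hω
  exact (show kappa (Q ω) = 2 ∨ 2 < kappa (Q ω) by omega)

end Fixed

variable {Ω : ℕ → Type*} [∀ n, MeasurableSpace (Ω n)]
    {P : ∀ n, Measure (Ω n)} [∀ n, IsProbabilityMeasure (P n)]
    {Q : ∀ n, Ω n → Matrix (Fin n) (Fin n) ℝ}

lemma isLittleO_measureReal_two_lt_kappa (hQ : ∀ n, IsGOE (P n) (Q n)) :
    (fun n => (P n).real {ω | 2 < kappa (Q n ω)}) =o[atTop] fun n => termB (P n) (Q n) := by
  simp only [(hQ _).termB_eq]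
  exact tendsto_zero_of_le_term (tendsto_mul_measureReal_two_lt_kappa hQ)

/-- All three expansions reduce to this, since each error is squeezed between the probabilities of
`κ = 2` and `κ > 1`, which differ by at most that of `κ > 2`. -/
lemma isLittleO_termB_of_abs_le (hQ : ∀ n, IsGOE (P n) (Q n)) {f : ℕ → ℝ}
    (hf : ∀ n, 2 ≤ n → |f n| ≤ (P n).real {ω | 2 < kappa (Q n ω)}) :
    f =o[atTop] fun n => termB (P n) (Q n) := by
  refine (IsBigO.of_bound' ?_).trans_isLittleO (isLittleO_measureReal_two_lt_kappa hQ)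
  filter_upwards [eventually_ge_atTop 2] with n hn
  rw [norm_eq_abs]
  exact (hf n hn).trans (le_abs_self _)

/-- At the scale `L / n` only `S_n` survives: `A_n` is smaller by `L⁻²`, and `B_n` by `L⁻⁴`, which
also covers the remainder. -/
lemma tendsto_of_sub_terms_isLittleO (hQ : ∀ n, IsGOE (P n) (Q n)) {f : ℕ → ℝ}
    (hf : (fun n => f n - (termS (P n) (Q n) + termA (P n) (Q n) + termB (P n) (Q n)))
      =o[atTop] fun n => termB (P n) (Q n)) :
    Tendsto (fun n : ℕ => n * (minScale n)⁻¹ * f n) atTop (𝓝 (√π * 2)) := by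
  simp only [(hQ _).termS_eq, (hQ _).termA_eq, (hQ _).termB_eq] at hf
  have hinv := tendsto_inv_atTop_zero.comp tendsto_minScale
  have hA := tendsto_integral_valA.mul (hinv.pow 2)
  have hB := tendsto_integral_valB.mul (hinv.pow 4)
  rw [Function.comp_def] at hA hB
  have hR := ((isBigO_refl (fun n : ℕ => (n : ℝ) * (minScale n)⁻¹) atTop).mul_isLittleO
    hf).trans_tendsto (by
      have h0 : 18 * √π * 0 ^ 4 = 0 := by ring
      rw [h0] at hB
      refine hB.congr' ?_
      filter_upwards [eventually_one_le_minScale] with n hn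
      have : minScale n ≠ 0 := by positivity
      field_simp)
  have h := ((tendsto_integral_valS.add hA).add hB).add hR
  rw [show √π * 2 + 3 * √π * 0 ^ 2 + 18 * √π * 0 ^ 4 + 0 = √π * 2 by ring] at h
  refine h.congr' ?_
  filter_upwards [eventually_one_le_minScale] with n hn
  have : minScale n ≠ 0 := by positivity
  field_simp
  ring

lemma isEquivalent_of_tendsto_minScale {f : ℕ → ℝ}
    (hf : Tendsto (fun n : ℕ => n * (minScale n)⁻¹ * f n) atTop (𝓝 (√π * 2))) :
    f ~[atTop] fun n : ℕ => 2 * √(2 * π) * (√(log n) / n) := by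
  refine isEquivalent_of_tendsto_mul hf (by positivity) ?_
  filter_upwards [eventually_one_le_minScale, eventually_gt_atTop 0] with n hL hn
  refine ⟨by positivity, ?_⟩
  have := sqrt_log_ne_zero hL
  rw [minScale_eq, sqrt_mul zero_le_two]
  field_simp

lemma tendsto_mul_of_tendsto_minScale {f : ℕ → ℝ}
    (hf : Tendsto (fun n : ℕ => n * (minScale n)⁻¹ * f n) atTop (𝓝 (√π * 2))) :
    Tendsto (fun n : ℕ => n / √(log n) * f n) atTop (𝓝 (2 * √(2 * π))) := by
  have h := hf.const_mul √2
  have e : √2 * (√π * 2) = 2 * √(2 * π) := by rw [sqrt_mul zero_le_two]; ring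
  rw [e] at h
  refine h.congr' ?_
  filter_upwards [eventually_one_le_minScale] with n hL
  have := sqrt_log_ne_zero hL
  rw [minScale_eq]
  field_simp

lemma isTheta_of_tendsto_minScale {f g : ℕ → ℝ}
    (hf : Tendsto (fun n : ℕ => n * (minScale n)⁻¹ * f n) atTop (𝓝 (√π * 2)))
    (hg : ∀ n, 1 ≤ n → g n = f n) : g =Θ[atTop] fun n : ℕ => √(log n) / n := by
  have h := (isEquivalent_of_tendsto_minScale hf).isTheta
  rw [isTheta_const_mul_right (by positivity)] at h
  exact EventuallyEq.trans_isTheta ((eventually_ge_atTop 1).mono hg) h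

end SupportSize
end StQP

/-! ### Assembly of the expansions and their leading orders. -/

theorem mainTheorem1
    (Ω : ℕ → Type*) [∀ n, MeasurableSpace (Ω n)]
    (P : ∀ n, Measure (Ω n)) [∀ n, IsProbabilityMeasure (P n)]
    (Q : ∀ n, Ω n → Matrix (Fin n) (Fin n) ℝ)
    (hQ : ∀ n, StQP.IsGOE (P n) (Q n)) :
    -- the support size is an almost surely well-defined random variable
    (∀ n, 1 ≤ n → ∀ᵐ ω ∂(P n), ∃! x, StQP.IsMinimizer (Q n ω) x) ∧
    (∀ n, AEMeasurable (fun ω => StQP.kappa (Q n ω)) (P n)) ∧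
    -- the three expansions
    ((fun n => (P n).real {ω | StQP.kappa (Q n ω) = 2} -
        (StQP.termS (P n) (Q n) + StQP.termA (P n) (Q n) + StQP.termB (P n) (Q n)))
      =o[atTop] fun n => StQP.termB (P n) (Q n)) ∧
    ((fun n => (P n).real {ω | 1 < StQP.kappa (Q n ω)} -
        (StQP.termS (P n) (Q n) + StQP.termA (P n) (Q n) + StQP.termB (P n) (Q n)))
      =o[atTop] fun n => StQP.termB (P n) (Q n)) ∧
    ((fun n => (P n).real {ω | StQP.kappa (Q n ω) = 1} -
        (1 - StQP.termS (P n) (Q n) - StQP.termA (P n) (Q n) - StQP.termB (P n) (Q n)))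
      =o[atTop] fun n => StQP.termB (P n) (Q n)) ∧
    -- the asymptotics of the three terms
    ((fun n => StQP.termS (P n) (Q n)) ~[atTop]
      fun n : ℕ => 2 * √(2 * Real.pi) * (√(Real.log n) / n)) ∧
    ((fun n => StQP.termA (P n) (Q n)) ~[atTop]
      fun n : ℕ => 3 * √(Real.pi / 2) * (1 / (n * √(Real.log n)))) ∧
    ((fun n => StQP.termB (P n) (Q n)) ~[atTop]
      fun n : ℕ => 9 * √(Real.pi / 2) * (1 / (n * Real.log n ^ (3 / 2 : ℝ)))) ∧
    -- the leading constants
    ((fun n => (P n).real {ω | 1 < StQP.kappa (Q n ω)}) ~[atTop]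
      fun n : ℕ => 2 * √(2 * Real.pi) * (√(Real.log n) / n)) ∧
    ((fun n => (P n).real {ω | StQP.kappa (Q n ω) = 2}) ~[atTop]
      fun n : ℕ => 2 * √(2 * Real.pi) * (√(Real.log n) / n)) ∧
    Tendsto (fun n : ℕ => n / √(Real.log n) * (P n).real {ω | 1 < StQP.kappa (Q n ω)})
      atTop (𝓝 (2 * √(2 * Real.pi))) ∧
    Tendsto (fun n : ℕ => n / √(Real.log n) * (P n).real {ω | StQP.kappa (Q n ω) = 2})
      atTop (𝓝 (2 * √(2 * Real.pi))) ∧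
    -- the probability that a vertex, and that the minimum-diagonal vertex, is optimal
    ((fun n => 1 - (P n).real {ω | StQP.kappa (Q n ω) = 1})
      =Θ[atTop] fun n : ℕ => √(Real.log n) / n) ∧
    ((fun n => 1 - (P n).real {ω | StQP.MinDiagVertexOptimal (Q n ω)})
      =Θ[atTop] fun n : ℕ => √(Real.log n) / n) := by
  have hle := fun n (hn : 2 ≤ n) => (hQ n).measureReal_kappa_eq_two_le hn
  have hge := fun n (hn : 2 ≤ n) => (hQ n).le_measureReal_one_lt_kappa hn
  have hsum := fun n => StQP.measureReal_one_lt_kappa_le (P := P n) (Q := Q n)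
  have hone := fun n (hn : 1 ≤ n) => (hQ n).measureReal_kappa_eq_one hn
  have h2 := StQP.isLittleO_termB_of_abs_le hQ (f := fun n => (P n).real {ω | StQP.kappa (Q n ω) = 2} -
    (StQP.termS (P n) (Q n) + StQP.termA (P n) (Q n) + StQP.termB (P n) (Q n))) fun n hn => by
      rw [abs_le]
      constructor <;> linarith [hle n hn, hge n hn, hsum n,
        measureReal_nonneg (μ := P n) (s := {ω | 2 < StQP.kappa (Q n ω)})]
  have hgt := StQP.isLittleO_termB_of_abs_le hQ (f := fun n => (P n).real {ω | 1 < StQP.kappa (Q n ω)} -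
    (StQP.termS (P n) (Q n) + StQP.termA (P n) (Q n) + StQP.termB (P n) (Q n))) fun n hn => by
      rw [abs_le]
      constructor <;> linarith [hle n hn, hge n hn, hsum n,
        measureReal_nonneg (μ := P n) (s := {ω | 2 < StQP.kappa (Q n ω)})]
  have h1 := StQP.isLittleO_termB_of_abs_le hQ (f := fun n => (P n).real {ω | StQP.kappa (Q n ω) = 1} -
    (1 - StQP.termS (P n) (Q n) - StQP.termA (P n) (Q n) - StQP.termB (P n) (Q n))) fun n hn => by
      rw [hone n (by omega), abs_le]
      constructor <;> linarith [hle n hn, hge n hn, hsum n,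
        measureReal_nonneg (μ := P n) (s := {ω | 2 < StQP.kappa (Q n ω)})]
  have ht2 := StQP.tendsto_of_sub_terms_isLittleO hQ h2
  have htgt := StQP.tendsto_of_sub_terms_isLittleO hQ hgt
  refine ⟨fun n hn => (hQ n).ae_existsUnique hn, fun n => (hQ n).aemeasurable_kappa, h2, hgt, h1,
    ?_, ?_, ?_, StQP.isEquivalent_of_tendsto_minScale htgt, StQP.isEquivalent_of_tendsto_minScale ht2,
    StQP.tendsto_mul_of_tendsto_minScale htgt, StQP.tendsto_mul_of_tendsto_minScale ht2,
    StQP.isTheta_of_tendsto_minScale htgt fun n hn => ?_,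
    StQP.isTheta_of_tendsto_minScale htgt fun n hn => ?_⟩
  · simpa only [(hQ _).termS_eq] using StQP.isEquivalent_integral_valS
  · simpa only [(hQ _).termA_eq] using StQP.isEquivalent_integral_valA
  · simpa only [(hQ _).termB_eq] using StQP.isEquivalent_integral_valB
  · rw [hone n hn]; ring
  · rw [(hQ n).measureReal_minDiagVertexOptimal hn, hone n hn]; ring
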